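/- Let $d\in\mathbb N$ and let $p_1,p_2,q_1,q_2\in[1,\infty]$ and $q\in[2,\infty]$ satisfy $p_1,p_2,q_1,q_2\le q$, $$\frac1{p_1}+\frac1{p_2}\ge 1\qquad\text{and}\qquad \frac1{q_1}+\frac1{q_2}\ge 1 ,$$ where $1/\infty=0$. For a non-zero window $g\in\mathcal S(\mathbb R^d)$, $f\in\mathcal S'(\mathbb R^d)$ and $1\le p,r\le\infty$ put $$V_gf(x,\xi)=\langle f,M_\xi T_xg\rangle=\int_{\mathbb R^d} f(t)\,\overline{g(t-x)}\,e^{-2\pi i t\cdot\xi}\,dt,\qquad \|f\|_{M^{p,r}(\mathbb R^d)}=\Big(\int_{\mathbb R^d}\Big(\int_{\mathbb R^d}|V_gf(x,\xi)|^p\,dx\Big)^{r/p}d\xi\Big)^{1/r}$$ (with the usual changes if $p=\infty$ or $r=\infty$), and let $M^{p,r}(\mathbb R^d)$ be the set of $f\in\mathcal S'(\mathbb R^d)$ for which this norm is finite. The (cross-)ambiguity function $$A(f_1,f_2)(x,\xi)=\int_{\mathbb R^d}e^{-2\pi i t\cdot\xi}f_1\big(t+\tfrac x2\big)\overline{f_2\big(t-\tfrac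 x2\big)}\,dt$$ is extended to $f_1,f_2\in\mathcal S'(\mathbb R^d)$ as a tempered distribution on $\mathbb R^{2d}$: it is the partial Fourier transform in $t$ of the tensor product $f_1\otimes\overline{f_2}$ in the coordinates $(x,t)$ given by $u=t+\frac x2$, $v=t-\frac x2$. Then, for any non-zero windows $g_1,g_2\in\mathcal S(\mathbb R^d)$ used to define the norms of $M^{p_1,q_1}(\mathbb R^d)$ and $M^{p_2,q_2}(\mathbb R^d)$ respectively, there is a constant $C<\infty$, depending only on $d,p_1,p_2,q_1,q_2,q,g_1,g_2$, such that for all $f_1\in M^{p_1,q_1}(\mathbb R^d)$ and $f_2\in M^{p_2,q_2}(\mathbb R^d)$ the ambiguity function $A(f_1,f_2)$ belongs to $L^q(\mathbb R^{2d})$ and $$\|A(f_1,f_2)\|_{L^q(\mathbb R^{2d})}\le C\,\|f_1\|_{M^{p_1,q_1}(\mathbb R^d)}\,\|f_2\|_{M^{p_2,q_2}(\mathbb R^d)} .$$ -/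

import Mathlib

open MeasureTheory SchwartzMap LineDeriv FourierTransform
open scoped ENNReal NNReal ContDiff

noncomputable section
namespace TimeFreq

section General
variable {X Y E F V : Type} [NormedAddCommGroup X] [NormedSpace ℝ X]
  [NormedAddCommGroup Y] [NormedSpace ℝ Y] [FiniteDimensional ℝ Y]
  [NormedAddCommGroup E] [NormedSpace ℝ E]
  [NormedAddCommGroup F] [NormedSpace ℝ F]

theorem smooth_of_closed (A : 𝓢(X, ℂ) → Y → ℂ) (D : Y → 𝓢(X, ℂ) →L[ℂ] 𝓢(X, ℂ))
    (hD : ∀ Φ y, ∃ L : Y →L[ℝ] ℂ, HasFDerivAt (A Φ) L y ∧ ∀ v, L v = A (D v Φ) y) (n : ℕ) :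
    ∀ Φ, ContDiff ℝ n (A Φ) := by
  have hd : ∀ Φ, Differentiable ℝ (A Φ) := fun Φ y => by
    obtain ⟨L, h, -⟩ := hD Φ y
    exact h.differentiableAt
  have hf : ∀ Φ v, (fun y => fderiv ℝ (A Φ) y v) = A (D v Φ) := fun Φ v => by
    ext y
    obtain ⟨L, h, h'⟩ := hD Φ y
    rw [h.fderiv, h']
  induction n with
  | zero => exact fun Φ => contDiff_zero.2 (hd Φ).continuous
  | succ n ih =>
    intro Φ
    push_cast
    rw [contDiff_succ_iff_fderiv_apply]
    refine ⟨hd Φ, by simp, fun v => ?_⟩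
    rw [hf]
    exact ih _

theorem decay_of_closed (A : 𝓢(X, ℂ) → Y → ℂ) (D : Y → 𝓢(X, ℂ) →L[ℂ] 𝓢(X, ℂ))
    (hD : ∀ Φ y, ∃ L : Y →L[ℝ] ℂ, HasFDerivAt (A Φ) L y ∧ ∀ v, L v = A (D v Φ) y)
    (hb : ∀ k : ℕ, ∃ q : Seminorm ℂ 𝓢(X, ℂ), Continuous q ∧ ∀ Φ y, ‖y‖ ^ k * ‖A Φ y‖ ≤ q Φ)
    (k n : ℕ) : ∃ q : Seminorm ℂ 𝓢(X, ℂ), Continuous q ∧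
      ∀ Φ y, ‖y‖ ^ k * ‖iteratedFDeriv ℝ n (A Φ) y‖ ≤ q Φ := by
  induction n with
  | zero => simpa using hb k
  | succ n ih =>
    obtain ⟨q, hq, h⟩ := ih
    let b := Module.finBasis ℝ Y
    let c : Fin (Module.finrank ℝ Y) → (Y →L[ℝ] ℝ) := fun i => (b.coord i).toContinuousLinearMap
    let ι : Fin (Module.finrank ℝ Y) → (ℂ →L[ℝ] (Y →L[ℝ] ℂ)) := fun i =>
      ContinuousLinearMap.smulRightL ℝ Y ℂ (c i)
    have hfd : ∀ Φ, fderiv ℝ (A Φ) = fun y => ∑ i, ι i (A (D (b i) Φ) y) := by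
      intro Φ
      ext y v
      obtain ⟨L, h1, h2⟩ := hD Φ y
      rw [h1.fderiv]
      conv_lhs => rw [← b.sum_repr v, map_sum]
      simp only [map_smul, h2 (b _)]
      simp [ι, c]
    refine ⟨∑ i, ‖ι i‖₊ • q.comp (D (b i)).toLinearMap, ?_, ?_⟩
    · have : (⇑(∑ i, ‖ι i‖₊ • q.comp (D (b i)).toLinearMap)
          : 𝓢(X, ℂ) → ℝ) = fun Φ => ∑ i, ‖ι i‖ * q (D (b i) Φ) := by
        ext Φ
        simp [NNReal.smul_def]
      rw [this]
      exact continuous_finsetSum _ fun i _ => continuous_const.mul (hq.comp (D (b i)).continuous)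
    · intro Φ y
      have hs : ∀ i, ContDiff ℝ n (fun y => ι i (A (D (b i) Φ) y)) := fun i =>
        (ι i).contDiff.comp (smooth_of_closed A D hD n _)
      rw [← norm_iteratedFDeriv_fderiv, hfd, iteratedFDeriv_fun_sum_apply (fun i _ => (hs i).contDiffAt)]
      have : (∑ i, ‖ι i‖₊ • q.comp (D (b i)).toLinearMap) Φ
          = ∑ i, ‖ι i‖ * q (D (b i) Φ) := by
        simp [NNReal.smul_def]
      rw [this]
      calc _ ≤ ‖y‖ ^ k * ∑ i, ‖ι i‖ * ‖iteratedFDeriv ℝ n (A (D (b i) Φ)) y‖ := by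
            gcongr
            refine (norm_sum_le _ _).trans (Finset.sum_le_sum fun i _ => ?_)
            exact (ι i).norm_iteratedFDeriv_comp_left
              (smooth_of_closed A D hD n _).contDiffAt le_rfl
        _ ≤ _ := by
            rw [Finset.mul_sum]
            refine Finset.sum_le_sum fun i _ => ?_
            have := h (D (b i) Φ) y
            calc _ = ‖ι i‖ * (‖y‖ ^ k * ‖iteratedFDeriv ℝ n (A (D (b i) Φ)) y‖) := by ring
              _ ≤ _ := by gcongr

/-- Assemble a continuous linear map between Schwartz spaces from a family that is closed under
differentiation. -/
def mkClosed (A : 𝓢(X, ℂ) → Y → ℂ) (hadd : ∀ f g y, A (f + g) y = A f y + A g y)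
    (hsmul : ∀ (a : ℂ) f y, A (a • f) y = a • A f y) (D : Y → 𝓢(X, ℂ) →L[ℂ] 𝓢(X, ℂ))
    (hD : ∀ Φ y, ∃ L : Y →L[ℝ] ℂ, HasFDerivAt (A Φ) L y ∧ ∀ v, L v = A (D v Φ) y)
    (hb : ∀ k : ℕ, ∃ q : Seminorm ℂ 𝓢(X, ℂ), Continuous q ∧ ∀ Φ y, ‖y‖ ^ k * ‖A Φ y‖ ≤ q Φ) :
    𝓢(X, ℂ) →L[ℂ] 𝓢(Y, ℂ) :=
  SchwartzMap.mkCLM (σ := RingHom.id ℂ) A hadd hsmul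
    (fun Φ => contDiff_infty.2 fun n => smooth_of_closed A D hD n Φ) (by
      rintro ⟨k, n⟩
      obtain ⟨q, hq, h⟩ := decay_of_closed A D hD hb k n
      obtain ⟨s, C, -, hC⟩ := Seminorm.bound_of_continuous (schwartz_withSeminorms ℂ X ℂ) q hq
      exact ⟨s, C, C.2, fun f x => (h f x).trans (hC f)⟩)


/-- The slice `y ↦ Φ (x, y)` of a Schwartz function on a product. -/
def slice (x : E) : 𝓢(E × F, ℂ) →L[ℂ] 𝓢(F, ℂ) :=
  SchwartzMap.compCLM ℂ (g := fun y : F => (x, y))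
    ((Function.HasTemperateGrowth.const (x, (0 : F))).add
      (ContinuousLinearMap.inr ℝ E F).hasTemperateGrowth |> fun h => by
        convert h using 1
        ext y <;> simp)
    ⟨1, 1, fun y => by
      have := norm_snd_le (x, y)
      simp only [one_mul, pow_one]
      linarith⟩

@[simp] theorem slice_apply (x : E) (Φ : 𝓢(E × F, ℂ)) (y : F) : slice x Φ y = Φ (x, y) := rfl

theorem norm_iteratedFDeriv_slice (x : E) (Φ : 𝓢(E × F, ℂ)) (n : ℕ) (y : F) :
    ‖iteratedFDeriv ℝ n (slice x Φ) y‖ ≤ ‖iteratedFDeriv ℝ n Φ (x, y)‖ := by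
  have h1 : (slice x Φ : F → ℂ) =
      (fun w => Φ ((x, 0) + w)) ∘ (ContinuousLinearMap.inr ℝ E F) := by
    ext y
    simp
  have hs : ContDiff ℝ n (fun w : E × F => Φ ((x, 0) + w)) :=
    (Φ.smooth n).comp (contDiff_const.add contDiff_id)
  rw [h1, ContinuousLinearMap.iteratedFDeriv_comp_right _ hs _ le_rfl]
  refine (ContinuousMultilinearMap.norm_compContinuousLinearMap_le _ _).trans ?_
  rw [iteratedFDeriv_comp_add_left]
  have h2 : (x, (0 : F)) + ContinuousLinearMap.inr ℝ E F y = (x, y) := by simp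
  rw [h2]
  refine mul_le_of_le_one_right (norm_nonneg _) ?_
  exact Finset.prod_le_one (fun _ _ => norm_nonneg _)
    fun _ _ => ContinuousLinearMap.norm_inr_le_one ℝ E F

theorem slice_bound (k : ℕ) (q : Seminorm ℂ 𝓢(F, ℂ)) (hq : Continuous q) :
    ∃ q' : Seminorm ℂ 𝓢(E × F, ℂ), Continuous q' ∧ ∀ x Φ, ‖x‖ ^ k * q (slice x Φ) ≤ q' Φ := by
  obtain ⟨s, C, -, hC⟩ := Seminorm.bound_of_continuous (schwartz_withSeminorms ℂ F ℂ) q hq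
  refine ⟨C • ∑ i ∈ s, schwartzSeminormFamily ℂ (E × F) ℂ (k + i.1, i.2), ?_, ?_⟩
  · have : (⇑(C • ∑ i ∈ s, schwartzSeminormFamily ℂ (E × F) ℂ (k + i.1, i.2))
          : 𝓢(E × F, ℂ) → ℝ) = fun Φ => C * ∑ i ∈ s, schwartzSeminormFamily ℂ (E × F) ℂ (k + i.1, i.2) Φ := by
      ext Φ
      simp [NNReal.smul_def]
    rw [this]
    exact continuous_const.mul (continuous_finsetSum _ fun i _ =>
      (schwartz_withSeminorms ℂ (E × F) ℂ).continuous_seminorm _)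
  · intro x Φ
    have h0 : (C • ∑ i ∈ s, schwartzSeminormFamily ℂ (E × F) ℂ (k + i.1, i.2)) Φ
        = C * ∑ i ∈ s, schwartzSeminormFamily ℂ (E × F) ℂ (k + i.1, i.2) Φ := by
      simp [NNReal.smul_def]
    rw [h0]
    have h1 : ∀ i : ℕ × ℕ, ‖x‖ ^ k * schwartzSeminormFamily ℂ F ℂ i (slice x Φ) ≤
        schwartzSeminormFamily ℂ (E × F) ℂ (k + i.1, i.2) Φ := by
      rintro ⟨a, b⟩
      rcases eq_or_ne (‖x‖ ^ k) 0 with h | h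
      · rw [h, zero_mul]
        positivity
      have hp : 0 < ‖x‖ ^ k := lt_of_le_of_ne (by positivity) h.symm
      rw [mul_comm, ← le_div_iff₀ hp]
      refine SchwartzMap.seminorm_le_bound ℂ a b _ (by positivity) fun y => ?_
      rw [le_div_iff₀ hp]
      calc _ ≤ ‖(x, y)‖ ^ a * ‖iteratedFDeriv ℝ b Φ (x, y)‖ * ‖(x, y)‖ ^ k := by
            gcongr
            · exact norm_snd_le (x, y)
            · exact norm_iteratedFDeriv_slice x Φ b y
            · exact norm_fst_le (x, y)
        _ = ‖(x, y)‖ ^ (k + a) * ‖iteratedFDeriv ℝ b Φ (x, y)‖ := by ring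
        _ ≤ _ := SchwartzMap.le_seminorm ℂ (k + a) b Φ (x, y)
    calc _ ≤ ‖x‖ ^ k * (C * ∑ i ∈ s, schwartzSeminormFamily ℂ F ℂ i (slice x Φ)) := by
          gcongr
          refine (hC _).trans ?_
          simp only [smul_apply, NNReal.smul_def, smul_eq_mul]
          gcongr
          simpa using
            Seminorm.le_def.1 (Seminorm.finset_sup_le_sum (schwartzSeminormFamily ℂ F ℂ) s) (slice x Φ)
      _ = C * ∑ i ∈ s, ‖x‖ ^ k * schwartzSeminormFamily ℂ F ℂ i (slice x Φ) := by
          rw [Finset.mul_sum, Finset.mul_sum, Finset.mul_sum]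
          exact Finset.sum_congr rfl fun i _ => by ring
      _ ≤ _ := by
          gcongr with i
          exact h1 i

/-- The first order Taylor remainder of a Schwartz function. -/
def taylorRem [NormedAddCommGroup V] [NormedSpace ℝ V] (w : X) (Φ : 𝓢(X, V)) : 𝓢(X, V) :=
  SchwartzMap.compSubConstCLM ℝ (-w) Φ - Φ - ∂_{w} Φ

theorem taylorRem_apply [NormedAddCommGroup V] [NormedSpace ℝ V] (w : X) (Φ : 𝓢(X, V)) (z : X) :
    taylorRem w Φ z = Φ (z + w) - Φ z - fderiv ℝ Φ z w := by
  simp [taylorRem, SchwartzMap.lineDerivOp_apply_eq_fderiv]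

theorem fderivCLM_taylorRem [NormedAddCommGroup V] [NormedSpace ℝ V] (w : X) (Φ : 𝓢(X, V)) :
    fderivCLM ℝ X V (taylorRem w Φ) = taylorRem w (fderivCLM ℝ X V Φ) := by
  ext z v
  have h1 : fderiv ℝ (SchwartzMap.compSubConstCLM ℝ (-w) Φ) z = fderiv ℝ Φ (z + w) := by
    have : (SchwartzMap.compSubConstCLM ℝ (-w) Φ : X → V) = fun y => Φ (y + w) := by
      ext y
      simp
    rw [this, fderiv_comp_add_right]
  have hd : DifferentiableAt ℝ (fderiv ℝ Φ) z :=
    ((fderivCLM ℝ X V Φ).hasFDerivAt z).differentiableAt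
  have h2 : fderiv ℝ (∂_{w} Φ : 𝓢(X, V)) z v = fderiv ℝ (fderiv ℝ Φ) z w v := by
    have : ((∂_{w} Φ : 𝓢(X, V)) : X → V) = fun y => fderiv ℝ Φ y w := by
      ext y
      rw [SchwartzMap.lineDerivOp_apply_eq_fderiv]
    rw [this, fderiv_clm_apply hd (differentiableAt_const w)]
    have hsym : IsSymmSndFDerivAt ℝ Φ z :=
      (Φ.smooth 2).contDiffAt.isSymmSndFDerivAt (by simp)
    simpa using hsym.eq v w
  rw [taylorRem_apply]
  simp only [taylorRem, map_sub, sub_apply, fderivCLM_apply, h1, h2]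
  rfl

theorem taylor_two [NormedAddCommGroup V] [NormedSpace ℝ V] (Φ : 𝓢(X, V)) (z w : X) (M : ℝ)
    (hM : ∀ u ∈ Metric.closedBall z ‖w‖, ‖fderiv ℝ (fderivCLM ℝ X V Φ) u‖ ≤ M) :
    ‖Φ (z + w) - Φ z - fderiv ℝ Φ z w‖ ≤ M * ‖w‖ ^ 2 := by
  have hz : z ∈ Metric.closedBall z ‖w‖ := by simp
  have hw : z + w ∈ Metric.closedBall z ‖w‖ := by simp
  have hc : Convex ℝ (Metric.closedBall z ‖w‖) := convex_closedBall z _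
  have hM0 : 0 ≤ M := le_trans (by positivity) (hM z hz)
  have h1 : ∀ u ∈ Metric.closedBall z ‖w‖, ‖fderiv ℝ Φ u - fderiv ℝ Φ z‖ ≤ M * ‖w‖ := by
    intro u hu
    refine (hc.norm_image_sub_le_of_norm_hasFDerivWithin_le
      (fun y _ => ((fderivCLM ℝ X V Φ).hasFDerivAt y).hasFDerivWithinAt) hM hz hu).trans ?_
    gcongr
    simpa [dist_eq_norm] using hu
  have := hc.norm_image_sub_le_of_norm_hasFDerivWithin_le'
    (fun y _ => (Φ.hasFDerivAt y).hasFDerivWithinAt) h1 hz hw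
  simp only [add_sub_cancel_left] at this
  linarith [this, show M * ‖w‖ * ‖w‖ = M * ‖w‖ ^ 2 by ring]

theorem taylorRem_bound (k n : ℕ) : ∀ (V : Type) [NormedAddCommGroup V] [NormedSpace ℝ V]
    (Φ : 𝓢(X, V)), ∃ C, 0 ≤ C ∧ ∀ w, ‖w‖ ≤ 1 → ∀ z,
      ‖z‖ ^ k * ‖iteratedFDeriv ℝ n (taylorRem w Φ) z‖ ≤ C * ‖w‖ ^ 2 := by
  induction n with
  | zero =>
    intro V _ _ Φ
    let K : ℝ := 2 ^ k * (Finset.Iic (k, 1)).sup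
      (fun m => SchwartzMap.seminorm ℝ m.1 m.2) (fderivCLM ℝ X V Φ)
    have hK : 0 ≤ K := by positivity
    refine ⟨K, hK, fun w hw z => ?_⟩
    rw [norm_iteratedFDeriv_zero, taylorRem_apply]
    rcases eq_or_ne (‖z‖ ^ k) 0 with h | h
    · rw [h, zero_mul]
      positivity
    have hp : 0 < ‖z‖ ^ k := lt_of_le_of_ne (by positivity) h.symm
    have := taylor_two Φ z w (K / ‖z‖ ^ k) fun u hu => by
      rw [le_div_iff₀' hp]
      have hzu : ‖z‖ ≤ 1 + ‖u‖ := by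
        have h1 : ‖u - z‖ ≤ 1 := by
          rw [← dist_eq_norm]
          exact (Metric.mem_closedBall.1 hu).trans hw
        have h2 : ‖z‖ ≤ ‖u - z‖ + ‖u‖ := by
          have := norm_sub_le u (u - z)
          simp only [sub_sub_cancel] at this
          linarith
        linarith
      calc _ ≤ (1 + ‖u‖) ^ k * ‖fderiv ℝ (fderivCLM ℝ X V Φ) u‖ := by gcongr
        _ ≤ K := by
          rw [← norm_iteratedFDeriv_one]
          exact SchwartzMap.one_add_le_sup_seminorm_apply (𝕜 := ℝ) (m := (k, 1)) le_rfl le_rfl _ u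
    calc _ ≤ ‖z‖ ^ k * (K / ‖z‖ ^ k * ‖w‖ ^ 2) := by gcongr
      _ = _ := by field_simp
  | succ n ih =>
    intro V _ _ Φ
    obtain ⟨C, hC, h⟩ := ih _ (fderivCLM ℝ X V Φ)
    refine ⟨C, hC, fun w hw z => ?_⟩
    rw [← norm_iteratedFDeriv_fderiv]
    have := h w hw z
    rw [← fderivCLM_taylorRem] at this
    exact this

theorem taylorRem_seminorm (q : Seminorm ℂ 𝓢(X, ℂ)) (hq : Continuous q) (Φ : 𝓢(X, ℂ)) :
    ∃ C, 0 ≤ C ∧ ∀ w, ‖w‖ ≤ 1 → q (taylorRem w Φ) ≤ C * ‖w‖ ^ 2 := by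
  obtain ⟨s, C, -, hC⟩ := Seminorm.bound_of_continuous (schwartz_withSeminorms ℂ X ℂ) q hq
  choose c hc h using fun i : ℕ × ℕ => taylorRem_bound i.1 i.2 ℂ Φ
  refine ⟨C * ∑ i ∈ s, c i, mul_nonneg C.2 (Finset.sum_nonneg fun i _ => hc i), fun w hw => ?_⟩
  calc q (taylorRem w Φ) ≤ C * ∑ i ∈ s, schwartzSeminormFamily ℂ X ℂ i (taylorRem w Φ) := by
        refine (hC _).trans ?_
        simp only [smul_apply, NNReal.smul_def, smul_eq_mul]
        gcongr
        simpa using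
          Seminorm.le_def.1 (Seminorm.finset_sup_le_sum (schwartzSeminormFamily ℂ X ℂ) s) _
    _ ≤ C * ∑ i ∈ s, c i * ‖w‖ ^ 2 := by
        gcongr with i
        exact SchwartzMap.seminorm_le_bound ℂ _ _ _ (mul_nonneg (hc i) (by positivity)) (h i w hw)
    _ = _ := by rw [← Finset.sum_mul, mul_assoc]

/-- The partial pairing `x ↦ T (Φ (x, ·))` of a tempered distribution `T` with a Schwartz function
of two variables. -/
def partialPairing [FiniteDimensional ℝ E] (T : 𝓢(F, ℂ) →L[ℂ] ℂ) : 𝓢(E × F, ℂ) →L[ℂ] 𝓢(E, ℂ) :=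
  mkClosed (fun Φ x => T (slice x Φ)) (fun f g x => by simp) (fun a f x => by simp)
    (fun v => LineDeriv.lineDerivOpCLM ℂ 𝓢(E × F, ℂ) (v, (0 : F)))
    (fun Φ x => by
      let L : E →ₗ[ℝ] ℂ :=
        { toFun := fun v => T (slice x (∂_{(v, (0 : F))} Φ))
          map_add' := fun v w => by
            have : ((v + w, 0) : E × F) = (v, 0) + (w, 0) := by simp
            rw [this, LineDeriv.lineDerivOp_left_add]
            simp
          map_smul' := fun a v => by
            have : ((a • v, 0) : E × F) = a • (v, 0) := by simp
            rw [this, LineDeriv.lineDerivOp_left_smul]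
            simp [← Complex.coe_smul] }
      refine ⟨L.toContinuousLinearMap, ?_, fun v => rfl⟩
      let q : Seminorm ℂ 𝓢(E × F, ℂ) := (normSeminorm ℂ ℂ).comp (T ∘L slice x).toLinearMap
      have hq : Continuous q := continuous_norm.comp (T ∘L slice x).continuous
      obtain ⟨C, hC, h⟩ := taylorRem_seminorm q hq Φ
      rw [hasFDerivAt_iff_isLittleO_nhds_zero]
      refine Asymptotics.IsBigO.trans_isLittleO (g := fun v : E => ‖v‖ ^ 2) ?_ ?_
      · refine Asymptotics.IsBigO.of_bound C ?_
        filter_upwards [Metric.closedBall_mem_nhds (0 : E) one_pos] with v hv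
        have hv1 : ‖((v, 0) : E × F)‖ = ‖v‖ := by simp
        have := h (v, 0) (by rw [hv1]; simpa using hv)
        rw [hv1] at this
        simp only [norm_pow, norm_norm]
        have hs : slice x (SchwartzMap.compSubConstCLM ℝ (-(v, (0 : F))) Φ) = slice (x + v) Φ := by
          ext y
          simp
        have hr : T (slice x (taylorRem (v, 0) Φ)) = T (slice (x + v) Φ) - T (slice x Φ) -
            T (slice x (∂_{(v, (0 : F))} Φ)) := by
          rw [taylorRem, map_sub, map_sub, map_sub, map_sub, hs]
        change ‖T (slice (x + v) Φ) - T (slice x Φ) - T (slice x (∂_{(v, (0 : F))} Φ))‖ ≤ _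
        rw [← hr]
        exact this
      · simpa using Asymptotics.isLittleO_norm_pow_id one_lt_two (E' := E))
    (fun k => by
      obtain ⟨q, hq, h⟩ := slice_bound (E := E) k ((normSeminorm ℂ ℂ).comp T.toLinearMap)
        (continuous_norm.comp T.continuous)
      exact ⟨q, hq, fun Φ x => h x Φ⟩)

@[simp] theorem partialPairing_apply [FiniteDimensional ℝ E] (T : 𝓢(F, ℂ) →L[ℂ] ℂ) (Φ : 𝓢(E × F, ℂ)) (x : E) :
    partialPairing T Φ x = T (slice x Φ) := rfl

end General
section PartialFourier
variable {E F : Type} [NormedAddCommGroup E] [NormedSpace ℝ E]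
  [NormedAddCommGroup F] [InnerProductSpace ℝ F] [FiniteDimensional ℝ F]
  [MeasurableSpace F] [BorelSpace F]
  {X : Type} [NormedAddCommGroup X] [NormedSpace ℝ X]

/-- The derivative of `(x, t) ↦ exp (-2 π i ξ · t) Φ (x, ξ)` -/
def pfDeriv (p : X →L[ℝ] E) (r : X →L[ℝ] F) (Φ : 𝓢(E × F, ℂ)) (z : X) (ξ : F) : X →L[ℝ] ℂ :=
  Complex.exp (↑(-2 * Real.pi * inner ℝ ξ (r z)) * Complex.I) •
    ((fderiv ℝ Φ (p z, ξ)).comp ((ContinuousLinearMap.inl ℝ E F).comp p)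
      + (ContinuousLinearMap.smulRight ((innerSL ℝ ξ).comp r)
          (-2 * Real.pi * Complex.I * Φ (p z, ξ))))

theorem hasFDerivAt_pf (p : X →L[ℝ] E) (r : X →L[ℝ] F) (Φ : 𝓢(E × F, ℂ)) (z : X) (ξ : F) :
    HasFDerivAt (fun w : X => Complex.exp (↑(-2 * Real.pi * inner ℝ ξ (r w)) * Complex.I) •
      Φ (p w, ξ)) (pfDeriv p r Φ z ξ) z := by
  have h1 : HasFDerivAt (fun w : X => Φ (p w, ξ)) ((fderiv ℝ Φ (p z, ξ)).comp
      ((ContinuousLinearMap.inl ℝ E F).comp p)) z := by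
    refine (Φ.hasFDerivAt (p z, ξ)).comp z ?_
    have := (p.hasFDerivAt (x := z)).prodMk (hasFDerivAt_const ξ z)
    convert! this using 1
  have h2 : HasFDerivAt (fun w : X => ((inner ℝ ξ (r w) : ℝ) : ℂ))
      (Complex.ofRealCLM.comp ((innerSL ℝ ξ).comp r)) z :=
    (Complex.ofRealCLM.comp ((innerSL ℝ ξ).comp r)).hasFDerivAt
  have h3 := ((h2.const_mul (-2 * Real.pi : ℂ)).mul_const Complex.I).cexp
  have h4 := h3.smul h1
  convert! h4 using 1
  · ext w
    simp
  · ext w <;> simp [pfDeriv] <;> ring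

theorem integrable_bound (p : X →L[ℝ] E) (r : X →L[ℝ] F) (Φ : 𝓢(E × F, ℂ)) : ∃ bound : F → ℝ, Integrable bound ∧
    ∀ z ξ, ‖pfDeriv p r Φ z ξ‖ ≤ bound ξ := by
  let N := (volume : Measure F).integrablePower
  let K : ℝ := 2 ^ (N + 1) * (Finset.Iic (N + 1, 1)).sup
      (fun m => SchwartzMap.seminorm ℝ m.1 m.2) Φ
  refine ⟨fun ξ => (‖p‖ + 2 * Real.pi * ‖r‖) * K * (1 + ‖ξ‖) ^ (-(N : ℝ)),
    (Measure.integrable_pow_neg_integrablePower volume).const_mul _, fun z ξ => ?_⟩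
  have hz : ‖ξ‖ ≤ ‖(p z, ξ)‖ := norm_snd_le (p z, ξ)
  have hp : 0 < (1 + ‖ξ‖) ^ N := by positivity
  have e1 : (1 + ‖ξ‖) ^ N * ‖fderiv ℝ Φ (p z, ξ)‖ ≤ K := by
    rw [← norm_iteratedFDeriv_one]
    calc _ ≤ (1 + ‖(p z, ξ)‖) ^ (N + 1) * ‖iteratedFDeriv ℝ 1 Φ (p z, ξ)‖ := by
          gcongr
          calc (1 + ‖ξ‖) ^ N ≤ (1 + ‖(p z, ξ)‖) ^ N := by gcongr
            _ ≤ _ := pow_le_pow_right₀ (by linarith [norm_nonneg (p z, ξ)]) (by simp)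
      _ ≤ K := SchwartzMap.one_add_le_sup_seminorm_apply (𝕜 := ℝ) (m := (N + 1, 1)) le_rfl le_rfl _ _
  have e2 : (1 + ‖ξ‖) ^ N * (‖ξ‖ * ‖Φ (p z, ξ)‖) ≤ K := by
    calc _ ≤ (1 + ‖(p z, ξ)‖) ^ N * ((1 + ‖(p z, ξ)‖) * ‖iteratedFDeriv ℝ 0 Φ (p z, ξ)‖) := by
          rw [norm_iteratedFDeriv_zero]
          gcongr
          linarith
      _ = (1 + ‖(p z, ξ)‖) ^ (N + 1) * ‖iteratedFDeriv ℝ 0 Φ (p z, ξ)‖ := by ring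
      _ ≤ K := SchwartzMap.one_add_le_sup_seminorm_apply (𝕜 := ℝ) (m := (N + 1, 1)) le_rfl
        zero_le_one _ _
  have e3 : ‖pfDeriv p r Φ z ξ‖ ≤ ‖fderiv ℝ Φ (p z, ξ)‖ * ‖p‖ +
      2 * Real.pi * ((‖ξ‖ * ‖Φ (p z, ξ)‖) * ‖r‖) := by
    rw [pfDeriv, norm_smul, Complex.norm_exp_ofReal_mul_I, one_mul]
    refine (norm_add_le _ _).trans (add_le_add ?_ ?_)
    · refine (ContinuousLinearMap.opNorm_comp_le _ _).trans ?_
      gcongr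
      refine (ContinuousLinearMap.opNorm_comp_le _ _).trans ?_
      exact mul_le_of_le_one_left (norm_nonneg _) (ContinuousLinearMap.norm_inl_le_one ℝ E F)
    · rw [ContinuousLinearMap.norm_smulRight_apply]
      have h1 : ‖(innerSL ℝ ξ).comp r‖ ≤ ‖ξ‖ * ‖r‖ := by
        refine (ContinuousLinearMap.opNorm_comp_le _ _).trans ?_
        rw [innerSL_apply_norm]
      have h2 : ‖(-2 * Real.pi * Complex.I * Φ (p z, ξ) : ℂ)‖ = 2 * Real.pi * ‖Φ (p z, ξ)‖ := by
        simp [abs_of_pos Real.pi_pos]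
      rw [h2]
      calc _ ≤ ‖ξ‖ * ‖r‖ * (2 * Real.pi * ‖Φ (p z, ξ)‖) := by gcongr
        _ = _ := by ring
  refine e3.trans ?_
  beta_reduce
  rw [Real.rpow_neg (by positivity), Real.rpow_natCast, ← div_eq_mul_inv, le_div_iff₀ hp]
  calc _ = (1 + ‖ξ‖) ^ N * ‖fderiv ℝ Φ (p z, ξ)‖ * ‖p‖ +
        2 * Real.pi * ((1 + ‖ξ‖) ^ N * (‖ξ‖ * ‖Φ (p z, ξ)‖) * ‖r‖) := by ring
    _ ≤ K * ‖p‖ + 2 * Real.pi * (K * ‖r‖) := by gcongr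
    _ = _ := by ring

theorem hasFDerivAt_partialFourier (p : X →L[ℝ] E) (r : X →L[ℝ] F) (Φ : 𝓢(E × F, ℂ)) (z : X) :
    HasFDerivAt (fun w : X => 𝓕 (slice (p w) Φ) (r w)) (∫ ξ, pfDeriv p r Φ z ξ) z ∧
      ∀ v, (∫ ξ, pfDeriv p r Φ z ξ) v = ∫ ξ, pfDeriv p r Φ z ξ v := by
  obtain ⟨b, hb, h⟩ := integrable_bound p r Φ
  have hcont : Continuous (pfDeriv p r Φ z) := by
    have hf : Continuous (fderiv ℝ Φ) := (fderivCLM ℝ (E × F) ℂ Φ).continuous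
    have hΦ := Φ.continuous
    unfold pfDeriv
    have h1 : Continuous fun ξ : F => ContinuousLinearMap.smulRight
      ((innerSL ℝ ξ).comp r) (-2 * Real.pi * Complex.I * Φ (p z, ξ)) := by
      have := (ContinuousLinearMap.smulRightL ℝ X ℂ).continuous₂
      refine this.comp (f := fun ξ : F => ((innerSL ℝ ξ).comp r,
        (-2 * Real.pi * Complex.I * Φ (p z, ξ)))) ?_
      fun_prop
    have h2 : Continuous fun ξ : F => (fderiv ℝ Φ (p z, ξ)).comp
        ((ContinuousLinearMap.inl ℝ E F).comp p) := by
      fun_prop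
    have h3 : Continuous fun ξ : F =>
        Complex.exp (↑(-2 * Real.pi * inner ℝ ξ (r z)) * Complex.I) := by fun_prop
    exact h3.smul (h2.add h1)
  refine ⟨?_, fun v => (ContinuousLinearMap.integral_apply
    (hb.mono' hcont.aestronglyMeasurable (Filter.Eventually.of_forall (h z))) v).symm ▸ rfl⟩
  have key := hasFDerivAt_integral_of_dominated_of_fderiv_le (μ := (volume : Measure F)) (𝕜 := ℝ)
    (F := fun (w : X) ξ => Complex.exp (↑(-2 * Real.pi * inner ℝ ξ (r w)) * Complex.I) •
      Φ (p w, ξ)) (F' := pfDeriv p r Φ) (x₀ := z) (s := Set.univ) (bound := b) Filter.univ_mem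
    (Filter.Eventually.of_forall fun w => by
      have hΦ := Φ.continuous
      exact Continuous.aestronglyMeasurable (by fun_prop))
    (by
      have h1 : Integrable (slice (p z) Φ) := (slice (p z) Φ).integrable
      refine h1.mono ?_ (Filter.Eventually.of_forall fun ξ => ?_)
      · have hΦ := Φ.continuous
        exact Continuous.aestronglyMeasurable (by fun_prop)
      · rw [norm_smul, Complex.norm_exp_ofReal_mul_I, one_mul, slice_apply])
    hcont.aestronglyMeasurable
    (Filter.Eventually.of_forall fun ξ w _ => h w ξ) hb
    (Filter.Eventually.of_forall fun ξ w _ => hasFDerivAt_pf p r Φ w ξ)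
  convert! key using 1
  ext w
  rw [SchwartzMap.fourier_coe, Real.fourier_eq']
  simp

/-- The partial Fourier transform `(x, t) ↦ ∫ exp (-2 π i t · ξ) Φ (x, ξ) dξ` of a Schwartz
function in its second variable. -/
def partialFourier [FiniteDimensional ℝ E] : 𝓢(E × F, ℂ) →L[ℂ] 𝓢(E × F, ℂ) :=
  mkClosed (fun Φ z => 𝓕 (slice z.1 Φ) z.2) (fun f g z => by simp [FourierAdd.fourier_add])
    (fun a f z => by simp [FourierSMul.fourier_smul])
    (fun v => LineDeriv.lineDerivOpCLM ℂ 𝓢(E × F, ℂ) (v.1, (0 : F)) +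
      (-2 * Real.pi * Complex.I : ℂ) • SchwartzMap.smulLeftCLM ℂ
        (fun z : E × F => ((inner ℝ v.2 z.2 : ℝ) : ℂ)))
    (fun Φ z => by
      obtain ⟨h1, h2⟩ := hasFDerivAt_partialFourier (ContinuousLinearMap.fst ℝ E F)
        (ContinuousLinearMap.snd ℝ E F) Φ z
      refine ⟨_, h1, fun v => ?_⟩
      rw [h2, SchwartzMap.fourier_coe, Real.fourier_eq']
      congr 1
      ext ξ
      have hg : Function.HasTemperateGrowth (fun z : E × F => ((inner ℝ v.2 z.2 : ℝ) : ℂ)) :=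
        (Complex.ofRealCLM.comp ((innerSL ℝ v.2).comp
          (ContinuousLinearMap.snd ℝ E F))).hasTemperateGrowth
      simp [pfDeriv, SchwartzMap.smulLeftCLM_apply_apply hg,
        SchwartzMap.lineDerivOp_apply_eq_fderiv, real_inner_comm ξ v.2]
      ring)
    (fun k => by
      have hc : Continuous ((SchwartzMap.seminorm ℂ k 0).comp
          (SchwartzMap.fourierTransformCLM ℂ (V := F) (E := ℂ)).toLinearMap) :=
        ((schwartz_withSeminorms ℂ F ℂ).continuous_seminorm (k, 0)).comp
          (SchwartzMap.fourierTransformCLM ℂ (V := F) (E := ℂ)).continuous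
      have hc0 : Continuous ((SchwartzMap.seminorm ℂ 0 0).comp
          (SchwartzMap.fourierTransformCLM ℂ (V := F) (E := ℂ)).toLinearMap) :=
        ((schwartz_withSeminorms ℂ F ℂ).continuous_seminorm (0, 0)).comp
          (SchwartzMap.fourierTransformCLM ℂ (V := F) (E := ℂ)).continuous
      obtain ⟨q1, hq1, h1⟩ := slice_bound (E := E) 0 _ hc
      obtain ⟨q2, hq2, h2⟩ := slice_bound (E := E) k _ hc0
      refine ⟨q1 + q2, hq1.add hq2, fun Φ z => ?_⟩
      have e1 : ‖z.2‖ ^ k * ‖𝓕 (slice z.1 Φ) z.2‖ ≤ q1 Φ := by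
        have := h1 z.1 Φ
        rw [pow_zero, one_mul] at this
        refine le_trans ?_ this
        exact SchwartzMap.norm_pow_mul_le_seminorm ℂ (𝓕 (slice z.1 Φ)) k z.2
      have e2 : ‖z.1‖ ^ k * ‖𝓕 (slice z.1 Φ) z.2‖ ≤ q2 Φ := by
        refine le_trans ?_ (h2 z.1 Φ)
        gcongr
        exact SchwartzMap.norm_le_seminorm ℂ (𝓕 (slice z.1 Φ)) z.2
      have e3 : ‖z‖ ^ k ≤ ‖z.2‖ ^ k + ‖z.1‖ ^ k := by
        rcases max_choice ‖z.1‖ ‖z.2‖ with h | h <;> rw [Prod.norm_def, h]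
        · linarith [pow_nonneg (norm_nonneg z.2) k]
        · linarith [pow_nonneg (norm_nonneg z.1) k]
      calc _ ≤ (‖z.2‖ ^ k + ‖z.1‖ ^ k) * ‖𝓕 (slice z.1 Φ) z.2‖ := by gcongr
        _ ≤ q1 Φ + q2 Φ := by linarith
        _ = (q1 + q2) Φ := rfl)

@[simp] theorem partialFourier_apply [FiniteDimensional ℝ E] (Φ : 𝓢(E × F, ℂ)) (z : E × F) :
    partialFourier Φ z = 𝓕 (slice z.1 Φ) z.2 := rfl

end PartialFourier

/-- The Euclidean space `ℝᵈ`. -/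
abbrev Rd (d : ℕ) : Type := EuclideanSpace ℝ (Fin d)

variable {d : ℕ}

/-- Complex conjugation of Schwartz functions. -/
def conjS {E : Type} [NormedAddCommGroup E] [NormedSpace ℝ E] : 𝓢(E, ℂ) →L[ℝ] 𝓢(E, ℂ) :=
  SchwartzMap.postcompCLM (Complex.conjCLE : ℂ →L[ℝ] ℂ)

@[simp] theorem conjS_apply {E : Type} [NormedAddCommGroup E] [NormedSpace ℝ E] (φ : 𝓢(E, ℂ))
    (x : E) : conjS φ x = starRingEnd ℂ (φ x) := rfl

/-- The complex conjugate of a tempered distribution, `φ ↦ conj (f (conj φ))`. -/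
def conjDist (f : 𝓢'(Rd d, ℂ)) : 𝓢(Rd d, ℂ) →L[ℂ] ℂ where
  toFun φ := starRingEnd ℂ (f (conjS φ))
  map_add' φ ψ := by simp
  map_smul' a φ := by
    have : conjS (a • φ) = starRingEnd ℂ a • conjS φ := by
      ext x
      simp
    simp [this]
  cont := Complex.continuous_conj.comp (f.continuous.comp conjS.continuous)

theorem hasTemperateGrowth_cexp :
    Function.HasTemperateGrowth (fun s : ℝ => Complex.exp (s * Complex.I)) := by
  have h1 : ContDiff ℝ ∞ (fun s : ℝ => Complex.exp (s * Complex.I)) :=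
    (Complex.ofRealCLM.contDiff.mul contDiff_const).cexp
  have h2 : ∀ n : ℕ, iteratedDeriv n (fun s : ℝ => Complex.exp (s * Complex.I)) =
      fun s : ℝ => Complex.I ^ n * Complex.exp (s * Complex.I) := by
    intro n
    induction n with
    | zero => simp
    | succ n ih =>
      rw [iteratedDeriv_succ, ih]
      ext s
      have h3 : HasDerivAt (fun s : ℝ => Complex.exp (s * Complex.I))
          (Complex.exp (s * Complex.I) * (1 * Complex.I)) s :=
        (Complex.ofRealCLM.hasDerivAt.mul_const Complex.I).cexp
      rw [(h3.const_mul _).deriv]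
      ring
  refine ⟨h1, fun n => ⟨0, 1, fun s => ?_⟩⟩
  rw [norm_iteratedFDeriv_eq_norm_iteratedDeriv, h2]
  simp [Complex.norm_exp_ofReal_mul_I]

/-- The modulation `M_ξ g (t) = exp (2 π i t · ξ) g (t)` of a Schwartz function. -/
def modulation (ξ : Rd d) : 𝓢(Rd d, ℂ) →L[ℂ] 𝓢(Rd d, ℂ) :=
  SchwartzMap.smulLeftCLM ℂ
    (fun t : Rd d => Complex.exp (↑(2 * Real.pi * inner ℝ t ξ) * Complex.I))

theorem modulation_apply (ξ : Rd d) (g : 𝓢(Rd d, ℂ)) (t : Rd d) :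
    modulation ξ g t = Complex.exp (↑(2 * Real.pi * inner ℝ t ξ) * Complex.I) * g t := by
  have h : Function.HasTemperateGrowth
      (fun t : Rd d => Complex.exp (↑(2 * Real.pi * inner ℝ t ξ) * Complex.I)) :=
    hasTemperateGrowth_cexp.comp ((2 * Real.pi) • (innerSL ℝ).flip ξ).hasTemperateGrowth
  rw [modulation, SchwartzMap.smulLeftCLM_apply_apply h, smul_eq_mul]

/-- The short-time Fourier transform `V_g f (x, ξ) = ⟨f, M_ξ T_x g⟩` of a tempered distribution
`f` with Schwartz window `g`. The bracket extends the inner product of `L²`, so that it is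
antilinear in its second entry. -/
def stft (g : 𝓢(Rd d, ℂ)) (f : 𝓢'(Rd d, ℂ)) (x ξ : Rd d) : ℂ :=
  f (conjS (modulation ξ (SchwartzMap.compSubConstCLM ℂ x g)))

/-- The norm of `M^{p,q}(ℝᵈ)` with window `g`: the mixed norm of `V_g f`, namely the `L^p` norm in
`x` followed by the `L^q` norm in `ξ`. It is `∞` when `f` is not in `M^{p,q}(ℝᵈ)`. -/
def modulationNorm (g : 𝓢(Rd d, ℂ)) (p q : ℝ≥0∞) (f : 𝓢'(Rd d, ℂ)) : ℝ≥0∞ :=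
  eLpNorm (fun ξ : Rd d => eLpNorm (fun x : Rd d => stft g f x ξ) p volume) q volume

/-- The modulation space `M^{p,q}(ℝᵈ)` (described with the window `g`). -/
def modulationSpace (g : 𝓢(Rd d, ℂ)) (p q : ℝ≥0∞) : Set 𝓢'(Rd d, ℂ) :=
  {f | modulationNorm g p q f < ⊤}

/-- The linear change of variables `(u, v) ↦ (u - v, (u + v) / 2)`, with inverse
`(x, t) ↦ (t + x / 2, t - x / 2)`. -/
def changeVar : (Rd d × Rd d) ≃L[ℝ] (Rd d × Rd d) :=
  LinearEquiv.toContinuousLinearEquiv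
    { toFun := fun w => (w.1 - w.2, (1 / 2 : ℝ) • (w.1 + w.2))
      invFun := fun z => (z.2 + (1 / 2 : ℝ) • z.1, z.2 - (1 / 2 : ℝ) • z.1)
      map_add' := fun w w' => by ext <;> simp <;> ring
      map_smul' := fun a w => by ext <;> simp <;> ring
      left_inv := fun w => by ext <;> simp <;> ring
      right_inv := fun z => by ext <;> simp <;> ring }

/-- The cross-ambiguity function
`A(f₁, f₂)(x, ξ) = ∫ exp (-2 π i t · ξ) f₁ (t + x / 2) conj (f₂ (t - x / 2)) dt`
of two tempered distributions, as a tempered distribution on `ℝ²ᵈ`. Moving the partial Fourier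
transform and the change of variables `u = t + x / 2`, `v = t - x / 2` to the test function `Φ`,
it is the tensor product `f₁(u) ⊗ conj f₂(v)` evaluated at
`(u, v) ↦ ∫ exp (-2 π i ((u + v) / 2) · ξ) Φ (u - v, ξ) dξ`. -/
def ambiguity (f₁ f₂ : 𝓢'(Rd d, ℂ)) : 𝓢'(Rd d × Rd d, ℂ) :=
  PointwiseConvergenceCLM.precomp ℂ
    (partialPairing (conjDist f₂) ∘L SchwartzMap.compCLMOfContinuousLinearEquiv ℂ changeVar
      ∘L partialFourier) f₁

theorem ambiguity_apply (f₁ f₂ : 𝓢'(Rd d, ℂ)) (Φ : 𝓢(Rd d × Rd d, ℂ)) :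
    ambiguity f₁ f₂ Φ = f₁ (partialPairing (conjDist f₂)
      (SchwartzMap.compCLMOfContinuousLinearEquiv ℂ changeVar (partialFourier Φ))) := rfl

/-- For a Schwartz function, the short-time Fourier transform is the usual integral. -/
theorem stft_coe (g h : 𝓢(Rd d, ℂ)) (x ξ : Rd d) :
    stft g (h : 𝓢'(Rd d, ℂ)) x ξ =
      ∫ t, h t * starRingEnd ℂ (g (t - x)) * Complex.exp (-2 * Real.pi * Complex.I * inner ℝ t ξ) := by
  rw [stft, SchwartzMap.coe_apply]
  congr 1
  ext t
  simp only [conjS_apply, modulation_apply, map_mul, ← Complex.exp_conj, Complex.conj_ofReal,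
    Complex.conj_I, smul_eq_mul, compSubConstCLM_apply]
  rw [show (↑(2 * Real.pi * inner ℝ t ξ) * -Complex.I : ℂ) =
    -2 * Real.pi * Complex.I * inner ℝ t ξ by push_cast; ring]
  ring

/-- The integral formula for the cross-ambiguity function of two functions. -/
def ambiguityFun (h₁ h₂ : Rd d → ℂ) (z : Rd d × Rd d) : ℂ :=
  ∫ t, Complex.exp (-2 * Real.pi * Complex.I * inner ℝ t z.2) *
    (h₁ (t + (1 / 2 : ℝ) • z.1) * starRingEnd ℂ (h₂ (t - (1 / 2 : ℝ) • z.1)))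

theorem measurePreserving_changeVar : MeasurePreserving (changeVar (d := d)) volume volume := by
  have h1 : MeasurePreserving (fun z : Rd d × Rd d => (z.2, z.1 - z.2)) volume volume :=
    measurePreserving_prod_sub_swap volume volume
  have h2 : MeasurePreserving (Prod.swap : Rd d × Rd d → Rd d × Rd d) volume volume :=
    Measure.measurePreserving_swap
  have h3 : MeasurePreserving (fun z : Rd d × Rd d => (z.1, z.2 + (1 / 2 : ℝ) • z.1))
      volume volume := by
    refine (MeasurePreserving.id volume).skew_product
      (g := fun (x v : Rd d) => v + (1 / 2 : ℝ) • x) (by fun_prop) ?_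
    exact Filter.Eventually.of_forall fun x => (measurePreserving_add_right volume _).map_eq
  have h4 := h3.comp (h2.comp h1)
  convert h4 using 1
  ext z <;> simp [changeVar] <;> ring

theorem conjDist_coe (h φ : 𝓢(Rd d, ℂ)) :
    conjDist (h : 𝓢'(Rd d, ℂ)) φ = ∫ t, φ t * starRingEnd ℂ (h t) := by
  change starRingEnd ℂ ((h : 𝓢'(Rd d, ℂ)) (conjS φ)) = _
  rw [SchwartzMap.coe_apply, ← integral_conj]
  simp

/-- For Schwartz functions, the distributional cross-ambiguity function is given by the integral
formula. -/
theorem ambiguity_coe (h₁ h₂ : 𝓢(Rd d, ℂ)) (Φ : 𝓢(Rd d × Rd d, ℂ)) :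
    ambiguity (h₁ : 𝓢'(Rd d, ℂ)) (h₂ : 𝓢'(Rd d, ℂ)) Φ = ∫ z, Φ z * ambiguityFun h₁ h₂ z := by
  have hV : (volume : Measure (Rd d × Rd d)).IsAddHaarMeasure :=
    inferInstanceAs ((volume : Measure (Rd d)).prod (volume : Measure (Rd d))).IsAddHaarMeasure
  have hT : (volume : Measure (Rd d × Rd d)).HasTemperateGrowth :=
    Measure.IsAddHaarMeasure.instHasTemperateGrowth
  rw [ambiguity_apply, SchwartzMap.coe_apply]
  simp only [partialPairing_apply, conjDist_coe, slice_apply, smul_eq_mul,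
    compCLMOfContinuousLinearEquiv_apply, Function.comp_apply]
  have hb1 : ∀ t, ‖h₁ t‖ ≤ SchwartzMap.seminorm ℝ 0 0 h₁ := norm_le_seminorm ℝ h₁
  have hb2 : ∀ t, ‖h₂ t‖ ≤ SchwartzMap.seminorm ℝ 0 0 h₂ := norm_le_seminorm ℝ h₂
  have c1 := h₁.continuous
  have c2 := h₂.continuous
  let H : Rd d × Rd d → ℂ := fun z =>
    h₁ (z.2 + (1 / 2 : ℝ) • z.1) * starRingEnd ℂ (h₂ (z.2 - (1 / 2 : ℝ) • z.1))
  have cH : Continuous H := by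
    have := Complex.continuous_conj
    fun_prop
  have bH : ∀ z, ‖H z‖ ≤ SchwartzMap.seminorm ℝ 0 0 h₁ * SchwartzMap.seminorm ℝ 0 0 h₂ := by
    intro z
    simp only [H, norm_mul, RCLike.norm_conj]
    gcongr
    · exact hb1 _
    · exact hb2 _
  have iG : Integrable (fun z => partialFourier Φ z * H z) (volume : Measure (Rd d × Rd d)) :=
    (SchwartzMap.integrable _).mul_bdd cH.aestronglyMeasurable (Filter.Eventually.of_forall bH)
  have hcv : ∀ w : Rd d × Rd d, H (changeVar w) = h₁ w.1 * starRingEnd ℂ (h₂ w.2) := by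
    intro w
    have e1 : (1 / 2 : ℝ) • (w.1 + w.2) + (1 / 2 : ℝ) • (w.1 - w.2) = w.1 := by module
    have e2 : (1 / 2 : ℝ) • (w.1 + w.2) - (1 / 2 : ℝ) • (w.1 - w.2) = w.2 := by module
    change h₁ ((1 / 2 : ℝ) • (w.1 + w.2) + (1 / 2 : ℝ) • (w.1 - w.2)) *
      starRingEnd ℂ (h₂ ((1 / 2 : ℝ) • (w.1 + w.2) - (1 / 2 : ℝ) • (w.1 - w.2))) = _
    rw [e1, e2]
  have me : MeasurableEmbedding (changeVar (d := d)) :=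
    (changeVar (d := d)).toHomeomorph.measurableEmbedding
  have iW : Integrable (fun w => partialFourier Φ (changeVar w) * H (changeVar w))
      (volume : Measure (Rd d × Rd d)) :=
    (measurePreserving_changeVar.integrable_comp_emb me).2 iG
  have s1 : ∫ u, (∫ v, partialFourier Φ (changeVar (u, v)) * starRingEnd ℂ (h₂ v)) * h₁ u =
      ∫ w : Rd d × Rd d, partialFourier Φ (changeVar w) * H (changeVar w) := by
    rw [Measure.volume_eq_prod, integral_prod _ iW]
    congr 1
    ext u
    rw [← integral_mul_const]
    congr 1
    ext v
    rw [hcv]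
    ring
  rw [s1, measurePreserving_changeVar.integral_comp me (fun z => partialFourier Φ z * H z),
    show ∫ z, partialFourier Φ z * H z = ∫ x, ∫ t, partialFourier Φ (x, t) * H (x, t) from
      integral_prod _ iG]
  have iH : ∀ x, Integrable (fun t => H (x, t)) := by
    intro x
    have e : Integrable (fun t => h₁ (t + (1 / 2 : ℝ) • x)) :=
      (h₁.integrable (μ := volume)).comp_add_right _
    refine e.mul_bdd (c := SchwartzMap.seminorm ℝ 0 0 h₂) ?_ (Filter.Eventually.of_forall fun t => ?_)
    · have := Complex.continuous_conj
      exact Continuous.aestronglyMeasurable (by fun_prop)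
    · rw [RCLike.norm_conj]
      exact hb2 _
  have hA : ∀ x ξ, ambiguityFun h₁ h₂ (x, ξ) = 𝓕 (fun t => H (x, t)) ξ := by
    intro x ξ
    rw [Real.fourier_eq', ambiguityFun]
    congr 1
    ext t
    rw [smul_eq_mul]
    congr 2
    push_cast
    ring
  have iA : Integrable (fun z => Φ z * ambiguityFun h₁ h₂ z) (volume : Measure (Rd d × Rd d)) := by
    have cA : StronglyMeasurable (ambiguityFun (h₁ : Rd d → ℂ) h₂) := by
      have : Continuous fun y : (Rd d × Rd d) × Rd d =>
          Complex.exp (-2 * Real.pi * Complex.I * inner ℝ y.2 y.1.2) *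
          (h₁ (y.2 + (1 / 2 : ℝ) • y.1.1) * starRingEnd ℂ (h₂ (y.2 - (1 / 2 : ℝ) • y.1.1))) := by
        have := Complex.continuous_conj
        fun_prop
      exact this.stronglyMeasurable.integral_prod_right'
    refine (SchwartzMap.integrable Φ).mul_bdd
      (c := (∫ t, ‖h₁ t‖) * SchwartzMap.seminorm ℝ 0 0 h₂) cA.aestronglyMeasurable
      (Filter.Eventually.of_forall ?_)
    rintro ⟨x, ξ⟩
    rw [hA, Real.fourier_eq']
    refine (norm_integral_le_integral_norm _).trans ?_
    rw [← integral_add_right_eq_self (fun t => ‖h₁ t‖) ((1 / 2 : ℝ) • x), ← integral_mul_const]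
    refine integral_mono_of_nonneg (Filter.Eventually.of_forall fun t => norm_nonneg _)
      (((h₁.integrable (μ := volume)).comp_add_right _).norm.mul_const _)
      (Filter.Eventually.of_forall fun t => ?_)
    simp only [norm_smul, Complex.norm_exp_ofReal_mul_I, one_mul, H, norm_mul, RCLike.norm_conj]
    gcongr
    exact hb2 _
  have hr := integral_prod _ iA
  rw [← Measure.volume_eq_prod] at hr
  rw [hr]
  congr 1
  ext x
  have key := VectorFourier.integral_fourierIntegral_smul_eq_flip (L := innerₗ (Rd d))
    (μ := volume) (ν := volume) Real.continuous_fourierChar continuous_inner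
    ((slice x Φ).integrable (μ := volume)) (iH x)
  simp only [hA, partialFourier_apply, SchwartzMap.fourier_coe]
  rw [flip_innerₗ] at key
  exact key

end TimeFreq
end

open TimeFreq

/-! The argument measures the ambiguity function by its short-time Fourier transform with a Gaussian
window on phase space. The Gaussian `gauss2` is, up to a constant, the ambiguity function of
`gauss1` with itself. Hence the transform of `ambiguity f₁ f₂` at `(z, ζ)` factors: up to a constant
and a phase it is `V f₁(w)` times the conjugate of `V f₂(w - z)`, where `w` depends on `ζ` through a
measure-preserving map (`ambiguity_gaussAtom`). For fixed `z`, its `L^s` norm in `ζ` is therefore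
the `1/s` power of a correlation of `|V f₁|^s` and `|V f₂|^s`.

Let `s` be the conjugate exponent of `q`, so that `s ≤ 2 ≤ q`. Young's inequality in mixed norms
bounds the `L^q` norm in `z` of this quantity by the product of the `M^{P₁,Q₁}` and `M^{P₂,Q₂}`
norms, provided `1/P₁ + 1/P₂ = 1`, `1/Q₁ + 1/Q₂ = 1` and all four exponents are at least `s`
(`eLpNorm_rpow_conv_le`). The assumptions on `p₁, p₂, q₁, q₂` are exactly what allows such exponents
above the given ones (`exists_conj_exponents`). Modulation norms decrease, up to a constant, when
the exponents grow, and a change of window also costs only a constant (`modulationNorm_le_of_le`).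

Finally, for fixed `z`, the localization of the ambiguity function by the Gaussian centred at `z` is
the inverse Fourier transform in `ζ` of this transform. By Hausdorff–Young it is a function whose
`L^q` norm is at most a constant times the `L^s` norm in `ζ`. Taking the `L^q` norm in `z` and
exchanging the order of integration gives the `L^q` norm of the ambiguity function times that of the
Gaussian (`exists_memLp_of_localization`).

As `f₁` and `f₂` are only distributions, every superposition of test functions is justified by a
Fubini theorem for tempered distributions (`distribution_integral`). Hausdorff–Young itself is
obtained by real interpolation between `L¹ → L^∞` and `L² → L²`, so its constant is not sharp. -/

noncomputable section
namespace TimeFreq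

/-! ### Measurability of partial norms and Minkowski's integral inequality. -/

section MixedNorm
variable {α β : Type*} [MeasurableSpace α] [MeasurableSpace β] {μ : Measure α} {ν : Measure β}

theorem eLpNorm_ennreal {p : ℝ≥0∞} (h0 : p ≠ 0) (ht : p ≠ ⊤) (f : α → ℝ≥0∞) :
    eLpNorm f p μ = (∫⁻ x, f x ^ p.toReal ∂μ) ^ (1 / p.toReal) := by
  rw [eLpNorm_eq_lintegral_rpow_enorm_toReal h0 ht]
  simp

theorem eLpNorm_top_ennreal (f : α → ℝ≥0∞) : eLpNorm f ⊤ μ = essSup f μ := by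
  simp [eLpNorm_exponent_top, eLpNormEssSup]

theorem measurable_eLpNorm_section [SFinite μ] {f : β → α → ℝ≥0∞} (hf : Measurable (Function.uncurry f))
    (p : ℝ≥0∞) : Measurable fun η => eLpNorm (f η) p μ := by
  rcases eq_or_ne p 0 with rfl | h0
  · simp
  rcases eq_or_ne p ⊤ with rfl | ht
  · simp only [eLpNorm_top_ennreal]
    refine measurable_of_Iic fun a => ?_
    -- The essential supremum of a section is at most `a` exactly when the section of the measurable
    -- set `{f > a}` is null, and measures of sections are measurable.
    have h1 : (fun η => essSup (f η) μ) ⁻¹' Set.Iic a =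
        (fun η => μ (Prod.mk η ⁻¹' {w : β × α | a < f w.1 w.2})) ⁻¹' {0} := by
      ext η
      simp only [Set.mem_preimage, Set.mem_Iic, Set.mem_singleton_iff, Set.preimage_ofPred_eq]
      constructor
      · intro h
        have := ae_le_essSup (f := f η) (μ := μ)
        refine measure_mono_null ?_ this
        intro x hx
        simp only [Set.mem_ofPred_eq] at hx
        exact fun h' => absurd (h'.trans h) (not_le.2 hx)
      · intro h
        refine essSup_le_of_ae_le a ?_
        rw [Filter.EventuallyLE, ae_iff]
        simpa using h
    rw [h1]
    exact measurable_measure_prodMk_left (measurableSet_lt measurable_const hf) (measurableSet_singleton 0)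
  · simp only [eLpNorm_ennreal h0 ht]
    exact (Measurable.lintegral_prod_right' (f := fun w : β × α => f w.1 w.2 ^ p.toReal)
      (hf.pow_const _)).pow_const _

/-- Minkowski's integral inequality. -/
theorem eLpNorm_lintegral_le [SigmaFinite μ] [SigmaFinite ν] {f : β → α → ℝ≥0∞}
    (hf : Measurable (Function.uncurry f)) {p : ℝ≥0∞} (hp : 1 ≤ p) :
    eLpNorm (fun x => ∫⁻ η, f η x ∂ν) p μ ≤ ∫⁻ η, eLpNorm (f η) p μ ∂ν := by
  have hc := measurable_eLpNorm_section (μ := μ) hf p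
  set c : β → ℝ≥0∞ := fun η => eLpNorm (f η) p μ with hcdef
  have h0 : p ≠ 0 := (one_pos.trans_le hp).ne'
  rcases eq_or_ne p ⊤ with rfl | ht
  · have hae : ∀ᵐ x ∂μ, ∀ᵐ η ∂ν, f η x ≤ c η := by
      rw [Measure.ae_ae_comm (p := fun x η => f η x ≤ c η)
        (measurableSet_le (hf.comp measurable_swap) (hc.comp measurable_snd))]
      refine Filter.Eventually.of_forall fun η => ?_
      rw [hcdef]
      simp only [eLpNorm_top_ennreal]
      exact ae_le_essSup
    rw [eLpNorm_top_ennreal]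
    refine essSup_le_of_ae_le _ ?_
    filter_upwards [hae] with x hx
    exact lintegral_mono_ae hx
  rcases eq_or_ne (∫⁻ η, c η ∂ν) ⊤ with hN | hN
  · rw [hN]
    exact le_top
  set r := p.toReal with hr
  have hr1 : 1 ≤ r := by
    rw [hr, ← ENNReal.toReal_one]
    exact ENNReal.toReal_mono ht hp
  have hr0 : 0 < r := one_pos.trans_le hr1
  have hcr : ∀ η, ∫⁻ x, f η x ^ r ∂μ = c η ^ r := by
    intro η
    rw [hcdef]
    simp only [eLpNorm_ennreal h0 ht]
    rw [← ENNReal.rpow_mul, one_div_mul_cancel hr0.ne', ENNReal.rpow_one]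
  refine ENNReal.le_of_forall_pos_le_add fun ε hε _ => ?_
  -- The norms `c η` may vanish, but negative powers of them are needed. Adding a strictly positive
  -- `w` of integral below `ε` removes the zeros, at a cost of `ε`.
  obtain ⟨w, hw0, hwm, hw⟩ := exists_pos_lintegral_lt_of_sigmaFinite ν (ε := ε) (by simpa using hε.ne')
  set c' : β → ℝ≥0∞ := fun η => c η + w η with hc'
  have hc'm : Measurable c' := hc.add hwm.coe_nnreal_ennreal
  have hN' : ∫⁻ η, c' η ∂ν ≤ ∫⁻ η, c η ∂ν + ε := by
    rw [hc', lintegral_add_left hc]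
    gcongr
  refine le_trans ?_ hN'
  set N := ∫⁻ η, c' η ∂ν with hNdef
  have hNt : N ≠ ⊤ := (hN'.trans_lt (by simpa using hN.lt_top)).ne
  have hfin : ∀ᵐ η ∂ν, c' η ≠ ⊤ := (ae_lt_top hc'm hNt).mono fun _ h => h.ne
  have hpos : ∀ η, c' η ≠ 0 := fun η => by
    have := (hw0 η).ne'
    simp [hc', this]
  -- The weight is chosen so that `f = F^(1/r) * c'^(1 - 1/r)`, to which Hölder in `η` applies,
  -- while integrating `F η` over `x` gives `c^r * c'^(-(r-1)) ≤ c'`.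
  let F : β → α → ℝ≥0∞ := fun η x => f η x ^ r * c' η ^ (-(r - 1))
  have hFm : Measurable (Function.uncurry F) :=
    (hf.pow_const r).mul ((hc'm.comp measurable_fst).pow_const _)
  have hle : 0 ≤ 1 - 1 / r := by
    rw [sub_nonneg, div_le_one hr0]
    exact hr1
  have hpt : ∀ x, (∫⁻ η, f η x ∂ν) ^ r ≤ (∫⁻ η, F η x ∂ν) * N ^ (r - 1) := by
    intro x
    have h1 : ∫⁻ η, f η x ∂ν = ∫⁻ η, F η x ^ (1 / r) * c' η ^ (1 - 1 / r) ∂ν := by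
      refine lintegral_congr_ae ?_
      filter_upwards [hfin] with η hη
      simp only [F]
      rw [ENNReal.mul_rpow_of_nonneg _ _ (by positivity), ← ENNReal.rpow_mul, ← ENNReal.rpow_mul,
        mul_one_div_cancel hr0.ne', ENNReal.rpow_one, mul_assoc,
        ← ENNReal.rpow_add _ _ (hpos η) hη]
      have : -(r - 1) * (1 / r) + (1 - 1 / r) = 0 := by
        field_simp
        ring
      rw [this, ENNReal.rpow_zero, mul_one]
    have h2 := ENNReal.lintegral_mul_norm_pow_le (μ := ν) (f := fun η => F η x) (g := c')
      (hFm.comp measurable_prodMk_right).aemeasurable hc'm.aemeasurable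
      (p := 1 / r) (q := 1 - 1 / r) (by positivity) hle (by ring)
    rw [h1]
    calc _ ≤ ((∫⁻ η, F η x ∂ν) ^ (1 / r) * N ^ (1 - 1 / r)) ^ r := by gcongr
      _ = _ := by
        rw [ENNReal.mul_rpow_of_nonneg _ _ hr0.le, ← ENNReal.rpow_mul, ← ENNReal.rpow_mul,
          one_div_mul_cancel hr0.ne', ENNReal.rpow_one]
        congr 2
        field_simp
  have hI : ∫⁻ x, ∫⁻ η, F η x ∂ν ∂μ ≤ N := by
    rw [lintegral_lintegral_swap (f := fun x η => F η x) (hFm.comp measurable_swap).aemeasurable]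
    refine lintegral_mono_ae ?_
    filter_upwards [hfin] with η hη
    simp only [F]
    have hfη : Measurable fun x => f η x ^ r :=
      (show Measurable (f η) from hf.comp measurable_prodMk_left).pow_const r
    rw [lintegral_mul_const _ hfη, hcr]
    calc _ ≤ c' η ^ r * c' η ^ (-(r - 1)) := by
          gcongr
          exact le_self_add
      _ = c' η := by
          rw [← ENNReal.rpow_add _ _ (hpos η) hη]
          ring_nf
          exact ENNReal.rpow_one _
  rw [eLpNorm_ennreal h0 ht, one_div, ENNReal.rpow_inv_le_iff hr0]
  calc _ ≤ ∫⁻ x, (∫⁻ η, F η x ∂ν) * N ^ (r - 1) ∂μ := lintegral_mono hpt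
    _ = (∫⁻ x, ∫⁻ η, F η x ∂ν ∂μ) * N ^ (r - 1) :=
        lintegral_mul_const _ (hFm.comp measurable_swap).lintegral_prod_right'
    _ ≤ N * N ^ (r - 1) := by gcongr
    _ = N ^ r := by
        nth_rewrite 1 [← ENNReal.rpow_one N]
        rw [← ENNReal.rpow_add_of_nonneg _ _ one_pos.le (by linarith)]
        ring_nf

end MixedNorm

/-! ### Hölder's and Young's inequalities, and Young's inequality for mixed norms. -/

section Young
variable {G : Type*} [AddCommGroup G] [MeasurableSpace G] [MeasurableAdd₂ G] [MeasurableNeg G]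
  {μ : Measure G} [SigmaFinite μ] [μ.IsAddLeftInvariant] [μ.IsNegInvariant]

omit [AddCommGroup G] [MeasurableAdd₂ G] [MeasurableNeg G] [SigmaFinite μ]
  [μ.IsAddLeftInvariant] [μ.IsNegInvariant] in
theorem lintegral_mul_le_essSup_mul {f g : G → ℝ≥0∞} (hg : AEMeasurable g μ) :
    ∫⁻ x, f x * g x ∂μ ≤ essSup f μ * ∫⁻ x, g x ∂μ := by
  rw [← lintegral_const_mul'' _ hg]
  refine lintegral_mono_ae ?_
  filter_upwards [ae_le_essSup (f := f) (μ := μ)] with x hx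
  gcongr

omit [AddCommGroup G] [MeasurableAdd₂ G] [MeasurableNeg G] [SigmaFinite μ]
  [μ.IsAddLeftInvariant] [μ.IsNegInvariant] in
/-- Hölder's inequality for functions with values in `[0, ∞]`. -/
theorem lintegral_mul_le_eLpNorm {f g : G → ℝ≥0∞}
    (hf : AEMeasurable f μ) (hg : AEMeasurable g μ) {p q : ℝ≥0∞} (hpq : p⁻¹ + q⁻¹ = 1) :
    ∫⁻ x, f x * g x ∂μ ≤ eLpNorm f p μ * eLpNorm g q μ := by
  rcases eq_or_ne p ⊤ with rfl | hp
  · have hq : q = 1 := by simpa using hpq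
    rw [hq, eLpNorm_one_eq_lintegral_enorm, eLpNorm_top_ennreal]
    exact lintegral_mul_le_essSup_mul hg
  rcases eq_or_ne q ⊤ with rfl | hq
  · have hp : p = 1 := by simpa using hpq
    rw [hp, eLpNorm_one_eq_lintegral_enorm, eLpNorm_top_ennreal, mul_comm]
    simp only [mul_comm (f _)]
    exact lintegral_mul_le_essSup_mul hf
  have hp0 : p ≠ 0 := by
    rintro rfl
    simp at hpq
  have hq0 : q ≠ 0 := by
    rintro rfl
    simp at hpq
  rw [eLpNorm_ennreal hp0 hp, eLpNorm_ennreal hq0 hq]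
  refine ENNReal.lintegral_mul_le_Lp_mul_Lq μ ?_ hf hg
  have hp1 := ENNReal.toReal_pos hp0 hp
  have hq1 := ENNReal.toReal_pos hq0 hq
  have := congrArg ENNReal.toReal hpq
  rw [ENNReal.toReal_add (ENNReal.inv_ne_top.2 hp0) (ENNReal.inv_ne_top.2 hq0), ENNReal.toReal_inv,
    ENNReal.toReal_inv, ENNReal.toReal_one] at this
  exact ⟨by simpa using this, hp1, hq1⟩

omit [SigmaFinite μ] in
theorem eLpNorm_comp_sub_left {f : G → ℝ≥0∞} (hf : Measurable f) (p : ℝ≥0∞) (x : G) :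
    eLpNorm (fun y => f (x - y)) p μ = eLpNorm f p μ :=
  eLpNorm_comp_measurePreserving (f := fun y => x - y) hf.aestronglyMeasurable
    (Measure.measurePreserving_sub_left μ x)

omit [SigmaFinite μ] [μ.IsAddLeftInvariant] [μ.IsNegInvariant] in
theorem measurable_conv_integrand {f g : G → ℝ≥0∞} (hf : Measurable f) (hg : Measurable g) :
    Measurable (fun w : G × G => f w.2 * g (w.1 - w.2)) :=
  (hf.comp measurable_snd).mul (hg.comp (measurable_fst.sub measurable_snd))

/-- Young's convolution inequality for functions with values in `[0, ∞]`. -/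
theorem eLpNorm_conv_le {f g : G → ℝ≥0∞} (hf : Measurable f) (hg : Measurable g) {p q r : ℝ≥0∞}
    (hp : 1 ≤ p) (hq : 1 ≤ q) (hpq : p⁻¹ + q⁻¹ = 1 + r⁻¹) :
    eLpNorm (fun x => ∫⁻ y, f y * g (x - y) ∂μ) r μ ≤ eLpNorm f p μ * eLpNorm g q μ := by
  rcases eq_or_ne r ⊤ with rfl | hr
  · rw [eLpNorm_top_ennreal]
    refine essSup_le_of_ae_le _ (Filter.Eventually.of_forall fun x => ?_)
    refine (lintegral_mul_le_eLpNorm hf.aemeasurable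
      (hg.comp (measurable_const.sub measurable_id)).aemeasurable (by simpa using hpq)).trans ?_
    exact mul_le_mul' le_rfl (eLpNorm_comp_sub_left hg q x).le
  have hp0 : p ≠ 0 := (one_pos.trans_le hp).ne'
  have hq0 : q ≠ 0 := (one_pos.trans_le hq).ne'
  have hpi : p⁻¹ ≤ 1 := ENNReal.inv_le_one.2 hp
  have hqi : q⁻¹ ≤ 1 := ENNReal.inv_le_one.2 hq
  have hri : r⁻¹ ≠ 0 := ENNReal.inv_ne_zero.2 hr
  -- With `r` finite, `p = ∞` would force `1/q = 1 + 1/r > 1`. The same argument excludes `q = ∞`.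
  have hpt : p ≠ ⊤ := by
    rintro rfl
    simp only [ENNReal.inv_top, zero_add] at hpq
    rw [hpq] at hqi
    have := ENNReal.lt_add_right ENNReal.one_ne_top hri
    exact absurd hqi (not_le.2 this)
  have hqt : q ≠ ⊤ := by
    rintro rfl
    simp only [ENNReal.inv_top, add_zero] at hpq
    rw [hpq] at hpi
    have := ENNReal.lt_add_right ENNReal.one_ne_top hri
    exact absurd hpi (not_le.2 this)
  have hr0 : r ≠ 0 := by
    rintro rfl
    rw [ENNReal.inv_zero, add_top] at hpq
    exact (ENNReal.add_lt_top.2 ⟨hpi.trans_lt ENNReal.one_lt_top, hqi.trans_lt ENNReal.one_lt_top⟩).ne hpq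
  have hP : 0 < p.toReal := ENNReal.toReal_pos hp0 hpt
  have hQ : 0 < q.toReal := ENNReal.toReal_pos hq0 hqt
  have hR : 0 < r.toReal := ENNReal.toReal_pos hr0 hr
  have hP1 : p.toReal⁻¹ ≤ 1 := by
    rw [← ENNReal.toReal_inv, ← ENNReal.toReal_one]
    exact ENNReal.toReal_mono ENNReal.one_ne_top hpi
  have hQ1 : q.toReal⁻¹ ≤ 1 := by
    rw [← ENNReal.toReal_inv, ← ENNReal.toReal_one]
    exact ENNReal.toReal_mono ENNReal.one_ne_top hqi
  have hsum : p.toReal⁻¹ + q.toReal⁻¹ = 1 + r.toReal⁻¹ := by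
    have := congrArg ENNReal.toReal hpq
    rwa [ENNReal.toReal_add (ENNReal.inv_ne_top.2 hp0) (ENNReal.inv_ne_top.2 hq0),
      ENNReal.toReal_add ENNReal.one_ne_top (ENNReal.inv_ne_top.2 hr0), ENNReal.toReal_inv,
      ENNReal.toReal_inv, ENNReal.toReal_inv, ENNReal.toReal_one] at this
  rw [eLpNorm_ennreal hr0 hr, eLpNorm_ennreal hp0 hpt, eLpNorm_ennreal hq0 hqt]
  generalize p.toReal = P at hP hP1 hsum
  generalize q.toReal = Q at hQ hQ1 hsum
  generalize r.toReal = R at hR hsum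
  set A := ∫⁻ y, f y ^ P ∂μ
  set B := ∫⁻ y, g y ^ Q ∂μ
  have ha : 0 ≤ P⁻¹ - R⁻¹ := by linarith
  have hb : 0 ≤ Q⁻¹ - R⁻¹ := by linarith
  have hRi : 0 ≤ R⁻¹ := by positivity
  let K : G → G → ℝ≥0∞ := fun x y => f y ^ P * g (x - y) ^ Q
  have hKm : Measurable (Function.uncurry K) :=
    measurable_conv_integrand (hf.pow_const P) (hg.pow_const Q)
  have hpt : ∀ x, (∫⁻ y, f y * g (x - y) ∂μ) ^ R ≤
      (∫⁻ y, K x y ∂μ) * (A ^ (R * (P⁻¹ - R⁻¹)) * B ^ (R * (Q⁻¹ - R⁻¹))) := by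
    intro x
    have hgx : Measurable fun y => g (x - y) := hg.comp (measurable_const.sub measurable_id)
    -- Three-function Hölder for `f g = (f^P g^Q)^(1/R) (f^P)^(1/P - 1/R) (g^Q)^(1/Q - 1/R)`. The
    -- exponents add up to 1 by the Young relation. Only the first factor still depends on `x` after
    -- integration in `y`.
    let F : Fin 3 → G → ℝ≥0∞ := ![K x, fun y => f y ^ P, fun y => g (x - y) ^ Q]
    let e : Fin 3 → ℝ := ![R⁻¹, P⁻¹ - R⁻¹, Q⁻¹ - R⁻¹]
    have h1 := ENNReal.lintegral_prod_norm_pow_le (μ := μ) Finset.univ (f := F) (p := e)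
      (fun i _ => by
        fin_cases i
        · exact (hKm.comp measurable_prodMk_left).aemeasurable
        · exact (hf.pow_const P).aemeasurable
        · exact (hgx.pow_const Q).aemeasurable)
      (by
        simp only [Fin.sum_univ_three, e, Matrix.cons_val]
        linarith)
      (fun i _ => by fin_cases i <;> assumption)
    simp only [Fin.prod_univ_three, F, e, Matrix.cons_val] at h1
    have h2 : ∀ y, K x y ^ R⁻¹ * (f y ^ P) ^ (P⁻¹ - R⁻¹) * (g (x - y) ^ Q) ^ (Q⁻¹ - R⁻¹) =
        f y * g (x - y) := by
      intro y
      have e1 : ∀ (u : ℝ≥0∞) (T : ℝ), 0 < T → 0 ≤ T⁻¹ - R⁻¹ →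
          (u ^ T) ^ R⁻¹ * (u ^ T) ^ (T⁻¹ - R⁻¹) = u := by
        intro u T hT h
        rw [← ENNReal.rpow_add_of_nonneg _ _ hRi h, add_sub_cancel, ← ENNReal.rpow_mul,
          mul_inv_cancel₀ hT.ne', ENNReal.rpow_one]
      simp only [K]
      rw [ENNReal.mul_rpow_of_nonneg _ _ hRi]
      calc _ = ((f y ^ P) ^ R⁻¹ * (f y ^ P) ^ (P⁻¹ - R⁻¹)) *
            ((g (x - y) ^ Q) ^ R⁻¹ * (g (x - y) ^ Q) ^ (Q⁻¹ - R⁻¹)) := by ring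
        _ = _ := by rw [e1 _ _ hP ha, e1 _ _ hQ hb]
    simp only [h2] at h1
    have h3 : ∫⁻ y, g (x - y) ^ Q ∂μ = B := lintegral_sub_left_eq_self (fun y => g y ^ Q) x
    rw [h3] at h1
    calc _ ≤ ((∫⁻ y, K x y ∂μ) ^ R⁻¹ * A ^ (P⁻¹ - R⁻¹) * B ^ (Q⁻¹ - R⁻¹)) ^ R := by gcongr
      _ = _ := by
        rw [ENNReal.mul_rpow_of_nonneg _ _ hR.le, ENNReal.mul_rpow_of_nonneg _ _ hR.le,
          ← ENNReal.rpow_mul, ← ENNReal.rpow_mul, ← ENNReal.rpow_mul, inv_mul_cancel₀ hR.ne',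
          ENNReal.rpow_one, mul_assoc, mul_comm R, mul_comm R]
  have hI : ∫⁻ x, ∫⁻ y, K x y ∂μ ∂μ = A * B := by
    rw [lintegral_lintegral_swap hKm.aemeasurable]
    have : ∀ y, ∫⁻ x, K x y ∂μ = f y ^ P * B := by
      intro y
      simp only [K]
      have hgy : Measurable fun x => g (x - y) ^ Q :=
        (show Measurable fun x => g (x - y) from hg.comp (measurable_id.sub measurable_const)).pow_const Q
      rw [lintegral_const_mul _ hgy,
        lintegral_sub_right_eq_self (fun x => g x ^ Q) y]
    simp only [this]
    exact lintegral_mul_const _ (hf.pow_const P)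
  have e2 : ∀ (u : ℝ≥0∞) (T : ℝ), 0 < T → 0 ≤ T⁻¹ - R⁻¹ →
      u * u ^ (R * (T⁻¹ - R⁻¹)) = u ^ (R * (1 / T)) := by
    intro u T hT h
    nth_rewrite 1 [← ENNReal.rpow_one u]
    rw [← ENNReal.rpow_add_of_nonneg _ _ one_pos.le (by positivity)]
    congr 1
    field_simp
    ring
  rw [one_div, ENNReal.rpow_inv_le_iff hR]
  calc _ ≤ ∫⁻ x, (∫⁻ y, K x y ∂μ) * (A ^ (R * (P⁻¹ - R⁻¹)) * B ^ (R * (Q⁻¹ - R⁻¹))) ∂μ :=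
        lintegral_mono hpt
    _ = (A * B) * (A ^ (R * (P⁻¹ - R⁻¹)) * B ^ (R * (Q⁻¹ - R⁻¹))) := by
        have hKi : Measurable fun x => ∫⁻ y, K x y ∂μ := hKm.lintegral_prod_right'
        rw [lintegral_mul_const _ hKi, hI]
    _ = (A * A ^ (R * (P⁻¹ - R⁻¹))) * (B * B ^ (R * (Q⁻¹ - R⁻¹))) := by ring
    _ = _ := by
        rw [e2 _ _ hP ha, e2 _ _ hQ hb, ENNReal.mul_rpow_of_nonneg _ _ hR.le, ← ENNReal.rpow_mul,
          ← ENNReal.rpow_mul, mul_comm R, mul_comm R]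

/-- The mixed norm: `L^p` in the first variable, followed by `L^q` in the second one. -/
def mixedNorm (μ : Measure G) (p q : ℝ≥0∞) (F : G × G → ℝ≥0∞) : ℝ≥0∞ :=
  eLpNorm (fun ξ => eLpNorm (fun x => F (x, ξ)) p μ) q μ

/-- Young's convolution inequality for mixed norms. -/
theorem mixedNorm_conv_le {F H : G × G → ℝ≥0∞} (hF : Measurable F) (hH : Measurable H)
    {p₁ q₁ r₁ p₂ q₂ r₂ : ℝ≥0∞} (hp₁ : 1 ≤ p₁) (hq₁ : 1 ≤ q₁) (h₁ : p₁⁻¹ + q₁⁻¹ = 1 + r₁⁻¹)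
    (hp₂ : 1 ≤ p₂) (hq₂ : 1 ≤ q₂) (h₂ : p₂⁻¹ + q₂⁻¹ = 1 + r₂⁻¹) (hr₁ : 1 ≤ r₁) :
    mixedNorm μ r₁ r₂ (fun w => ∫⁻ z, F z * H (w - z) ∂(μ.prod μ)) ≤
      mixedNorm μ p₁ p₂ F * mixedNorm μ q₁ q₂ H := by
  let a : G → ℝ≥0∞ := fun η => eLpNorm (fun x => F (x, η)) p₁ μ
  let b : G → ℝ≥0∞ := fun η => eLpNorm (fun x => H (x, η)) q₁ μ
  have ham : Measurable a :=
    measurable_eLpNorm_section (f := fun η x => F (x, η)) (hF.comp measurable_swap) p₁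
  have hbm : Measurable b :=
    measurable_eLpNorm_section (f := fun η x => H (x, η)) (hH.comp measurable_swap) q₁
  have hK : ∀ w : G × G, Measurable fun z => F z * H (w - z) := fun w =>
    hF.mul (hH.comp (show Measurable fun z : G × G => (w.1 - z.1, w.2 - z.2) by fun_prop))
  have key : ∀ ξ, eLpNorm (fun x => ∫⁻ z, F z * H ((x, ξ) - z) ∂(μ.prod μ)) r₁ μ ≤
      ∫⁻ η, a η * b (ξ - η) ∂μ := by
    intro ξ
    have e1 : (fun x => ∫⁻ z, F z * H ((x, ξ) - z) ∂(μ.prod μ)) = fun x =>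
        ∫⁻ η, ∫⁻ y, F (y, η) * H (x - y, ξ - η) ∂μ ∂μ := by
      ext x
      rw [lintegral_prod_symm' _ (hK (x, ξ))]
      rfl
    rw [e1]
    have hm : Measurable (Function.uncurry
        (fun η x => ∫⁻ y, F (y, η) * H (x - y, ξ - η) ∂μ)) := by
      refine Measurable.lintegral_prod_right' (f := fun u : (G × G) × G =>
        F (u.2, u.1.1) * H (u.1.2 - u.2, ξ - u.1.1)) ?_
      refine (hF.comp ?_).mul (hH.comp ?_)
      · fun_prop
      · fun_prop
    -- Minkowski moves the `L^r₁` norm in `x` under the integral over `η`. Young in the first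
    -- variable then leaves a convolution of the partial norms, handled by Young in the second
    -- variable.
    refine (eLpNorm_lintegral_le hm hr₁).trans (lintegral_mono fun η => ?_)
    exact eLpNorm_conv_le (f := fun y => F (y, η)) (g := fun y => H (y, ξ - η))
      (hF.comp measurable_prodMk_right) (hH.comp measurable_prodMk_right) hp₁ hq₁ h₁
  refine (eLpNorm_mono_enorm fun ξ => ?_).trans (eLpNorm_conv_le ham hbm hp₂ hq₂ h₂)
  simpa using key ξ

end Young

end TimeFreq
end

noncomputable section
namespace TimeFreq

/-! ### A Fubini theorem for tempered distributions. -/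

section Fubini
variable {E F : Type} [NormedAddCommGroup E] [NormedSpace ℝ E]
  [NormedAddCommGroup F] [NormedSpace ℝ F]

/-- The Banach space of bounded continuous functions with values in the `n`-linear forms. -/
def JetSpace (F : Type) [NormedAddCommGroup F] [NormedSpace ℝ F] (n : ℕ) : Type :=
  BoundedContinuousFunction F (F [×n]→L[ℝ] ℂ)

instance (n : ℕ) : NormedAddCommGroup (JetSpace F n) :=
  inferInstanceAs (NormedAddCommGroup (BoundedContinuousFunction F (F [×n]→L[ℝ] ℂ)))

instance (n : ℕ) : NormedSpace ℂ (JetSpace F n) :=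
  inferInstanceAs (NormedSpace ℂ (BoundedContinuousFunction F (F [×n]→L[ℝ] ℂ)))

instance (n : ℕ) : CompleteSpace (JetSpace F n) :=
  inferInstanceAs (CompleteSpace (BoundedContinuousFunction F (F [×n]→L[ℝ] ℂ)))

/-- Evaluation of a function in `JetSpace F n` at a point and at `n` vectors. -/
def JetSpace.eval {n : ℕ} (y : F) (m : Fin n → F) : JetSpace F n →L[ℂ] ℂ :=
  LinearMap.mkContinuous
    { toFun := fun J => (show BoundedContinuousFunction F (F [×n]→L[ℝ] ℂ) from J) y m
      map_add' := fun _ _ => rfl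
      map_smul' := fun _ _ => rfl } (∏ i, ‖m i‖) (fun J => by
        let J' : BoundedContinuousFunction F (F [×n]→L[ℝ] ℂ) := J
        change ‖J' y m‖ ≤ _ * ‖J'‖
        rw [mul_comm]
        refine ((J' y).le_opNorm m).trans ?_
        gcongr
        exact J'.norm_coe_le_norm y)

theorem JetSpace.ext {n : ℕ} {J K : JetSpace F n} (h : ∀ y m, JetSpace.eval y m J = JetSpace.eval y m K) :
    J = K :=
  BoundedContinuousFunction.ext fun y => ContinuousMultilinearMap.ext fun m => h y m

/-- The bounded continuous function `y ↦ ‖y‖ ^ k • Dⁿ φ y` attached to a Schwartz function. -/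
def weightedJet (k n : ℕ) : 𝓢(F, ℂ) →ₗ[ℂ] JetSpace F n where
  toFun φ := BoundedContinuousFunction.ofNormedAddCommGroup
    (fun y => (‖y‖ ^ k : ℝ) • iteratedFDeriv ℝ n φ y)
    ((continuous_norm.pow _).smul ((φ.smooth n).continuous_iteratedFDeriv le_rfl))
    (SchwartzMap.seminorm ℂ k n φ)
    (fun y => by
      rw [norm_smul, norm_pow, norm_norm]
      exact SchwartzMap.le_seminorm ℂ k n φ y)
  map_add' φ ψ := by
    refine BoundedContinuousFunction.ext fun y => ?_
    change (‖y‖ ^ k : ℝ) • iteratedFDeriv ℝ n (⇑(φ + ψ)) y = (‖y‖ ^ k : ℝ) • iteratedFDeriv ℝ n φ y +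
      (‖y‖ ^ k : ℝ) • iteratedFDeriv ℝ n ψ y
    have : (⇑(φ + ψ) : F → ℂ) = ⇑φ + ⇑ψ := by ext; simp
    rw [this, iteratedFDeriv_add_apply (φ.smooth n).contDiffAt (ψ.smooth n).contDiffAt,
      smul_add]
  map_smul' a φ := by
    refine BoundedContinuousFunction.ext fun y => ?_
    change (‖y‖ ^ k : ℝ) • iteratedFDeriv ℝ n (⇑(a • φ)) y =
      a • ((‖y‖ ^ k : ℝ) • iteratedFDeriv ℝ n φ y)
    have : (⇑(a • φ) : F → ℂ) = a • ⇑φ := by ext; simp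
    rw [this, iteratedFDeriv_const_smul_apply (φ.smooth n).contDiffAt, smul_comm]

theorem eval_weightedJet (k n : ℕ) (φ : 𝓢(F, ℂ)) (y : F) (m : Fin n → F) :
    JetSpace.eval y m (weightedJet k n φ) = (‖y‖ ^ k : ℝ) • iteratedFDeriv ℝ n φ y m := rfl

theorem norm_weightedJet (k n : ℕ) (φ : 𝓢(F, ℂ)) :
    ‖weightedJet k n φ‖ = SchwartzMap.seminorm ℂ k n φ := by
  let J : BoundedContinuousFunction F (F [×n]→L[ℝ] ℂ) := weightedJet k n φ
  change ‖J‖ = _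
  refine le_antisymm ?_ (SchwartzMap.seminorm_le_bound ℂ k n φ (norm_nonneg J) fun y => ?_)
  · refine (BoundedContinuousFunction.norm_le (apply_nonneg _ _)).2 fun y => ?_
    change ‖(‖y‖ ^ k : ℝ) • iteratedFDeriv ℝ n φ y‖ ≤ _
    rw [norm_smul, norm_pow, norm_norm]
    exact SchwartzMap.le_seminorm ℂ k n φ y
  · have : ‖(‖y‖ ^ k : ℝ) • iteratedFDeriv ℝ n φ y‖ ≤ ‖J‖ := J.norm_coe_le_norm y
    rwa [norm_smul, norm_pow, norm_norm] at this

/-- Continuity bounds `T` by finitely many Schwartz seminorms, and each of these is the Banach norm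
of a weighted jet. So `T` is bounded on the range of the jet map, and Hahn–Banach extends it to the
whole product. This replaces the Fréchet space by a Banach space, where Bochner integrals commute
with functionals. -/
theorem exists_weightedJet_factor (T : 𝓢(F, ℂ) →L[ℂ] ℂ) : ∃ (s : Finset (ℕ × ℕ))
    (G : (∀ i : s, JetSpace F i.1.2) →L[ℂ] ℂ), ∀ φ, T φ = G (fun i => weightedJet i.1.1 i.1.2 φ) := by
  obtain ⟨s₀, C, -, hC⟩ := Seminorm.bound_of_continuous (schwartz_withSeminorms ℂ F ℂ)
    ((normSeminorm ℂ ℂ).comp T.toLinearMap) (continuous_norm.comp T.continuous)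
  classical
  -- The index `(0, 0)` adds the sup norm, which makes the jet map injective, so that `T` can be
  -- transported to its range.
  let s := insert (0, 0) s₀
  let ι : 𝓢(F, ℂ) →ₗ[ℂ] (∀ i : s, JetSpace F i.1.2) :=
    LinearMap.pi fun i => weightedJet i.1.1 i.1.2
  have hι : Function.Injective ι := by
    refine (injective_iff_map_eq_zero ι).2 fun φ hφ => ?_
    have h0 : weightedJet 0 0 φ = 0 := congrFun hφ ⟨(0, 0), Finset.mem_insert_self _ _⟩
    have h1 := norm_weightedJet 0 0 φ
    rw [h0, norm_zero] at h1
    ext y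
    have h2 := SchwartzMap.norm_le_seminorm ℂ φ y
    simpa [← h1] using h2
  let e := LinearEquiv.ofInjective ι hι
  have hb : ∀ w : LinearMap.range ι, ‖(T.toLinearMap ∘ₗ e.symm.toLinearMap) w‖ ≤ C * ‖w‖ := by
    intro w
    obtain ⟨φ, rfl⟩ := e.surjective w
    simp only [LinearMap.comp_apply, LinearEquiv.coe_coe, LinearEquiv.symm_apply_apply]
    refine (hC φ).trans ?_
    simp only [smul_apply, NNReal.smul_def, smul_eq_mul]
    gcongr
    refine Seminorm.finset_sup_apply_le (norm_nonneg _) fun i hi => ?_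
    refine (norm_weightedJet i.1 i.2 φ).symm.le.trans ?_
    exact norm_le_pi_norm (ι φ) ⟨i, Finset.mem_insert_of_mem hi⟩
  obtain ⟨G, hG, -⟩ := exists_extension_norm_eq (LinearMap.range ι)
    (LinearMap.mkContinuous _ C hb)
  refine ⟨s, G, fun φ => ?_⟩
  have := hG (e φ)
  simp only [LinearMap.mkContinuous_apply, LinearMap.comp_apply, LinearEquiv.coe_coe,
    LinearEquiv.symm_apply_apply] at this
  exact this.symm

theorem slice_taylor (Φ : 𝓢(E × F, ℂ)) (x v : E) :
    slice x (taylorRem (v, (0 : F)) Φ) =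
      slice (x + v) Φ - slice x Φ - slice x (∂_{(v, (0 : F))} Φ) := by
  have hs : slice x (SchwartzMap.compSubConstCLM ℝ (-(v, (0 : F))) Φ) = slice (x + v) Φ := by
    ext y
    simp
  have : taylorRem (v, (0 : F)) Φ = SchwartzMap.compSubConstCLM ℝ (-(v, (0 : F))) Φ - Φ -
    ∂_{(v, (0 : F))} Φ := rfl
  rw [this, map_sub, map_sub, hs]

/-- The increment of a slice is its first-order term plus a Taylor remainder of quadratic size. The
first-order term is linear in `v`, hence controlled by the finitely many coordinates of `v`. This
gives continuity of the jet-valued map `x ↦ slice x Φ`, needed for strong measurability. -/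
theorem tendsto_seminorm_slice [FiniteDimensional ℝ E] (q : Seminorm ℂ 𝓢(F, ℂ)) (hq : Continuous q)
    (Φ : 𝓢(E × F, ℂ)) (x : E) :
    Filter.Tendsto (fun v => q (slice (x + v) Φ - slice x Φ)) (nhds 0) (nhds 0) := by
  let q' : Seminorm ℂ 𝓢(E × F, ℂ) := q.comp (slice x).toLinearMap
  have hq' : Continuous q' := hq.comp (slice x).continuous
  obtain ⟨C, hC, h⟩ := taylorRem_seminorm q' hq' Φ
  let b := Module.finBasis ℝ E
  let c : Fin (Module.finrank ℝ E) → (E →L[ℝ] ℝ) := fun i => (b.coord i).toContinuousLinearMap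
  have hd : ∀ v, q (slice x (∂_{(v, (0 : F))} Φ)) ≤
      ∑ i, ‖c i v‖ * q (slice x (∂_{(b i, (0 : F))} Φ)) := by
    intro v
    have e1 : ((v, 0) : E × F) = ∑ i, c i v • ((b i, 0) : E × F) := by
      ext
      · rw [Prod.fst_sum]
        simp [c, b.sum_repr v]
      · rw [Prod.snd_sum]
        simp
    have e2 : ∀ t : Finset (Fin (Module.finrank ℝ E)),
        q (slice x (∂_{∑ i ∈ t, c i v • ((b i, 0) : E × F)} Φ)) ≤
          ∑ i ∈ t, ‖c i v‖ * q (slice x (∂_{(b i, (0 : F))} Φ)) := by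
      classical
      intro t
      induction t using Finset.induction_on with
      | empty =>
        have : (∂_{(0 : E × F)} Φ) = 0 := by
          ext z
          simp
        simp [this]
      | insert a t ha ih =>
        rw [Finset.sum_insert ha, Finset.sum_insert ha, LineDeriv.lineDerivOp_left_add, map_add]
        refine (map_add_le_add q _ _).trans (add_le_add ?_ ih)
        rw [LineDeriv.lineDerivOp_left_smul]
        have : (slice x) (c a v • ∂_{(b a, (0 : F))} Φ) =
            ((c a v : ℝ) : ℂ) • (slice x) (∂_{(b a, (0 : F))} Φ) := by
          ext y
          simp
        rw [this, map_smul_eq_mul]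
        simp
    rw [e1]
    exact e2 _
  have hlim : Filter.Tendsto (fun v : E => C * ‖v‖ ^ 2 +
      ∑ i, ‖c i v‖ * q (slice x (∂_{(b i, (0 : F))} Φ))) (nhds 0) (nhds 0) := by
    have : Continuous (fun v : E => C * ‖v‖ ^ 2 +
      ∑ i, ‖c i v‖ * q (slice x (∂_{(b i, (0 : F))} Φ))) := by fun_prop
    have h0 := this.tendsto 0
    simpa using h0
  refine squeeze_zero' (Filter.Eventually.of_forall fun v => apply_nonneg _ _) ?_ hlim
  filter_upwards [Metric.closedBall_mem_nhds (0 : E) one_pos] with v hv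
  have hv1 : ‖((v, 0) : E × F)‖ = ‖v‖ := by simp
  have h1 := h (v, 0) (by rw [hv1]; simpa using hv)
  rw [hv1] at h1
  have h2 : slice (x + v) Φ - slice x Φ =
      slice x (taylorRem (v, (0 : F)) Φ) + slice x (∂_{(v, (0 : F))} Φ) := by
    rw [slice_taylor]
    abel
  rw [h2]
  exact (map_add_le_add q _ _).trans (add_le_add h1 (hd v))

/-- The difference quotient may be taken inside `T`, since the Taylor remainder is quadratic in
every continuous seminorm. With `T` an integral, this is differentiation under the integral sign. -/
theorem partialPairing_lineDeriv [FiniteDimensional ℝ E] (T : 𝓢(F, ℂ) →L[ℂ] ℂ) (Φ : 𝓢(E × F, ℂ))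
    (v : E) : ∂_{v} (partialPairing T Φ) = partialPairing T (∂_{(v, (0 : F))} Φ) := by
  ext x
  rw [SchwartzMap.lineDerivOp_apply]
  refine HasLineDerivAt.lineDeriv ?_
  rw [HasLineDerivAt, hasDerivAt_iff_isLittleO_nhds_zero]
  let q : Seminorm ℂ 𝓢(E × F, ℂ) := (normSeminorm ℂ ℂ).comp (T ∘L slice x).toLinearMap
  have hq : Continuous q := continuous_norm.comp (T ∘L slice x).continuous
  obtain ⟨C, hC, h⟩ := taylorRem_seminorm q hq Φ
  refine Asymptotics.IsBigO.trans_isLittleO (g := fun t : ℝ => ‖t‖ ^ 2) ?_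
    (by simpa using Asymptotics.isLittleO_norm_pow_id one_lt_two (E' := ℝ))
  refine Asymptotics.IsBigO.of_bound (C * ‖v‖ ^ 2) ?_
  have hn : ∀ᶠ t : ℝ in nhds 0, ‖t • v‖ ≤ 1 := by
    have : Continuous fun t : ℝ => ‖t • v‖ := by fun_prop
    exact (this.tendsto 0).eventually_le_const (by simp)
  filter_upwards [hn] with t ht
  have hv1 : ‖((t • v, 0) : E × F)‖ = ‖t • v‖ := by simp
  have h1 := h (t • v, 0) (by rw [hv1]; exact ht)
  rw [hv1] at h1
  have h2 : ((t • v, 0) : E × F) = t • (v, 0) := by simp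
  have h3 : slice x (∂_{((t • v, 0) : E × F)} Φ) = (t : ℂ) • slice x (∂_{(v, (0 : F))} Φ) := by
    rw [h2, LineDeriv.lineDerivOp_left_smul]
    ext y
    simp
  change ‖T (slice x (taylorRem (t • v, 0) Φ))‖ ≤ _ at h1
  rw [slice_taylor, map_sub, map_sub, h3, map_smul] at h1
  simp only [partialPairing_apply, zero_add, zero_smul, add_zero, norm_pow, norm_norm]
  calc _ ≤ C * ‖t • v‖ ^ 2 := by
        rw [← Complex.coe_smul]
        exact h1
    _ = _ := by rw [norm_smul]; ring

variable [FiniteDimensional ℝ E] [FiniteDimensional ℝ F] [MeasurableSpace E] [BorelSpace E]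

/-- Integration of a Schwartz function of two variables in its first variable. -/
def integralFst (μ : Measure E) [μ.HasTemperateGrowth] : 𝓢(E × F, ℂ) →L[ℂ] 𝓢(F, ℂ) :=
  partialPairing (SchwartzMap.integralCLM ℂ μ) ∘L
    SchwartzMap.compCLMOfContinuousLinearEquiv ℂ (ContinuousLinearEquiv.prodComm ℝ F E)

theorem integralFst_apply (μ : Measure E) [μ.HasTemperateGrowth] (Φ : 𝓢(E × F, ℂ)) (y : F) :
    integralFst μ Φ y = ∫ x, Φ (x, y) ∂μ := rfl

theorem lineDeriv_integralFst (μ : Measure E) [μ.HasTemperateGrowth] (Φ : 𝓢(E × F, ℂ)) (v : F) :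
    ∂_{v} (integralFst μ Φ) = integralFst μ (∂_{((0 : E), v)} Φ) := by
  simp only [integralFst, ContinuousLinearMap.comp_apply]
  rw [partialPairing_lineDeriv, SchwartzMap.lineDerivOp_compCLMOfContinuousLinearEquiv]
  rfl

omit [FiniteDimensional ℝ E] [FiniteDimensional ℝ F] [MeasurableSpace E] [BorelSpace E] in
theorem lineDeriv_slice (Φ : 𝓢(E × F, ℂ)) (x : E) (v : F) :
    ∂_{v} (slice x Φ) = slice x (∂_{((0 : E), v)} Φ) := by
  ext y
  rw [SchwartzMap.lineDerivOp_apply_eq_fderiv, slice_apply, SchwartzMap.lineDerivOp_apply_eq_fderiv]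
  have h : HasFDerivAt (slice x Φ) ((fderiv ℝ Φ (x, y)).comp
      (ContinuousLinearMap.inr ℝ E F)) y := by
    have := (Φ.hasFDerivAt (x, y)).comp y ((hasFDerivAt_const x y).prodMk (hasFDerivAt_id y))
    convert! this using 1
  rw [h.fderiv]
  simp

/-- Each directional derivative in `F` passes both through the integral and through the slices as
the derivative of `Φ` along `(0, v)`. The induction keeps a single Schwartz function `Ψ` that
represents both sides. The result identifies the jets of an integral with the integrals of the jets.
-/
theorem iteratedFDeriv_integralFst (μ : Measure E) [μ.HasTemperateGrowth] (n : ℕ) (m : Fin n → F)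
    (Φ : 𝓢(E × F, ℂ)) (y : F) : iteratedFDeriv ℝ n (integralFst μ Φ) y m =
      ∫ x, iteratedFDeriv ℝ n (slice x Φ) y m ∂μ := by
  have key : ∀ (n : ℕ) (m : Fin n → F), ∃ Ψ : 𝓢(E × F, ℂ), ∂^{m} (integralFst μ Φ) = integralFst μ Ψ ∧
      ∀ x, ∂^{m} (slice x Φ) = slice x Ψ := by
    intro n
    induction n with
    | zero => exact fun m => ⟨Φ, by simp, fun x => by simp⟩
    | succ n ih =>
      intro m
      obtain ⟨Ψ, h1, h2⟩ := ih (Fin.tail m)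
      refine ⟨∂_{((0 : E), m 0)} Ψ, ?_, fun x => ?_⟩
      · rw [LineDeriv.iteratedLineDerivOp_succ_left, h1, lineDeriv_integralFst]
      · rw [LineDeriv.iteratedLineDerivOp_succ_left, h2, lineDeriv_slice]
  obtain ⟨Ψ, h1, h2⟩ := key n m
  simp only [← SchwartzMap.iteratedLineDerivOp_eq_iteratedFDeriv, h1, h2, integralFst_apply,
    slice_apply]

/-- Fubini's theorem for a tempered distribution and a Schwartz function of two variables. -/
theorem distribution_integral (μ : Measure E) [μ.HasTemperateGrowth] (T : 𝓢(F, ℂ) →L[ℂ] ℂ)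
    (Φ : 𝓢(E × F, ℂ)) : T (integralFst μ Φ) = ∫ x, T (slice x Φ) ∂μ := by
  obtain ⟨s, G, hG⟩ := exists_weightedJet_factor T
  let J : E → (∀ i : s, JetSpace F i.1.2) := fun x i => weightedJet i.1.1 i.1.2 (slice x Φ)
  have hJi : ∀ i, Integrable (fun x => J x i) μ := by
    intro i
    have hc : Continuous (fun x => J x i) := by
      rw [continuous_iff_continuousAt]
      intro x
      rw [ContinuousAt, tendsto_iff_norm_sub_tendsto_zero]
      have h0 := tendsto_seminorm_slice (SchwartzMap.seminorm ℂ i.1.1 i.1.2)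
        ((schwartz_withSeminorms ℂ F ℂ).continuous_seminorm i.1) Φ x
      have h1 : Filter.Tendsto (fun x' : E => x' - x) (nhds x) (nhds 0) := by
        have : Continuous fun x' : E => x' - x := by fun_prop
        simpa using this.tendsto x
      refine (h0.comp h1).congr fun x' => ?_
      simp only [J, ← map_sub, Function.comp_apply, add_sub_cancel, norm_weightedJet]
    have hcont := (schwartz_withSeminorms ℂ F ℂ).continuous_seminorm i.1
    -- Weight 0 bounds the norm of the jet, and the weight `μ.integrablePower` gives the decay in
    -- `x` that makes it integrable.
    obtain ⟨q0, -, h0⟩ := slice_bound (E := E) (F := F) 0 (SchwartzMap.seminorm ℂ i.1.1 i.1.2) hcont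
    obtain ⟨q1, -, h1⟩ := slice_bound (E := E) (F := F) μ.integrablePower
      (SchwartzMap.seminorm ℂ i.1.1 i.1.2) hcont
    have := integrable_of_le_of_pow_mul_le (μ := μ) (f := fun x => J x i) (k := 0)
      (C₁ := q0 Φ) (C₂ := q1 Φ) (fun x => ?_) (fun x => ?_) hc.aestronglyMeasurable
    · refine (integrable_norm_iff hc.aestronglyMeasurable).1 ?_
      simpa using this
    · have := h0 x Φ
      rw [pow_zero, one_mul] at this
      exact (norm_weightedJet _ _ _).le.trans this
    · rw [zero_add, norm_weightedJet]
      exact h1 x Φ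
  have hJ : Integrable J μ := Integrable.of_eval hJi
  simp only [hG]
  rw [show (fun x => G fun i : s => weightedJet i.1.1 i.1.2 (slice x Φ)) = fun x => G (J x) from rfl,
    ContinuousLinearMap.integral_comp_comm G hJ]
  congr 1
  ext i
  rw [MeasureTheory.eval_integral hJi]
  -- Evaluation at `y` and `m` is a continuous functional, so the Bochner integral can be computed
  -- pointwise. The weight `‖y‖ ^ k` does not depend on `x`.
  refine JetSpace.ext fun y m => ?_
  rw [← ContinuousLinearMap.integral_comp_comm _ (hJi i)]
  simp only [J, eval_weightedJet, iteratedFDeriv_integralFst]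
  rw [integral_smul]

end Fubini

end TimeFreq
end

noncomputable section
namespace TimeFreq

/-! ### Tensor products of Schwartz functions. -/

section Tensor
variable {E F : Type} [NormedAddCommGroup E] [NormedSpace ℝ E]
  [NormedAddCommGroup F] [NormedSpace ℝ F]

theorem norm_iteratedFDeriv_comp_fst_le (φ : 𝓢(E, ℂ)) (n : ℕ) (z : E × F) :
    ‖iteratedFDeriv ℝ n (fun z : E × F => φ z.1) z‖ ≤ ‖iteratedFDeriv ℝ n φ z.1‖ := by
  have := ContinuousLinearMap.iteratedFDeriv_comp_right (ContinuousLinearMap.fst ℝ E F)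
    (φ.smooth n) z (i := n) le_rfl
  change ‖iteratedFDeriv ℝ n (φ ∘ (ContinuousLinearMap.fst ℝ E F)) z‖ ≤ _
  rw [this]
  refine (ContinuousMultilinearMap.norm_compContinuousLinearMap_le _ _).trans ?_
  exact mul_le_of_le_one_right (norm_nonneg _) (Finset.prod_le_one (fun _ _ => norm_nonneg _)
    fun _ _ => ContinuousLinearMap.norm_fst_le ..)

theorem norm_iteratedFDeriv_comp_snd_le (φ : 𝓢(F, ℂ)) (n : ℕ) (z : E × F) :
    ‖iteratedFDeriv ℝ n (fun z : E × F => φ z.2) z‖ ≤ ‖iteratedFDeriv ℝ n φ z.2‖ := by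
  have := ContinuousLinearMap.iteratedFDeriv_comp_right (ContinuousLinearMap.snd ℝ E F)
    (φ.smooth n) z (i := n) le_rfl
  change ‖iteratedFDeriv ℝ n (φ ∘ (ContinuousLinearMap.snd ℝ E F)) z‖ ≤ _
  rw [this]
  refine (ContinuousMultilinearMap.norm_compContinuousLinearMap_le _ _).trans ?_
  exact mul_le_of_le_one_right (norm_nonneg _) (Finset.prod_le_one (fun _ _ => norm_nonneg _)
    fun _ _ => ContinuousLinearMap.norm_snd_le ..)

/-- The tensor product `(x, y) ↦ φ x * ψ y` of two Schwartz functions. -/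
def tensor (φ : 𝓢(E, ℂ)) (ψ : 𝓢(F, ℂ)) : 𝓢(E × F, ℂ) where
  toFun z := φ z.1 * ψ z.2
  smooth' := (φ.smooth'.comp contDiff_fst).mul (ψ.smooth'.comp contDiff_snd)
  decay' k n := by
    have hφ : ContDiff ℝ n (fun z : E × F => φ z.1) := (φ.smooth n).comp contDiff_fst
    have hψ : ContDiff ℝ n (fun z : E × F => ψ z.2) := (ψ.smooth n).comp contDiff_snd
    let p := fun i j => SchwartzMap.seminorm ℝ i j φ
    let r := fun i j => SchwartzMap.seminorm ℝ i j ψ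
    refine ⟨∑ i ∈ Finset.range (n + 1), (n.choose i : ℝ) *
      (p k i * r 0 (n - i) + p 0 i * r k (n - i)), fun z => ?_⟩
    have h1 := norm_iteratedFDeriv_mul_le hφ hψ z (n := n) le_rfl
    have e3 : ‖z‖ ^ k ≤ ‖z.1‖ ^ k + ‖z.2‖ ^ k := by
      rcases max_choice ‖z.1‖ ‖z.2‖ with h | h <;> rw [Prod.norm_def, h]
      · linarith [pow_nonneg (norm_nonneg z.2) k]
      · linarith [pow_nonneg (norm_nonneg z.1) k]
    calc _ ≤ (‖z.1‖ ^ k + ‖z.2‖ ^ k) * ∑ i ∈ Finset.range (n + 1), (n.choose i : ℝ) *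
          ‖iteratedFDeriv ℝ i φ z.1‖ * ‖iteratedFDeriv ℝ (n - i) ψ z.2‖ := by
          refine mul_le_mul e3 (h1.trans ?_) (norm_nonneg _) (by positivity)
          gcongr
          · exact norm_iteratedFDeriv_comp_fst_le φ _ z
          · exact norm_iteratedFDeriv_comp_snd_le ψ _ z
      _ ≤ _ := by
          rw [Finset.mul_sum]
          refine Finset.sum_le_sum fun i _ => ?_
          calc _ = (n.choose i : ℝ) * ((‖z.1‖ ^ k * ‖iteratedFDeriv ℝ i φ z.1‖) *
                ‖iteratedFDeriv ℝ (n - i) ψ z.2‖ + ‖iteratedFDeriv ℝ i φ z.1‖ *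
                (‖z.2‖ ^ k * ‖iteratedFDeriv ℝ (n - i) ψ z.2‖)) := by ring
            _ ≤ _ := by
              gcongr
              · exact SchwartzMap.le_seminorm ℝ k i φ z.1
              · exact SchwartzMap.norm_iteratedFDeriv_le_seminorm ℝ ψ _ z.2
              · exact SchwartzMap.norm_iteratedFDeriv_le_seminorm ℝ φ _ z.1
              · exact SchwartzMap.le_seminorm ℝ k _ ψ z.2

@[simp] theorem tensor_apply (φ : 𝓢(E, ℂ)) (ψ : 𝓢(F, ℂ)) (z : E × F) :
    tensor φ ψ z = φ z.1 * ψ z.2 := rfl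

end Tensor

/-! ### Gaussians as Schwartz functions. -/

section Gaussian
variable {H : Type} [NormedAddCommGroup H] [InnerProductSpace ℝ H]

/-- The derivative of the Gaussian is the Gaussian times a linear map `L`. By the Leibniz rule, a
derivative of order `n + 1` is bounded by lower derivatives times the polynomially bounded
derivatives of `L`, so strong induction for all weights `k` at once closes the estimate. -/
theorem gaussian_decay {a : ℝ} (ha : 0 < a) (n : ℕ) : ∀ k : ℕ, ∃ C, ∀ x : H,
    ‖x‖ ^ k * ‖iteratedFDeriv ℝ n (fun x : H => Complex.exp (↑(-a * ‖x‖ ^ 2))) x‖ ≤ C := by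
  set f : H → ℂ := fun x : H => Complex.exp (↑(-a * ‖x‖ ^ 2)) with hf
  have hs : ContDiff ℝ ∞ f := by
    have h1 : ContDiff ℝ ∞ (fun x : H => -a * ‖x‖ ^ 2) := contDiff_const.mul (contDiff_norm_sq ℝ)
    exact (Complex.ofRealCLM.contDiff.comp h1).cexp
  let I : H →L[ℝ] (H →L[ℝ] ℝ) := LinearMap.mkContinuous₂ (innerₗ H) 1 fun x y => by
    simpa using norm_inner_le_norm (𝕜 := ℝ) x y
  let L : H →L[ℝ] (H →L[ℝ] ℂ) := (-2 * a) • (ContinuousLinearMap.compL ℝ H ℝ ℂ Complex.ofRealCLM).comp I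
  have hd : fderiv ℝ f = fun x => f x • L x := by
    ext1 x
    have h1 : HasFDerivAt (fun x : H => -a * ‖x‖ ^ 2) ((-a) • ((2 : ℝ) • (I x))) x := by
      have := (hasStrictFDerivAt_norm_sq x).hasFDerivAt.const_mul (-a)
      convert! this using 1
      ext y
      simp [I]
    have h2 := (Complex.ofRealCLM.hasFDerivAt.comp x h1).cexp
    change HasFDerivAt f _ x at h2
    rw [h2.fderiv]
    ext y
    simp [L, I, hf]
    ring_nf
  have hL := L.hasTemperateGrowth
  induction n using Nat.strong_induction_on with
  | _ n ih =>
    rcases n with _ | n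
    · intro k
      refine ⟨1 + (k.factorial : ℝ) / a ^ k, fun x => ?_⟩
      rw [norm_iteratedFDeriv_zero]
      simp only [hf, Complex.norm_exp_ofReal]
      have h1 := Real.pow_div_factorial_le_exp (a * ‖x‖ ^ 2) (by positivity) k
      -- Passing to even powers allows comparison with the term `(a ‖x‖²)^k / k!` of the exponential
      -- series.
      have h2 : ‖x‖ ^ k ≤ 1 + (‖x‖ ^ 2) ^ k := by
        rw [← pow_mul, mul_comm 2 k, pow_mul]
        nlinarith [sq_nonneg (‖x‖ ^ k - 1), sq_nonneg (‖x‖ ^ k)]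
      have h3 : (‖x‖ ^ 2) ^ k * Real.exp (-a * ‖x‖ ^ 2) ≤ (k.factorial : ℝ) / a ^ k := by
        rw [le_div_iff₀ (by positivity), neg_mul, Real.exp_neg]
        have hpos := Real.exp_pos (a * ‖x‖ ^ 2)
        rw [div_le_iff₀ (by positivity)] at h1
        rw [mul_assoc, mul_comm, mul_assoc, inv_mul_le_iff₀ hpos]
        calc _ = (a * ‖x‖ ^ 2) ^ k := by ring
          _ ≤ _ := h1
      have h4 : Real.exp (-a * ‖x‖ ^ 2) ≤ 1 := by
        rw [Real.exp_le_one_iff]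
        nlinarith [sq_nonneg ‖x‖]
      calc _ ≤ (1 + (‖x‖ ^ 2) ^ k) * Real.exp (-a * ‖x‖ ^ 2) := by gcongr
        _ ≤ _ := by linarith
    · intro k
      choose K c hc using fun j => hL.2 j
      choose C hC using fun i (hi : i < n + 1) k => ih i hi k
      refine ⟨∑ i ∈ (Finset.range (n + 1)).attach, (n.choose i : ℝ) * (c (n - i) * (2 ^ (K (n - i) - 1) *
        (C i.1 (Finset.mem_range.1 i.2) k + C i.1 (Finset.mem_range.1 i.2) (k + K (n - i))))), fun x => ?_⟩
      rw [← norm_iteratedFDeriv_fderiv, hd]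
      have h1 := norm_iteratedFDeriv_smul_le (hs.of_le (mod_cast le_top) : ContDiff ℝ n f)
        (L.contDiff (n := n)) x (n := n) le_rfl
      refine (mul_le_mul_of_nonneg_left h1 (by positivity)).trans ?_
      rw [← Finset.sum_attach, Finset.mul_sum]
      refine Finset.sum_le_sum fun i _ => ?_
      have hi := Finset.mem_range.1 i.2
      have h2 := hc (n - i) x
      have hc0 : 0 ≤ c (n - i) :=
        nonneg_of_mul_nonneg_left ((norm_nonneg _).trans h2) (by positivity)
      -- This is convexity of powers. The subtraction is truncated: when `K (n - i) = 0` the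
      -- inequality reads `1 ≤ 2`.
      have h3 : (1 + ‖x‖) ^ K (n - i) ≤ 2 ^ (K (n - i) - 1) * (1 + ‖x‖ ^ K (n - i)) := by
        have := add_pow_le zero_le_one (norm_nonneg x) (K (n - i))
        simpa using this
      calc _ = (n.choose i : ℝ) * (‖iteratedFDeriv ℝ (n - i) L x‖ *
              (‖x‖ ^ k * ‖iteratedFDeriv ℝ i f x‖)) := by ring
        _ ≤ (n.choose i : ℝ) * ((c (n - i) * (2 ^ (K (n - i) - 1) * (1 + ‖x‖ ^ K (n - i)))) *
              (‖x‖ ^ k * ‖iteratedFDeriv ℝ i f x‖)) := by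
            gcongr
            exact h2.trans (by gcongr)
        _ = (n.choose i : ℝ) * (c (n - i) * (2 ^ (K (n - i) - 1) * (‖x‖ ^ k * ‖iteratedFDeriv ℝ i f x‖ +
              ‖x‖ ^ (k + K (n - i)) * ‖iteratedFDeriv ℝ i f x‖))) := by ring
        _ ≤ _ := by
            gcongr
            · exact hC i hi k x
            · exact hC i hi _ x

/-- The Gaussian `x ↦ exp (-a ‖x‖²)` as a Schwartz function. -/
def gaussian (a : ℝ) (ha : 0 < a) : 𝓢(H, ℂ) where
  toFun x := Complex.exp (↑(-a * ‖x‖ ^ 2))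
  smooth' := (Complex.ofRealCLM.contDiff.comp (contDiff_const.mul (contDiff_norm_sq ℝ))).cexp
  decay' k n := gaussian_decay ha n k

@[simp] theorem gaussian_apply (a : ℝ) (ha : 0 < a) (x : H) :
    gaussian a ha x = Complex.exp (↑(-a * ‖x‖ ^ 2)) := rfl

end Gaussian

end TimeFreq
end

/-! ### The short-time Fourier transform: continuity, reconstruction and change of window. -/

noncomputable section
namespace TimeFreq

variable {d : ℕ}

instance : (volume : Measure (Rd d × Rd d)).IsAddHaarMeasure :=
  inferInstanceAs ((volume : Measure (Rd d)).prod (volume : Measure (Rd d))).IsAddHaarMeasure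

instance : (volume : Measure (Rd d × Rd d)).HasTemperateGrowth :=
  Measure.IsAddHaarMeasure.instHasTemperateGrowth

theorem hasTemperateGrowth_cexp_bilin {X Y : Type} [NormedAddCommGroup X] [NormedSpace ℝ X]
    [NormedAddCommGroup Y] [InnerProductSpace ℝ Y] (A B : X →L[ℝ] Y) (c : ℝ) :
    Function.HasTemperateGrowth
      (fun w : X => Complex.exp (↑(c * inner ℝ (A w) (B w)) * Complex.I)) := by
  let I : Y →L[ℝ] (Y →L[ℝ] ℝ) := LinearMap.mkContinuous₂ (innerₗ Y) 1 fun x y => by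
    simpa using norm_inner_le_norm (𝕜 := ℝ) x y
  have h := I.bilinear_hasTemperateGrowth A.hasTemperateGrowth B.hasTemperateGrowth
  exact hasTemperateGrowth_cexp.comp ((Function.HasTemperateGrowth.const c).mul h)

/-- A tempered distribution as a continuous linear functional. -/
def toCLM {E : Type} [NormedAddCommGroup E] [NormedSpace ℝ E] (f : 𝓢'(E, ℂ)) :
    𝓢(E, ℂ) →L[ℂ] ℂ where
  toFun := f
  map_add' := map_add f
  map_smul' := map_smul f
  cont := f.continuous

@[simp] theorem toCLM_apply {E : Type} [NormedAddCommGroup E] [NormedSpace ℝ E] (f : 𝓢'(E, ℂ))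
    (φ : 𝓢(E, ℂ)) : toCLM f φ = f φ := rfl

/-- The conjugated time-frequency shift `t ↦ conj (g (t - x)) exp (-2 π i t · ξ)`. -/
def window (g : 𝓢(Rd d, ℂ)) (z : Rd d × Rd d) : 𝓢(Rd d, ℂ) :=
  conjS (modulation z.2 (SchwartzMap.compSubConstCLM ℂ z.1 g))

theorem stft_eq (g : 𝓢(Rd d, ℂ)) (f : 𝓢'(Rd d, ℂ)) (z : Rd d × Rd d) :
    stft g f z.1 z.2 = f (window g z) := rfl

theorem window_apply (g : 𝓢(Rd d, ℂ)) (z : Rd d × Rd d) (t : Rd d) :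
    window g z t = starRingEnd ℂ (g (t - z.1)) *
      Complex.exp (↑(-2 * Real.pi * inner ℝ t z.2) * Complex.I) := by
  simp only [window, conjS_apply, modulation_apply, map_mul, ← Complex.exp_conj, Complex.conj_ofReal,
    Complex.conj_I, compSubConstCLM_apply]
  rw [mul_comm]
  congr 2
  push_cast
  ring

/-- The linear change of variables `((x, ξ), t) ↦ ((x, ξ), t - x)`. -/
def shear : ((Rd d × Rd d) × Rd d) ≃L[ℝ] ((Rd d × Rd d) × Rd d) :=
  LinearEquiv.toContinuousLinearEquiv
    { toFun := fun w => (w.1, w.2 - w.1.1)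
      invFun := fun w => (w.1, w.2 + w.1.1)
      map_add' := fun w w' => by ext <;> simp <;> ring
      map_smul' := fun a w => by ext <;> simp <;> ring
      left_inv := fun w => by ext <;> simp
      right_inv := fun w => by ext <;> simp }

/-- The Schwartz function `((x, ξ), t) ↦ H (x, ξ) conj (g (t - x)) exp (-2 π i t · ξ)`. -/
def windowKernel (H : 𝓢(Rd d × Rd d, ℂ)) (g : 𝓢(Rd d, ℂ)) : 𝓢((Rd d × Rd d) × Rd d, ℂ) :=
  SchwartzMap.smulLeftCLM ℂ
    (fun w : (Rd d × Rd d) × Rd d => Complex.exp (↑(-2 * Real.pi * inner ℝ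
      (ContinuousLinearMap.snd ℝ (Rd d × Rd d) (Rd d) w)
      (((ContinuousLinearMap.snd ℝ (Rd d) (Rd d)).comp
        (ContinuousLinearMap.fst ℝ (Rd d × Rd d) (Rd d))) w)) * Complex.I))
    (SchwartzMap.compCLMOfContinuousLinearEquiv ℂ shear (tensor H (conjS g)))

theorem windowKernel_apply (H : 𝓢(Rd d × Rd d, ℂ)) (g : 𝓢(Rd d, ℂ)) (z : Rd d × Rd d) (t : Rd d) :
    windowKernel H g (z, t) = H z * window g z t := by
  rw [windowKernel, SchwartzMap.smulLeftCLM_apply_apply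
    (hasTemperateGrowth_cexp_bilin _ _ _), window_apply]
  simp [shear]
  ring

theorem slice_windowKernel (H : 𝓢(Rd d × Rd d, ℂ)) (g : 𝓢(Rd d, ℂ)) (z : Rd d × Rd d) :
    slice z (windowKernel H g) = H z • window g z := by
  ext t
  rw [slice_apply, windowKernel_apply]
  rfl

/-- The window at `z` does not decay in `z`, but after multiplication by a nowhere vanishing
Gaussian `G z` it is the slice of a Schwartz function of `(z, t)`. So `G` times the transform is a
Schwartz function, and one divides by `G`. -/
theorem continuous_stft (g : 𝓢(Rd d, ℂ)) (f : 𝓢'(Rd d, ℂ)) :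
    Continuous (fun z : Rd d × Rd d => stft g f z.1 z.2) := by
  let G : 𝓢(Rd d × Rd d, ℂ) := tensor (gaussian 1 one_pos) (gaussian 1 one_pos)
  have hG : ∀ z, G z ≠ 0 := fun z => by simp [G]
  have h1 : (fun z : Rd d × Rd d => stft g f z.1 z.2) =
      fun z => partialPairing (toCLM f) (windowKernel G g) z / G z := by
    ext z
    rw [partialPairing_apply, slice_windowKernel, stft_eq, map_smul, smul_eq_mul,
      mul_div_cancel_left₀ _ (hG z), toCLM_apply]
  rw [h1]
  exact (SchwartzMap.continuous _).div G.continuous hG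

/-- The linear change of variables `(x, s) ↦ (s, s - x)`. -/
def swapShear : (Rd d × Rd d) ≃L[ℝ] (Rd d × Rd d) :=
  LinearEquiv.toContinuousLinearEquiv
    { toFun := fun w => (w.2, w.2 - w.1)
      invFun := fun w => (w.1 - w.2, w.1)
      map_add' := fun w w' => by ext <;> simp <;> ring
      map_smul' := fun a w => by ext <;> simp <;> ring
      left_inv := fun w => by ext <;> simp
      right_inv := fun w => by ext <;> simp }

/-- The Schwartz function `(x, ξ) ↦ ∫ ψ s * g (s - x) * exp (2 π i s · ξ) ds`. -/
def windowCoeff (ψ g : 𝓢(Rd d, ℂ)) : 𝓢(Rd d × Rd d, ℂ) :=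
  SchwartzMap.compCLMOfContinuousLinearEquiv ℂ
    ((ContinuousLinearEquiv.refl ℝ (Rd d)).prodCongr (ContinuousLinearEquiv.neg ℝ))
    (partialFourier (SchwartzMap.compCLMOfContinuousLinearEquiv ℂ swapShear (tensor ψ g)))

theorem windowCoeff_eq_fourier (ψ g : 𝓢(Rd d, ℂ)) (x ξ : Rd d) :
    windowCoeff ψ g (x, ξ) = 𝓕 (slice x (SchwartzMap.compCLMOfContinuousLinearEquiv ℂ swapShear
      (tensor ψ g))) (-ξ) := rfl

theorem windowCoeff_apply (ψ g : 𝓢(Rd d, ℂ)) (z : Rd d × Rd d) :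
    windowCoeff ψ g z = ∫ s, ψ s * g (s - z.1) *
      Complex.exp (↑(2 * Real.pi * inner ℝ s z.2) * Complex.I) := by
  obtain ⟨x, ξ⟩ := z
  rw [windowCoeff_eq_fourier, SchwartzMap.fourier_coe, Real.fourier_eq']
  congr 1
  ext s
  simp [swapShear]
  ring

/-- Covariance: a time-frequency shift of the analysed function translates its coefficients, up to a
unimodular factor. This is what produces a convolution when the window is changed. -/
theorem norm_windowCoeff_window (φ g : 𝓢(Rd d, ℂ)) (w z : Rd d × Rd d) :
    ‖windowCoeff (window φ w) g z‖ = ‖windowCoeff (window φ 0) g (z - w)‖ := by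
  rw [windowCoeff_apply, windowCoeff_apply,
    ← integral_add_right_eq_self (μ := (volume : Measure (Rd d))) _ w.1]
  have : ∀ s : Rd d, window φ w (s + w.1) * g (s + w.1 - z.1) *
      Complex.exp (↑(2 * Real.pi * inner ℝ (s + w.1) z.2) * Complex.I) =
      Complex.exp (↑(2 * Real.pi * inner ℝ w.1 (z.2 - w.2)) * Complex.I) *
      (window φ 0 s * g (s - (z - w).1) *
      Complex.exp (↑(2 * Real.pi * inner ℝ s (z - w).2) * Complex.I)) := by
    intro s
    have e1 : Complex.exp (↑(-2 * Real.pi * inner ℝ (s + w.1) w.2) * Complex.I) *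
        Complex.exp (↑(2 * Real.pi * inner ℝ (s + w.1) z.2) * Complex.I) =
        Complex.exp (↑(2 * Real.pi * inner ℝ w.1 (z.2 - w.2)) * Complex.I) *
        Complex.exp (↑(2 * Real.pi * inner ℝ s (z - w).2) * Complex.I) := by
      rw [← Complex.exp_add, ← Complex.exp_add]
      congr 1
      simp only [inner_add_left, inner_sub_right, Prod.snd_sub]
      push_cast
      ring
    have e2 : s + w.1 - z.1 = s - (z - w).1 := by
      simp only [Prod.fst_sub]
      abel
    simp only [window_apply, add_sub_cancel_right, Prod.fst_zero, sub_zero, Prod.snd_zero,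
      inner_zero_right, mul_zero, Complex.ofReal_zero, zero_mul, Complex.exp_zero, mul_one, e2]
    linear_combination (starRingEnd ℂ (φ s) * g (s - (z - w).1)) * e1
  simp only [this]
  rw [integral_const_mul, norm_mul, Complex.norm_exp_ofReal_mul_I, one_mul]

/-- The reconstruction formula. For fixed `x`, the integral over `ξ` is Fourier inversion for `s ↦ ψ
s * g (s - x)`, which gives `ψ t * |g (t - x)|²`. The integral over `x` then yields the squared `L²`
norm of `g`. -/
theorem integral_windowKernel (ψ g : 𝓢(Rd d, ℂ)) :
    integralFst volume (windowKernel (windowCoeff ψ g) g) = ((∫ t, ‖g t‖ ^ 2 : ℝ) : ℂ) • ψ := by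
  ext t
  rw [integralFst_apply]
  have hi : Integrable (fun z => windowKernel (windowCoeff ψ g) g (z, t))
      (volume : Measure (Rd d × Rd d)) :=
    (slice t (SchwartzMap.compCLMOfContinuousLinearEquiv ℂ
      (ContinuousLinearEquiv.prodComm ℝ (Rd d) (Rd d × Rd d))
      (windowKernel (windowCoeff ψ g) g))).integrable
  rw [Measure.volume_eq_prod] at hi ⊢
  rw [integral_prod _ hi]
  have h1 : ∀ x, ∫ ξ, windowKernel (windowCoeff ψ g) g ((x, ξ), t) =
      ψ t * ((‖g (t - x)‖ ^ 2 : ℝ) : ℂ) := by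
    intro x
    let K := slice x (SchwartzMap.compCLMOfContinuousLinearEquiv ℂ swapShear (tensor ψ g))
    -- The coefficient is the Fourier transform at `-ξ`, so the substitution `ξ ↦ -ξ` turns the
    -- integral into an inverse Fourier transform.
    have h2 : ∫ ξ, windowKernel (windowCoeff ψ g) g ((x, ξ), t) =
        starRingEnd ℂ (g (t - x)) * 𝓕⁻ (𝓕 K) t := by
      rw [SchwartzMap.fourierInv_coe, Real.fourierInv_eq', ← integral_const_mul,
        ← integral_neg_eq_self]
      congr 1
      ext ξ
      rw [windowKernel_apply, window_apply, windowCoeff_eq_fourier, neg_neg]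
      simp only [smul_eq_mul, inner_neg_right, real_inner_comm, K]
      ring_nf
    rw [h2, FourierTransform.fourierInv_fourier_eq]
    simp only [K, slice_apply, compCLMOfContinuousLinearEquiv_apply, Function.comp_apply,
      tensor_apply]
    change starRingEnd ℂ (g (t - x)) * (ψ t * g (t - x)) = _
    rw [Complex.ofReal_pow, ← Complex.conj_mul']
    ring
  simp only [h1]
  rw [integral_const_mul, integral_complex_ofReal,
    integral_sub_left_eq_self (fun x => ‖g x‖ ^ 2) volume t]
  simp [mul_comm]

theorem integral_normSq_pos {g : 𝓢(Rd d, ℂ)} (hg : g ≠ 0) : 0 < ∫ t, ‖g t‖ ^ 2 := by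
  have hc : Continuous fun t => ‖g t‖ ^ 2 := by
    have := g.continuous
    fun_prop
  have hi : Integrable fun t => ‖g t‖ ^ 2 := (g.memLp 2).integrable_norm_pow (by simp)
  obtain ⟨t, ht⟩ : ∃ t, g t ≠ 0 := by
    by_contra! h
    exact hg (by ext t; simp [h t])
  rw [integral_pos_iff_support_of_nonneg (fun t => by positivity) hi]
  exact (isOpen_ne_fun hc continuous_const).measure_pos volume ⟨t, by simpa using ht⟩

/-- The distribution `f` is applied to the reconstruction formula for the shifted window `window φ
w`. Fubini for distributions brings `f` under the integral, and covariance makes the coefficients a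
function of `z - w` in absolute value. -/
theorem stft_change_window (g : 𝓢(Rd d, ℂ)) (f : 𝓢'(Rd d, ℂ)) (φ : 𝓢(Rd d, ℂ)) (w : Rd d × Rd d) :
    ENNReal.ofReal (∫ t, ‖g t‖ ^ 2) * ‖stft φ f w.1 w.2‖ₑ ≤
      ∫⁻ z, ‖stft g f z.1 z.2‖ₑ * ‖windowCoeff (window φ 0) g (z - w)‖ₑ := by
  have h1 := distribution_integral volume (toCLM f)
    (windowKernel (windowCoeff (window φ w) g) g)
  rw [integral_windowKernel, map_smul] at h1
  simp only [slice_windowKernel, map_smul] at h1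
  have h2 : ‖((∫ t, ‖g t‖ ^ 2 : ℝ) : ℂ) • stft φ f w.1 w.2‖ₑ ≤
      ∫⁻ z, ‖stft g f z.1 z.2‖ₑ * ‖windowCoeff (window φ 0) g (z - w)‖ₑ := by
    refine (congrArg enorm h1).le.trans ((enorm_integral_le_lintegral_enorm _).trans
      (lintegral_mono fun z => ?_))
    rw [smul_eq_mul, enorm_mul, mul_comm]
    refine mul_le_mul' le_rfl ?_
    rw [← ofReal_norm, norm_windowCoeff_window, ofReal_norm]
  rw [smul_eq_mul, enorm_mul] at h2
  refine le_trans (mul_le_mul' (le_of_eq ?_) le_rfl) h2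
  rw [← ofReal_norm, Complex.norm_real, Real.norm_of_nonneg (integral_nonneg fun _ => by positivity)]

end TimeFreq
end

/-! ### Embeddings of modulation spaces and independence of the window. -/

noncomputable section
namespace TimeFreq

variable {d : ℕ}

theorem modulationNorm_eq_mixedNorm (g : 𝓢(Rd d, ℂ)) (p q : ℝ≥0∞) (f : 𝓢'(Rd d, ℂ)) :
    modulationNorm g p q f = mixedNorm volume p q (fun z : Rd d × Rd d => ‖stft g f z.1 z.2‖ₑ) := by
  simp only [modulationNorm, mixedNorm, eLpNorm_enorm]

theorem eLpNorm_const_mul_ennreal {α : Type*} [MeasurableSpace α] {μ : Measure α} (c : ℝ≥0∞)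
    (hc : c ≠ ⊤) (f : α → ℝ≥0∞) (p : ℝ≥0∞) :
    eLpNorm (fun x => c * f x) p μ = c * eLpNorm f p μ := by
  rcases eq_or_ne p 0 with rfl | h0
  · simp
  rcases eq_or_ne p ⊤ with rfl | ht
  · rw [eLpNorm_top_ennreal, eLpNorm_top_ennreal, ENNReal.essSup_const_mul]
  · have hp := ENNReal.toReal_pos h0 ht
    rw [eLpNorm_ennreal h0 ht, eLpNorm_ennreal h0 ht]
    simp only [ENNReal.mul_rpow_of_nonneg _ _ hp.le]
    rw [lintegral_const_mul' _ _ (by simp [hc, hp.le]), ENNReal.mul_rpow_of_nonneg _ _ (by positivity),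
      ← ENNReal.rpow_mul, mul_one_div_cancel hp.ne', ENNReal.rpow_one]

theorem mixedNorm_const_mul {G : Type*} [MeasurableSpace G] {μ : Measure G} (c : ℝ≥0∞) (hc : c ≠ ⊤)
    (F : G × G → ℝ≥0∞) (p q : ℝ≥0∞) :
    mixedNorm μ p q (fun z => c * F z) = c * mixedNorm μ p q F := by
  simp only [mixedNorm, eLpNorm_const_mul_ennreal c hc]

theorem mixedNorm_mono {G : Type*} [MeasurableSpace G] {μ : Measure G} {F H : G × G → ℝ≥0∞}
    (h : ∀ z, F z ≤ H z) (p q : ℝ≥0∞) : mixedNorm μ p q F ≤ mixedNorm μ p q H :=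
  eLpNorm_mono_enorm fun ξ => by
    simp only [enorm_eq_self]
    exact eLpNorm_mono_enorm fun x => by simpa using h (x, ξ)

/-- A Schwartz function is dominated by a product of inverse polynomial weights in the two variables
separately, and the mixed norm of such a product factors. -/
theorem mixedNorm_schwartz_lt_top (H : 𝓢(Rd d × Rd d, ℂ)) (p q : ℝ≥0∞) :
    mixedNorm volume p q (fun z => ‖H z‖ₑ) < ⊤ := by
  obtain ⟨k, hk⟩ := Measure.HasTemperateGrowth.exists_eLpNorm_lt_top (E := Rd d) (μ := volume) p
    inferInstance
  obtain ⟨l, hl⟩ := Measure.HasTemperateGrowth.exists_eLpNorm_lt_top (E := Rd d) (μ := volume) q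
    inferInstance
  obtain ⟨C, hC⟩ : ∃ C, ∀ z, (1 + ‖z‖) ^ (k + l) * ‖H z‖ ≤ C := ⟨_, fun z => by
    have := SchwartzMap.one_add_le_sup_seminorm_apply (𝕜 := ℝ) (m := (k + l, 0)) le_rfl le_rfl H z
    rwa [norm_iteratedFDeriv_zero] at this⟩
  have hC0 : 0 ≤ C := le_trans (by positivity) (hC 0)
  let a : Rd d → ℝ≥0∞ := fun x => ‖(1 + ‖x‖) ^ (-k : ℝ)‖ₑ
  let b : Rd d → ℝ≥0∞ := fun x => ‖(1 + ‖x‖) ^ (-l : ℝ)‖ₑ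
  have hle : ∀ z, ‖H z‖ₑ ≤ ENNReal.ofReal C * (b z.2 * a z.1) := by
    intro z
    have h1 : ‖H z‖ ≤ C * ((1 + ‖z.2‖) ^ (-l : ℝ) * (1 + ‖z.1‖) ^ (-k : ℝ)) := by
      rw [Real.rpow_neg (by positivity), Real.rpow_neg (by positivity), Real.rpow_natCast,
        Real.rpow_natCast, ← mul_inv, ← div_eq_mul_inv, le_div_iff₀' (by positivity)]
      refine le_trans ?_ (hC z)
      gcongr
      rw [pow_add, mul_comm]
      gcongr
      · exact norm_fst_le z
      · exact norm_snd_le z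
    have h2 := ENNReal.ofReal_le_ofReal h1
    rw [ofReal_norm, ENNReal.ofReal_mul hC0, ENNReal.ofReal_mul (by positivity)] at h2
    have e : ∀ (x : Rd d) (n : ℕ), ‖(1 + ‖x‖) ^ (-n : ℝ)‖ₑ = ENNReal.ofReal ((1 + ‖x‖) ^ (-n : ℝ)) :=
      fun x n => Real.enorm_of_nonneg (by positivity)
    simp only [a, b, e]
    exact h2
  refine (mixedNorm_mono hle p q).trans_lt ?_
  rw [mixedNorm_const_mul _ ENNReal.ofReal_ne_top]
  refine ENNReal.mul_lt_top ENNReal.ofReal_lt_top ?_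
  have hb : ∀ x, b x ≠ ⊤ := fun x => enorm_ne_top
  have ha : eLpNorm a p volume < ⊤ := by simpa only [a, eLpNorm_enorm] using hk
  have hb' : eLpNorm b q volume < ⊤ := by simpa only [b, eLpNorm_enorm] using hl
  simp only [mixedNorm, eLpNorm_const_mul_ennreal _ (hb _)]
  simp only [mul_comm (b _)]
  rw [eLpNorm_const_mul_ennreal _ ha.ne]
  exact ENNReal.mul_lt_top ha hb'

theorem exists_young_exponent {p P : ℝ≥0∞} (hp : 1 ≤ p) (hpP : p ≤ P) :
    ∃ ρ : ℝ≥0∞, 1 ≤ ρ ∧ p⁻¹ + ρ⁻¹ = 1 + P⁻¹ := by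
  have h1 : p⁻¹ ≤ 1 := ENNReal.inv_le_one.2 hp
  refine ⟨(1 + P⁻¹ - p⁻¹)⁻¹, ?_, ?_⟩
  · rw [ENNReal.one_le_inv, tsub_le_iff_right]
    gcongr
  · rw [inv_inv, add_tsub_cancel_of_le (h1.trans le_self_add)]

/-- Changing the window dominates the transform by a convolution with a fixed Schwartz function,
which lies in every mixed Lebesgue space. Young's inequality therefore changes the window and raises
the exponents simultaneously. -/
theorem modulationNorm_le_of_le (g φ : 𝓢(Rd d, ℂ)) (hg : g ≠ 0) {p q P Q : ℝ≥0∞} (hp : 1 ≤ p)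
    (hq : 1 ≤ q) (hpP : p ≤ P) (hqQ : q ≤ Q) :
    ∃ C : ℝ≥0∞, C ≠ ⊤ ∧ ∀ f : 𝓢'(Rd d, ℂ), modulationNorm φ P Q f ≤ C * modulationNorm g p q f := by
  obtain ⟨ρ, hρ, hρ'⟩ := exists_young_exponent hp hpP
  obtain ⟨σ, hσ, hσ'⟩ := exists_young_exponent hq hqQ
  -- The reflection turns the kernel in `z - w` into one in `w - z`, as a convolution requires.
  let H : 𝓢(Rd d × Rd d, ℂ) := SchwartzMap.compCLMOfContinuousLinearEquiv ℂ
    (ContinuousLinearEquiv.neg ℝ) (windowCoeff (window φ 0) g)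
  let c := ENNReal.ofReal (∫ t, ‖g t‖ ^ 2)
  have hc0 : c ≠ 0 := by simpa [c] using integral_normSq_pos hg
  have hct : c ≠ ⊤ := ENNReal.ofReal_ne_top
  refine ⟨c⁻¹ * mixedNorm volume ρ σ (fun z => ‖H z‖ₑ), ENNReal.mul_ne_top (by simpa using hc0)
    (mixedNorm_schwartz_lt_top H ρ σ).ne, fun f => ?_⟩
  have h1 : ∀ w : Rd d × Rd d, ‖stft φ f w.1 w.2‖ₑ ≤
      c⁻¹ * ∫⁻ z, ‖stft g f z.1 z.2‖ₑ * ‖H (w - z)‖ₑ := by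
    intro w
    have h2 := stft_change_window g f φ w
    rw [mul_comm, ← ENNReal.le_div_iff_mul_le (Or.inl hc0) (Or.inl hct), div_eq_mul_inv, mul_comm] at h2
    convert! h2 using 6 with z
    change windowCoeff (window φ 0) g (-(w - z)) = _
    rw [neg_sub]
  rw [modulationNorm_eq_mixedNorm, modulationNorm_eq_mixedNorm]
  refine (mixedNorm_mono h1 P Q).trans ?_
  rw [mixedNorm_const_mul _ (by simpa using hc0), mul_assoc]
  gcongr
  rw [mul_comm]
  exact mixedNorm_conv_le (continuous_stft g f).enorm.measurable H.continuous.enorm.measurable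
    hp hρ hρ' hq hσ hσ' (hp.trans hpP)

end TimeFreq
end

/-! ### The Gaussian-windowed transform of the ambiguity function. -/

noncomputable section
namespace TimeFreq

variable {d : ℕ}

/-- The character `exp (-2 π i (x · α + ξ · τ))` of `ℝ²ᵈ`. -/
def character (ζ w : Rd d × Rd d) : ℂ :=
  Complex.exp (↑(-2 * Real.pi * inner ℝ w.1 ζ.1) * Complex.I) *
    Complex.exp (↑(-2 * Real.pi * inner ℝ w.2 ζ.2) * Complex.I)

theorem hasTemperateGrowth_character_uncurry :
    Function.HasTemperateGrowth (fun u : (Rd d × Rd d) × (Rd d × Rd d) => character u.1 u.2) :=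
  (hasTemperateGrowth_cexp_bilin
    ((ContinuousLinearMap.fst ℝ (Rd d) (Rd d)).comp (ContinuousLinearMap.snd ℝ (Rd d × Rd d) (Rd d × Rd d)))
    ((ContinuousLinearMap.fst ℝ (Rd d) (Rd d)).comp (ContinuousLinearMap.fst ℝ (Rd d × Rd d) (Rd d × Rd d)))
    (-2 * Real.pi)).mul (hasTemperateGrowth_cexp_bilin
    ((ContinuousLinearMap.snd ℝ (Rd d) (Rd d)).comp (ContinuousLinearMap.snd ℝ (Rd d × Rd d) (Rd d × Rd d)))
    ((ContinuousLinearMap.snd ℝ (Rd d) (Rd d)).comp (ContinuousLinearMap.fst ℝ (Rd d × Rd d) (Rd d × Rd d)))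
    (-2 * Real.pi))

theorem hasTemperateGrowth_character (ζ : Rd d × Rd d) :
    Function.HasTemperateGrowth (character ζ) := by
  have h : ∀ L : (Rd d × Rd d) →L[ℝ] ℝ, Function.HasTemperateGrowth
      (fun w => Complex.exp (↑(L w) * Complex.I)) := fun L =>
    hasTemperateGrowth_cexp.comp L.hasTemperateGrowth
  exact (h ((-2 * Real.pi) • ((innerSL ℝ).flip ζ.1).comp (ContinuousLinearMap.fst ℝ (Rd d) (Rd d)))).mul
    (h ((-2 * Real.pi) • ((innerSL ℝ).flip ζ.2).comp (ContinuousLinearMap.snd ℝ (Rd d) (Rd d))))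

/-- The Gaussian `exp (-π (|x|² + |ξ|²) / 2)` on `ℝ²ᵈ`. -/
def gauss2 : 𝓢(Rd d × Rd d, ℂ) :=
  tensor (gaussian (Real.pi / 2) (by positivity)) (gaussian (Real.pi / 2) (by positivity))

/-- The Gaussian `exp (-π |t|²)` on `ℝᵈ`. -/
def gauss1 : 𝓢(Rd d, ℂ) := gaussian Real.pi Real.pi_pos

/-- The conjugated time-frequency shifts of the Gaussian on `ℝ²ᵈ`. -/
def gaussAtom (z ζ : Rd d × Rd d) : 𝓢(Rd d × Rd d, ℂ) :=
  SchwartzMap.smulLeftCLM ℂ (character ζ) (SchwartzMap.compSubConstCLM ℂ z gauss2)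

theorem gaussAtom_apply (z ζ w : Rd d × Rd d) :
    gaussAtom z ζ w = character ζ w * gauss2 (w - z) := by
  rw [gaussAtom, SchwartzMap.smulLeftCLM_apply_apply (hasTemperateGrowth_character ζ),
    compSubConstCLM_apply, smul_eq_mul]

theorem integral_gaussian_phase (y : Rd d) :
    ∫ η : Rd d, Complex.exp ((-(Real.pi / 2) * ‖η‖ ^ 2 : ℝ) : ℂ) *
      Complex.exp (↑(-2 * Real.pi * inner ℝ η y) * Complex.I) =
      (2 : ℂ) ^ ((d : ℂ) / 2) * Complex.exp ((-2 * Real.pi * ‖y‖ ^ 2 : ℝ) : ℂ) := by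
  have h := GaussianFourier.integral_cexp_neg_mul_sq_norm_add (V := Rd d) (b := (Real.pi / 2 : ℝ))
    (by simpa using Real.pi_pos) (-2 * Real.pi * Complex.I) y
  have e1 : (Real.pi / ((Real.pi / 2 : ℝ) : ℂ) : ℂ) = 2 := by
    have : (Real.pi : ℂ) ≠ 0 := by exact_mod_cast Real.pi_ne_zero
    push_cast
    field_simp
  have e2 : ((-2 * Real.pi * Complex.I) ^ 2 * (‖y‖ : ℂ) ^ 2 / (4 * ((Real.pi / 2 : ℝ) : ℂ)) : ℂ) =
      ((-2 * Real.pi * ‖y‖ ^ 2 : ℝ) : ℂ) := by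
    have : (Real.pi : ℂ) ≠ 0 := by exact_mod_cast Real.pi_ne_zero
    push_cast
    rw [mul_pow, Complex.I_sq]
    field_simp
    ring
  rw [e1, e2, finrank_euclideanSpace_fin] at h
  rw [← h]
  congr 1
  ext η
  rw [← Complex.exp_add]
  congr 1
  rw [real_inner_comm]
  push_cast
  ring

/-- The partial Fourier transform of the Gaussian in the frequency variable is again a Gaussian,
with quadratic form proportional to `‖a - b‖² + ‖a + b‖²`, where `a` and `b` are recentred versions
of `u` and `v`. The parallelogram law separates the variables. The phase is bilinear, so it splits
as well. -/
theorem ambiguityKernel_gaussAtom (x ξ α τ u v : Rd d) :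
    partialFourier (gaussAtom (x, ξ) (α, τ)) (changeVar (u, v)) =
      (2 : ℂ) ^ ((d : ℂ) / 2) * Complex.exp (↑(-2 * Real.pi * inner ℝ ξ τ) * Complex.I) *
        (window gauss1 ((1 / 2 : ℝ) • x - τ, α + (1 / 2 : ℝ) • ξ) u *
        starRingEnd ℂ (window gauss1 (-((1 / 2 : ℝ) • x) - τ, α - (1 / 2 : ℝ) • ξ) v)) := by
  let t : Rd d := (1 / 2 : ℝ) • (u + v)
  have h1 : partialFourier (gaussAtom (x, ξ) (α, τ)) (changeVar (u, v)) =
      𝓕 (slice (u - v) (gaussAtom (x, ξ) (α, τ))) t := rfl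
  rw [h1, SchwartzMap.fourier_coe, Real.fourier_eq',
    -- Translation by `ξ` centres the Gaussian in the frequency variable.
    ← integral_add_right_eq_self (μ := (volume : Measure (Rd d))) _ ξ]
  have h2 : ∀ η : Rd d, Complex.exp (↑(-2 * Real.pi * inner ℝ (η + ξ) t) * Complex.I) •
      slice (u - v) (gaussAtom (x, ξ) (α, τ)) (η + ξ) =
      (Complex.exp (↑(-2 * Real.pi * (inner ℝ (u - v) α + inner ℝ ξ (t + τ))) * Complex.I) *
        Complex.exp ((-(Real.pi / 2) * ‖u - v - x‖ ^ 2 : ℝ) : ℂ)) *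
      (Complex.exp ((-(Real.pi / 2) * ‖η‖ ^ 2 : ℝ) : ℂ) *
      Complex.exp (↑(-2 * Real.pi * inner ℝ η (t + τ)) * Complex.I)) := by
    intro η
    rw [slice_apply, gaussAtom_apply]
    simp only [character, gauss2, tensor_apply, gaussian_apply, Prod.fst_sub, Prod.snd_sub,
      add_sub_cancel_right, smul_eq_mul]
    simp only [← Complex.exp_add]
    congr 1
    simp only [inner_add_left, inner_add_right]
    push_cast
    ring
  simp only [h2]
  rw [integral_const_mul, integral_gaussian_phase]
  simp only [window_apply, gauss1, gaussian_apply, map_mul, ← Complex.exp_conj, Complex.conj_ofReal,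
    Complex.conj_I]
  set a := u - ((1 / 2 : ℝ) • x - τ) with ha
  set b := v - (-((1 / 2 : ℝ) • x) - τ) with hb
  have e1 : u - v - x = a - b := by
    rw [ha, hb]
    module
  have e2 : t + τ = (1 / 2 : ℝ) • (a + b) := by
    simp only [ha, hb, t]
    module
  have e3 : -(Real.pi / 2) * ‖u - v - x‖ ^ 2 + -2 * Real.pi * ‖t + τ‖ ^ 2 =
      -Real.pi * ‖a‖ ^ 2 + -Real.pi * ‖b‖ ^ 2 := by
    have := parallelogram_law_with_norm ℝ a b
    rw [e1, e2, norm_smul, mul_pow]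
    norm_num
    linear_combination -(Real.pi / 2) * this
  have e4 : inner ℝ (u - v) α + inner ℝ ξ (t + τ) =
      inner ℝ ξ τ + inner ℝ u (α + (1 / 2 : ℝ) • ξ) - inner ℝ v (α - (1 / 2 : ℝ) • ξ) := by
    simp only [t, inner_add_right, inner_sub_left, inner_sub_right, inner_smul_right]
    rw [real_inner_comm u ξ, real_inner_comm v ξ]
    ring
  have e3' := congrArg (fun r : ℝ => (r : ℂ)) e3
  have e4' := congrArg (fun r : ℝ => (r : ℂ)) e4
  beta_reduce at e3' e4'
  have key : Complex.exp (↑(-2 * Real.pi * (inner ℝ (u - v) α + inner ℝ ξ (t + τ))) * Complex.I) *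
      Complex.exp ((-(Real.pi / 2) * ‖u - v - x‖ ^ 2 : ℝ) : ℂ) * Complex.exp ((-2 * Real.pi * ‖t + τ‖ ^ 2 : ℝ) : ℂ) =
      Complex.exp (↑(-2 * Real.pi * inner ℝ ξ τ) * Complex.I) *
      (Complex.exp ((-Real.pi * ‖a‖ ^ 2 : ℝ) : ℂ) *
        Complex.exp (↑(-2 * Real.pi * inner ℝ u (α + (1 / 2 : ℝ) • ξ)) * Complex.I) *
        (Complex.exp ((-Real.pi * ‖b‖ ^ 2 : ℝ) : ℂ) *
        Complex.exp (↑(-2 * Real.pi * inner ℝ v (α - (1 / 2 : ℝ) • ξ)) * -Complex.I))) := by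
    simp only [← Complex.exp_add]
    congr 1
    rw [e4]
    push_cast at e3' ⊢
    linear_combination e3'
  linear_combination (2 : ℂ) ^ ((d : ℂ) / 2) * key

/-- After the partial Fourier transform and the change of variables, the test function is an
elementary tensor. Hence the tensor product of `f₁` and the conjugate of `f₂` evaluates to a product
of two short-time Fourier transforms. -/
theorem ambiguity_gaussAtom (f₁ f₂ : 𝓢'(Rd d, ℂ)) (x ξ α τ : Rd d) :
    ambiguity f₁ f₂ (gaussAtom (x, ξ) (α, τ)) =
      (2 : ℂ) ^ ((d : ℂ) / 2) * Complex.exp (↑(-2 * Real.pi * inner ℝ ξ τ) * Complex.I) *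
        (stft gauss1 f₁ ((1 / 2 : ℝ) • x - τ) (α + (1 / 2 : ℝ) • ξ) *
        starRingEnd ℂ (stft gauss1 f₂ (-((1 / 2 : ℝ) • x) - τ) (α - (1 / 2 : ℝ) • ξ))) := by
  set c := (2 : ℂ) ^ ((d : ℂ) / 2) * Complex.exp (↑(-2 * Real.pi * inner ℝ ξ τ) * Complex.I) with hc
  set a : Rd d × Rd d := ((1 / 2 : ℝ) • x - τ, α + (1 / 2 : ℝ) • ξ) with ha
  set b : Rd d × Rd d := (-((1 / 2 : ℝ) • x) - τ, α - (1 / 2 : ℝ) • ξ) with hb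
  rw [ambiguity_apply]
  have h : partialPairing (conjDist f₂) (SchwartzMap.compCLMOfContinuousLinearEquiv ℂ changeVar
      (partialFourier (gaussAtom (x, ξ) (α, τ)))) =
      (c * starRingEnd ℂ (f₂ (window gauss1 b))) • window gauss1 a := by
    ext u
    rw [partialPairing_apply]
    have h1 : slice u (SchwartzMap.compCLMOfContinuousLinearEquiv ℂ changeVar
        (partialFourier (gaussAtom (x, ξ) (α, τ)))) =
        (c * window gauss1 a u) • conjS (window gauss1 b) := by
      ext v
      rw [slice_apply, compCLMOfContinuousLinearEquiv_apply, Function.comp_apply,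
        ambiguityKernel_gaussAtom]
      change _ = c * window gauss1 a u * starRingEnd ℂ (window gauss1 b v)
      ring
    have h2 : conjS (conjS (window gauss1 b)) = window gauss1 b := by
      ext t
      simp
    rw [h1, map_smul]
    change (c * window gauss1 a u) * starRingEnd ℂ (f₂ (conjS (conjS (window gauss1 b)))) =
      c * starRingEnd ℂ (f₂ (window gauss1 b)) * window gauss1 a u
    rw [h2]
    ring
  rw [h, map_smul, smul_eq_mul]
  change _ = c * (f₁ (window gauss1 a) * starRingEnd ℂ (f₂ (window gauss1 b)))
  ring

end TimeFreq
end

/-! ### Distributional inverse Fourier transforms, and their distribution functions. -/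

noncomputable section
namespace TimeFreq

section Uniqueness
variable {E : Type} [NormedAddCommGroup E] [NormedSpace ℝ E] [FiniteDimensional ℝ E]
  [MeasurableSpace E] [BorelSpace E] {μ : Measure E}

/-- A locally integrable function is determined by its pairings with Schwartz functions. -/
theorem ae_eq_of_integral_schwartz_mul_eq {u v : E → ℂ} (hu : LocallyIntegrable u μ)
    (hv : LocallyIntegrable v μ) (h : ∀ χ : 𝓢(E, ℂ), ∫ x, χ x * u x ∂μ = ∫ x, χ x * v x ∂μ) :
    u =ᵐ[μ] v := by
  refine ae_eq_of_integral_contDiff_smul_eq hu hv fun g hg hc => ?_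
  have hg' : ContDiff ℝ ∞ (fun x => (g x : ℂ)) := Complex.ofRealCLM.contDiff.comp hg
  have hc' : HasCompactSupport (fun x => (g x : ℂ)) := hc.comp_left (g := fun r : ℝ => (r : ℂ)) rfl
  simpa using h (hc'.toSchwartzMap hg')

omit [FiniteDimensional ℝ E] in
theorem integrable_schwartz_mul [μ.HasTemperateGrowth] {p : ℝ≥0∞} (hp : 1 ≤ p) {u : E → ℂ}
    (hu : MemLp u p μ) (χ : 𝓢(E, ℂ)) : Integrable (fun x => χ x * u x) μ := by
  have : ENNReal.HolderConjugate (ENNReal.conjExponent p) p :=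
    (ENNReal.HolderConjugate.conjExponent hp).symm
  exact MemLp.integrable_mul (χ.memLp (ENNReal.conjExponent p) μ) hu

end Uniqueness

section HausdorffYoung
variable {V : Type} [NormedAddCommGroup V] [InnerProductSpace ℝ V] [FiniteDimensional ℝ V]
  [MeasurableSpace V] [BorelSpace V]

/-- The function `u` is the distributional inverse Fourier transform of the function `h`. -/
def IsFourierInv (h u : V → ℂ) : Prop :=
  ∀ χ : 𝓢(V, ℂ), ∫ x, χ x * u x = ∫ x, (𝓕⁻ χ) x * h x

theorem exists_isFourierInv_one {h : V → ℂ} (hh : MemLp h 1) :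
    ∃ u : V → ℂ, AEStronglyMeasurable u ∧ (∀ x, ‖u x‖ₑ ≤ eLpNorm h 1) ∧ IsFourierInv h u := by
  have hi : Integrable h := memLp_one_iff_integrable.1 hh
  refine ⟨𝓕⁻ h, ?_, fun x => ?_, fun χ => ?_⟩
  · refine Continuous.aestronglyMeasurable ?_
    exact VectorFourier.fourierIntegral_continuous (L := -innerₗ V) Real.continuous_fourierChar
      (continuous_inner (𝕜 := ℝ) (E := V)).neg hi
  · rw [Real.fourierInv_eq, eLpNorm_one_eq_lintegral_enorm]
    refine (enorm_integral_le_lintegral_enorm _).trans (le_of_eq ?_)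
    congr 1
    ext v
    rw [Circle.smul_def, enorm_smul, ← ofReal_norm, Circle.norm_coe]
    simp
  · have key := VectorFourier.integral_fourierIntegral_smul_eq_flip (L := -innerₗ V)
      (μ := volume) (ν := volume) Real.continuous_fourierChar
      (continuous_inner (𝕜 := ℝ) (E := V)).neg (χ.integrable (μ := volume)) hi
    have hf : (-innerₗ V).flip = -innerₗ V := by
      ext x y
      simp [real_inner_comm]
    rw [hf] at key
    rw [SchwartzMap.fourierInv_coe]
    exact key.symm

theorem exists_isFourierInv_two {h : V → ℂ} (hh : MemLp h 2) :
    ∃ u : V → ℂ, MemLp u 2 ∧ eLpNorm u 2 = eLpNorm h 2 ∧ IsFourierInv h u := by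
  let H := hh.toLp h
  let U : Lp ℂ 2 (volume : Measure V) := 𝓕⁻ H
  refine ⟨U, Lp.memLp U, ?_, fun χ => ?_⟩
  · have h1 : ‖U‖ = ‖H‖ := (Lp.fourierTransformₗᵢ V ℂ).symm.norm_map H
    have h2 : ‖U‖ₑ = ‖H‖ₑ := by rw [← ofReal_norm, h1, ofReal_norm]
    rw [Lp.enorm_def, Lp.enorm_def] at h2
    rw [h2]
    exact eLpNorm_congr_ae hh.coeFn_toLp
  · have h1 := congrArg (fun T : 𝓢'(V, ℂ) => T χ) (Lp.fourierInv_toTemperedDistribution_eq H)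
    simp only [TemperedDistribution.fourierInv_apply, Lp.toTemperedDistribution_apply,
      smul_eq_mul] at h1
    rw [← h1]
    refine integral_congr_ae ?_
    filter_upwards [hh.coeFn_toLp] with x hx
    rw [hx]

/-- This uniqueness ensures that splitting `h` at different heights always produces the same
function. -/
theorem IsFourierInv.ae_eq {h u v : V → ℂ} (hu : IsFourierInv h u) (hv : IsFourierInv h v)
    (hu' : LocallyIntegrable u) (hv' : LocallyIntegrable v) : u =ᵐ[volume] v :=
  ae_eq_of_integral_schwartz_mul_eq hu' hv' fun χ => (hu χ).trans (hv χ).symm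

theorem IsFourierInv.add {h₁ h₂ u₁ u₂ : V → ℂ} (H₁ : IsFourierInv h₁ u₁) (H₂ : IsFourierInv h₂ u₂)
    {a₁ a₂ b₁ b₂ : ℝ≥0∞} (ha₁ : 1 ≤ a₁) (ha₂ : 1 ≤ a₂) (hb₁ : 1 ≤ b₁) (hb₂ : 1 ≤ b₂)
    (hh₁ : MemLp h₁ a₁) (hh₂ : MemLp h₂ a₂) (hu₁ : MemLp u₁ b₁) (hu₂ : MemLp u₂ b₂) :
    IsFourierInv (h₁ + h₂) (u₁ + u₂) := fun χ => by
  simp only [Pi.add_apply, mul_add]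
  rw [integral_add (integrable_schwartz_mul hb₁ hu₁ χ) (integrable_schwartz_mul hb₂ hu₂ χ),
    integral_add (integrable_schwartz_mul ha₁ hh₁ _) (integrable_schwartz_mul ha₂ hh₂ _), H₁, H₂]

theorem IsFourierInv.const_mul {h u : V → ℂ} (H : IsFourierInv h u) (c : ℂ) :
    IsFourierInv (fun x => c * h x) (fun x => c * u x) := fun χ => by
  simp only [mul_left_comm _ c, integral_const_mul, H χ]

theorem IsFourierInv.congr {h h' u : V → ℂ} (H : IsFourierInv h u) (hh : h =ᵐ[volume] h') :
    IsFourierInv h' u := fun χ => by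
  rw [H χ]
  refine integral_congr_ae ?_
  filter_upwards [hh] with x hx
  rw [hx]

/-- Above the height `κ`, an `L^s` bound controls the `L¹` norm. The next lemma is the counterpart
below `κ`, for the square of the `L²` norm. -/
theorem le_rpow_mul_rpow {κ r s : ℝ} (hκ : 0 < κ) (hr : κ < r) (hs : 1 < s) :
    r ≤ κ ^ (1 - s) * r ^ s := by
  have h0 : 0 < r := hκ.trans hr
  calc r = r ^ (1 - s) * r ^ s := by rw [← Real.rpow_add h0]; simp
    _ ≤ _ := by
      gcongr ?_ * _
      exact Real.rpow_le_rpow_of_nonpos hκ hr.le (by linarith)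

theorem sq_le_rpow_mul_rpow {κ r s : ℝ} (hr0 : 0 ≤ r) (hr : r ≤ κ) (hs : s < 2) :
    r ^ 2 ≤ κ ^ (2 - s) * r ^ s := by
  rcases hr0.eq_or_lt with rfl | h0
  · have : 0 ≤ κ := hr
    rw [zero_pow two_ne_zero]
    positivity
  calc r ^ 2 = r ^ (2 - s) * r ^ s := by rw [← Real.rpow_add h0]; simp
    _ ≤ _ := by
      gcongr

theorem eLpNorm_two_pow {f : V → ℂ} : eLpNorm f 2 ^ 2 = ∫⁻ x, ENNReal.ofReal (‖f x‖ ^ 2) := by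
  have := eLpNorm_nnreal_pow_eq_lintegral (f := f) (μ := (volume : Measure V)) (p := 2) two_ne_zero
  simp only [NNReal.coe_ofNat, ENNReal.rpow_ofNat] at this
  simp only [ENNReal.coe_ofNat] at this
  rw [this]
  congr 1
  ext x
  rw [ENNReal.ofReal_pow (norm_nonneg _), ofReal_norm]

/-- The decomposition of `h` at height `κ`: the part above `κ` is integrable, and the part below
`κ` is square integrable. -/
theorem truncation {h : V → ℂ} (hm : StronglyMeasurable h) {s : ℝ} (hs1 : 1 < s) (hs2 : s < 2)
    (hN : ∫⁻ x, ENNReal.ofReal (‖h x‖ ^ s) ≤ 1) {κ : ℝ} (hκ : 0 < κ) :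
    MemLp ({x | ‖h x‖ ≤ κ}ᶜ.indicator h) 1 ∧
    eLpNorm ({x | ‖h x‖ ≤ κ}ᶜ.indicator h) 1 ≤ ENNReal.ofReal (κ ^ (1 - s)) ∧
    MemLp ({x | ‖h x‖ ≤ κ}.indicator h) 2 := by
  have hS : MeasurableSet {x | ‖h x‖ ≤ κ} := measurableSet_le hm.norm.measurable measurable_const
  have h1 : eLpNorm ({x | ‖h x‖ ≤ κ}ᶜ.indicator h) 1 ≤ ENNReal.ofReal (κ ^ (1 - s)) := by
    rw [eLpNorm_one_eq_lintegral_enorm]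
    calc _ ≤ ∫⁻ x, ENNReal.ofReal (κ ^ (1 - s)) * ENNReal.ofReal (‖h x‖ ^ s) := by
          refine lintegral_mono fun x => ?_
          by_cases hx : ‖h x‖ ≤ κ
          · simp [hx]
          · rw [Set.indicator_of_mem (by simpa using hx), ← ofReal_norm,
              ← ENNReal.ofReal_mul (by positivity)]
            exact ENNReal.ofReal_le_ofReal (le_rpow_mul_rpow hκ (not_le.1 hx) hs1)
      _ ≤ _ := by
          rw [lintegral_const_mul' _ _ ENNReal.ofReal_ne_top]
          exact mul_le_of_le_one_right (by positivity) hN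
  refine ⟨⟨(hm.indicator hS.compl).aestronglyMeasurable, h1.trans_lt ENNReal.ofReal_lt_top⟩, h1,
    (hm.indicator hS).aestronglyMeasurable, ?_⟩
  refine (ENNReal.pow_lt_top_iff.1 ?_).resolve_right two_ne_zero
  rw [eLpNorm_two_pow]
  calc _ ≤ ∫⁻ x, ENNReal.ofReal (κ ^ (2 - s)) * ENNReal.ofReal (‖h x‖ ^ s) := by
        refine lintegral_mono fun x => ?_
        by_cases hx : ‖h x‖ ≤ κ
        · rw [Set.indicator_of_mem (by simpa using hx), ← ENNReal.ofReal_mul (by positivity)]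
          exact ENNReal.ofReal_le_ofReal (sq_le_rpow_mul_rpow (norm_nonneg _) hx hs2)
        · simp [hx]
    _ < ⊤ := by
        rw [lintegral_const_mul' _ _ ENNReal.ofReal_ne_top]
        exact ENNReal.mul_lt_top ENNReal.ofReal_lt_top (hN.trans_lt ENNReal.one_lt_top)

/-- An inverse Fourier transform of a function in `L^s`, with its distribution function
controlled by the truncations. -/
theorem exists_isFourierInv_weak {h : V → ℂ} (hm : StronglyMeasurable h) {s : ℝ} (hs1 : 1 < s)
    (hs2 : s < 2) (hN : ∫⁻ x, ENNReal.ofReal (‖h x‖ ^ s) ≤ 1) :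
    ∃ u : V → ℂ, AEStronglyMeasurable u ∧ IsFourierInv h u ∧ ∀ κ a : ℝ, 0 < κ → 0 < a →
      κ ^ (1 - s) ≤ a → ENNReal.ofReal a ^ 2 * volume {x | 2 * a < ‖u x‖} ≤
        ∫⁻ x, ENNReal.ofReal (‖{x | ‖h x‖ ≤ κ}.indicator h x‖ ^ 2) := by
  have key : ∀ κ : ℝ, 0 < κ → ∃ v w : V → ℂ, AEStronglyMeasurable v ∧ MemLp w 2 ∧
      (∀ x, ‖v x‖ₑ ≤ ENNReal.ofReal (κ ^ (1 - s))) ∧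
      eLpNorm w 2 = eLpNorm ({x | ‖h x‖ ≤ κ}.indicator h) 2 ∧ IsFourierInv h (v + w) ∧
      LocallyIntegrable (v + w) := by
    -- The high part of `h` is integrable and its transform `v` is bounded. The low part is square
    -- integrable and its transform `w` obeys Plancherel.
    intro κ hκ
    obtain ⟨h1, h2, h3⟩ := truncation hm hs1 hs2 hN hκ
    obtain ⟨v, hv, hv', hvF⟩ := exists_isFourierInv_one h1
    obtain ⟨w, hw, hw', hwF⟩ := exists_isFourierInv_two h3
    have hvL : MemLp v ⊤ := ⟨hv, by
      rw [eLpNorm_exponent_top]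
      refine (eLpNormEssSup_le_of_ae_enorm_bound (Filter.Eventually.of_forall hv')).trans_lt h1.2⟩
    refine ⟨v, w, hv, hw, fun x => (hv' x).trans h2, hw', ?_, ?_⟩
    · have := hvF.add hwF le_rfl one_le_two le_top one_le_two h1 h3 hvL hw
      rwa [Set.indicator_compl_add_self] at this
    · exact (hvL.locallyIntegrable le_top).add (hw.locallyIntegrable one_le_two)
  -- Height 1 is an arbitrary choice that fixes `u`. At any other height the decomposition agrees
  -- with it almost everywhere.
  obtain ⟨v₁, w₁, hv₁, hw₁, -, -, hF₁, hl₁⟩ := key 1 one_pos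
  refine ⟨v₁ + w₁, hv₁.add hw₁.1, hF₁, fun κ a hκ ha hκa => ?_⟩
  obtain ⟨v, w, hv, hw, hvb, hwn, hF, hl⟩ := key κ hκ
  have hae := hF₁.ae_eq hF hl₁ hl
  -- Since `v` is bounded by `a`, a value of `v + w` above `2a` forces `w` above `a`. Chebyshev in
  -- `L²` concludes.
  calc _ ≤ ENNReal.ofReal a ^ 2 * volume {x | ENNReal.ofReal a ≤ ‖w x‖ₑ} := by
        refine mul_le_mul_right (measure_mono_ae (μ := volume) ?_) _
        filter_upwards [hae] with x hx h1
        have h1 : 2 * a < ‖(v₁ + w₁) x‖ := h1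
        change ENNReal.ofReal a ≤ ‖w x‖ₑ
        rw [hx, Pi.add_apply] at h1
        have h2 : ‖v x‖ ≤ a := by
          have := (hvb x).trans (ENNReal.ofReal_le_ofReal hκa)
          rwa [← ofReal_norm, ENNReal.ofReal_le_ofReal_iff ha.le] at this
        rw [← ofReal_norm]
        refine ENNReal.ofReal_le_ofReal ?_
        linarith [norm_add_le (v x) (w x)]
    _ ≤ eLpNorm w 2 ^ 2 := by
        have := mul_meas_ge_le_pow_eLpNorm' volume two_ne_zero ENNReal.ofNat_ne_top hw.1
          (ENNReal.ofReal a)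
        simpa using this
    _ = _ := by rw [hwn, eLpNorm_two_pow]

end HausdorffYoung

end TimeFreq
end

/-! ### The Hausdorff–Young inequality by real interpolation. -/

noncomputable section
namespace TimeFreq

/-- For a fixed value `r` of `‖h‖`, this is the integral over the levels `l`. As `(t - 1)(s - 1) =
1`, which is conjugacy of `s` and `t`, the condition on `r` forces `l ≤ 2 r^(1 - s)`. Since `t > 2`,
the power `l^(t - 3)` is integrable at 0, and the resulting power of `r` is exactly `s`. -/
theorem lintegral_truncated_rpow_le {s t r : ℝ} (hs1 : 1 < s) (hs2 : s < 2)
    (hst : (t - 1) * (s - 1) = 1) (hr : 0 ≤ r) :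
    ∫⁻ l in Set.Ioi (0 : ℝ), {l : ℝ | r ≤ (2 / l) ^ (t - 1)}.indicator
      (fun l => ENNReal.ofReal (4 * l ^ (t - 3)) * ENNReal.ofReal (r ^ 2)) l ≤
    ENNReal.ofReal (4 * 2 ^ (t - 2) / (t - 2)) * ENNReal.ofReal (r ^ s) := by
  have ht : 2 < t := by nlinarith
  rcases hr.eq_or_lt with rfl | hr
  · simp
  set B : ℝ := 2 * r ^ (1 - s) with hB
  have hB0 : 0 < B := by positivity
  have hi : IntervalIntegrable (fun l : ℝ => l ^ (t - 3)) volume 0 B :=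
    intervalIntegral.intervalIntegrable_rpow' (by linarith)
  calc _ ≤ ∫⁻ l in Set.Ioi (0 : ℝ), (Set.Ioc 0 B).indicator
        (fun l => ENNReal.ofReal (4 * r ^ 2 * l ^ (t - 3))) l := by
        refine setLIntegral_mono_ae' measurableSet_Ioi (Filter.Eventually.of_forall fun l hl => ?_)
        have hl : 0 < l := hl
        by_cases h : r ≤ (2 / l) ^ (t - 1)
        · have hlB : l ≤ B := by
            have h1 : r ^ (s - 1) ≤ 2 / l := by
              calc r ^ (s - 1) ≤ ((2 / l) ^ (t - 1)) ^ (s - 1) := by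
                    gcongr
                _ = 2 / l := by rw [← Real.rpow_mul (by positivity), hst, Real.rpow_one]
            rw [le_div_iff₀ hl] at h1
            rw [hB, show 1 - s = -(s - 1) by ring, Real.rpow_neg hr.le, ← div_eq_mul_inv,
              le_div_iff₀ (by positivity)]
            linarith
          rw [Set.indicator_of_mem (by exact h), Set.indicator_of_mem (show l ∈ Set.Ioc 0 B from ⟨hl, hlB⟩),
            ← ENNReal.ofReal_mul (by positivity)]
          exact ENNReal.ofReal_le_ofReal (by linarith)
        · rw [Set.indicator_of_notMem (by exact h)]
          positivity
    _ = ∫⁻ l in Set.Ioc 0 B, ENNReal.ofReal (4 * r ^ 2 * l ^ (t - 3)) := by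
        rw [lintegral_indicator measurableSet_Ioc, Measure.restrict_restrict measurableSet_Ioc,
          Set.inter_eq_left.2 (fun l hl => hl.1)]
    _ = ENNReal.ofReal (4 * r ^ 2 * (B ^ (t - 2) / (t - 2))) := by
        rw [← ofReal_integral_eq_lintegral_ofReal]
        · rw [integral_const_mul, ← intervalIntegral.integral_of_le hB0.le,
            integral_rpow (Or.inl (by linarith)), show t - 3 + 1 = t - 2 by ring,
            Real.zero_rpow (by linarith), sub_zero]
        · exact ((intervalIntegrable_iff_integrableOn_Ioc_of_le hB0.le).1 hi).const_mul _
        · refine (ae_restrict_iff' measurableSet_Ioc).2 (Filter.Eventually.of_forall fun l hl => ?_)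
          have := hl.1
          change (0 : ℝ) ≤ _
          positivity
    _ = _ := by
        rw [← ENNReal.ofReal_mul (div_nonneg (by positivity) (by linarith))]
        congr 1
        rw [hB, Real.mul_rpow (by norm_num) (by positivity), ← Real.rpow_mul hr.le,
          show (1 - s) * (t - 2) = s - 2 by linarith, Real.rpow_sub hr, Real.rpow_two]
        field_simp

section HausdorffYoung
variable {V : Type} [NormedAddCommGroup V] [InnerProductSpace ℝ V] [FiniteDimensional ℝ V]
  [MeasurableSpace V] [BorelSpace V]

/-- The Marcinkiewicz argument: in the layer-cake formula for the `t`-th power of `u`, the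
truncation height varies with the level, and exchanging the integrals reduces to the one-variable
estimate. -/
theorem exists_isFourierInv_normalized {h : V → ℂ} (hm : StronglyMeasurable h) {s t : ℝ}
    (hs1 : 1 < s) (hs2 : s < 2) (hst : (t - 1) * (s - 1) = 1)
    (hN : ∫⁻ x, ENNReal.ofReal (‖h x‖ ^ s) ≤ 1) :
    ∃ u : V → ℂ, AEStronglyMeasurable u ∧ IsFourierInv h u ∧
      ∫⁻ x, ENNReal.ofReal (‖u x‖ ^ t) ≤ ENNReal.ofReal (t * (4 * 2 ^ (t - 2) / (t - 2))) := by
  have ht : 2 < t := by nlinarith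
  obtain ⟨u, hu, hF, hw⟩ := exists_isFourierInv_weak hm hs1 hs2 hN
  refine ⟨u, hu, hF, ?_⟩
  let G : ℝ → V → ℝ≥0∞ := fun l x => {l : ℝ | ‖h x‖ ≤ (2 / l) ^ (t - 1)}.indicator
      (fun l => ENNReal.ofReal (4 * l ^ (t - 3)) * ENNReal.ofReal (‖h x‖ ^ 2)) l
  have hG : Measurable (Function.uncurry G) := by
    have hh := hm.norm.measurable
    have : Function.uncurry G = {p : ℝ × V | ‖h p.2‖ ≤ (2 / p.1) ^ (t - 1)}.indicator
        (fun p => ENNReal.ofReal (4 * p.1 ^ (t - 3)) * ENNReal.ofReal (‖h p.2‖ ^ 2)) := rfl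
    rw [this]
    refine Measurable.indicator (by fun_prop) (measurableSet_le (by fun_prop) (by fun_prop))
  rw [lintegral_rpow_eq_lintegral_meas_lt_mul volume (Filter.Eventually.of_forall fun x => norm_nonneg _)
    hu.norm.aemeasurable (by linarith), ENNReal.ofReal_mul (by linarith)]
  gcongr
  calc _ ≤ ∫⁻ l in Set.Ioi (0 : ℝ), ∫⁻ x, G l x := by
        refine setLIntegral_mono_ae' measurableSet_Ioi (Filter.Eventually.of_forall fun l hl => ?_)
        have hl : 0 < l := hl
        -- The height is tuned so that the bound `κ^(1 - s)` for the bounded part equals exactly `l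
        -- / 2`, half the level.
        have h1 := hw ((2 / l) ^ (t - 1)) (l / 2) (by positivity) (by positivity) (le_of_eq (by
          rw [← Real.rpow_mul (by positivity), show (t - 1) * (1 - s) = -1 by linarith,
            Real.rpow_neg_one, inv_div]))
        rw [show 2 * (l / 2) = l by ring] at h1
        -- The weak estimate comes with a factor `(l/2)²`. Extracting it from `l^(t - 1)` leaves `4
        -- l^(t - 3)`.
        have h2 : ENNReal.ofReal (l ^ (t - 1)) =
            ENNReal.ofReal (4 * l ^ (t - 3)) * ENNReal.ofReal (l / 2) ^ 2 := by
          rw [← ENNReal.ofReal_pow (by positivity), ← ENNReal.ofReal_mul (by positivity)]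
          congr 1
          rw [show t - 1 = (t - 3) + 2 by ring, Real.rpow_add hl, Real.rpow_two]
          ring
        calc _ = ENNReal.ofReal (4 * l ^ (t - 3)) *
              (ENNReal.ofReal (l / 2) ^ 2 * volume {x | l < ‖u x‖}) := by
              rw [h2, mul_comm, mul_assoc]
          _ ≤ _ := by
              refine (mul_le_mul_right h1 _).trans (le_of_eq ?_)
              rw [← lintegral_const_mul' _ _ ENNReal.ofReal_ne_top]
              congr 1
              ext x
              by_cases hx : ‖h x‖ ≤ (2 / l) ^ (t - 1)
              · simp [G, hx]
              · simp [G, hx]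
    _ = ∫⁻ x, ∫⁻ l in Set.Ioi (0 : ℝ), G l x := lintegral_lintegral_swap hG.aemeasurable
    _ ≤ ∫⁻ x, ENNReal.ofReal (4 * 2 ^ (t - 2) / (t - 2)) * ENNReal.ofReal (‖h x‖ ^ s) :=
        lintegral_mono fun x => lintegral_truncated_rpow_le hs1 hs2 hst (norm_nonneg _)
    _ ≤ _ := by
        rw [lintegral_const_mul' _ _ ENNReal.ofReal_ne_top]
        exact mul_le_of_le_one_right (by positivity) hN

/-- **Hausdorff–Young inequality** -/
theorem hausdorff_young {s t : ℝ≥0∞} (hs1 : 1 ≤ s) (hs2 : s ≤ 2) (hst : s⁻¹ + t⁻¹ = 1) :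
    ∃ C : ℝ≥0∞, C ≠ ⊤ ∧ ∀ h : V → ℂ, MemLp h s → ∃ u : V → ℂ, MemLp u t ∧ IsFourierInv h u ∧
      eLpNorm u t ≤ C * eLpNorm h s := by
  rcases hs1.eq_or_lt with rfl | hs1
  · have ht : t = ⊤ := by simpa using hst
    subst ht
    refine ⟨1, ENNReal.one_ne_top, fun h hh => ?_⟩
    obtain ⟨u, hu, hb, hF⟩ := exists_isFourierInv_one hh
    have hb' : eLpNorm u ⊤ ≤ eLpNorm h 1 := by
      rw [eLpNorm_exponent_top]
      exact eLpNormEssSup_le_of_ae_enorm_bound (Filter.Eventually.of_forall hb)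
    exact ⟨u, ⟨hu, hb'.trans_lt hh.2⟩, hF, by rwa [one_mul]⟩
  rcases hs2.eq_or_lt with rfl | hs2
  · have ht : t = 2 := by
      have : t⁻¹ = 2⁻¹ := by
        have h2 : (2 : ℝ≥0∞)⁻¹ + 2⁻¹ = 1 := ENNReal.inv_two_add_inv_two
        exact ENNReal.add_right_inj (by simp) |>.1 (hst.trans h2.symm)
      exact inv_injective this
    subst ht
    refine ⟨1, ENNReal.one_ne_top, fun h hh => ?_⟩
    obtain ⟨u, hu, hb, hF⟩ := exists_isFourierInv_two hh
    exact ⟨u, hu, hF, by rw [hb, one_mul]⟩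
  have hsT : s ≠ ⊤ := (hs2.trans ENNReal.ofNat_lt_top).ne
  have hs0 : s ≠ 0 := (zero_lt_one.trans hs1).ne'
  have htT : t ≠ ⊤ := by
    rintro rfl
    simp only [ENNReal.inv_top, add_zero, ENNReal.inv_eq_one] at hst
    exact hs1.ne' hst
  have ht0 : t ≠ 0 := by
    rintro rfl
    simp at hst
  lift s to ℝ≥0 using hsT
  lift t to ℝ≥0 using htT
  have hs1' : 1 < (s : ℝ) := by exact_mod_cast hs1
  have hs2' : (s : ℝ) < 2 := by exact_mod_cast hs2
  have hs0' : s ≠ 0 := by exact_mod_cast hs0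
  have ht0' : t ≠ 0 := by exact_mod_cast ht0
  have hst' : ((t : ℝ) - 1) * (s - 1) = 1 := by
    rw [← ENNReal.coe_inv hs0', ← ENNReal.coe_inv ht0'] at hst
    have h : (s : ℝ)⁻¹ + (t : ℝ)⁻¹ = 1 := by exact_mod_cast hst
    have : (s : ℝ) ≠ 0 := by exact_mod_cast hs0'
    have : (t : ℝ) ≠ 0 := by exact_mod_cast ht0'
    field_simp at h
    linarith
  have hpow : ∀ (r : ℝ≥0) (f : V → ℂ), r ≠ 0 →
      eLpNorm f r ^ (r : ℝ) = ∫⁻ x, ENNReal.ofReal (‖f x‖ ^ (r : ℝ)) := fun r f hr => by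
    rw [eLpNorm_nnreal_pow_eq_lintegral hr]
    congr 1
    ext x
    rw [← ofReal_norm, ENNReal.ofReal_rpow_of_nonneg (norm_nonneg _) r.coe_nonneg]
  refine ⟨ENNReal.ofReal (t * (4 * 2 ^ ((t : ℝ) - 2) / (t - 2))) ^ (t : ℝ)⁻¹,
    ENNReal.rpow_ne_top_of_nonneg (by positivity) ENNReal.ofReal_ne_top, fun h hh => ?_⟩
  -- The interpolation bound is not homogeneous, so `h` is divided by its norm. The zero norm must
  -- be treated apart.
  rcases eq_or_ne (eLpNorm h s) 0 with h0 | h0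
  · have hz : h =ᵐ[volume] 0 := (eLpNorm_eq_zero_iff hh.1 (by exact_mod_cast hs0')).1 h0
    refine ⟨0, MemLp.zero, fun χ => ?_, by simp⟩
    have : ∫ x, (𝓕⁻ χ) x * h x = ∫ x : V, (0 : ℂ) := integral_congr_ae (by
      filter_upwards [hz] with x hx
      simp [hx])
    simp [this]
  obtain ⟨h', hm', hae⟩ := hh.1
  have hn : eLpNorm h s = eLpNorm h' s := eLpNorm_congr_ae hae
  set c : ℝ := (eLpNorm h s).toReal with hc
  have hc0 : 0 < c := ENNReal.toReal_pos h0 hh.2.ne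
  have hcE : ENNReal.ofReal c = eLpNorm h s := ENNReal.ofReal_toReal hh.2.ne
  have hcn : ‖(c : ℂ)‖ₑ = eLpNorm h s := by
    rw [← ofReal_norm, Complex.norm_real, Real.norm_of_nonneg hc0.le, hcE]
  have hc0' : (c : ℂ) ≠ 0 := by exact_mod_cast hc0.ne'
  have hnorm : ∫⁻ x, ENNReal.ofReal (‖(c : ℂ)⁻¹ * h' x‖ ^ (s : ℝ)) ≤ 1 := by
    rw [← hpow s (fun x => (c : ℂ)⁻¹ * h' x) hs0']
    have : eLpNorm (fun x => (c : ℂ)⁻¹ * h' x) s = 1 := by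
      have e := eLpNorm_const_smul (c : ℂ)⁻¹ h' s (volume : Measure V)
      change eLpNorm (fun x => (c : ℂ)⁻¹ * h' x) s volume = _ at e
      rw [e, enorm_inv hc0', hcn, ← hn]
      exact ENNReal.inv_mul_cancel h0 hh.2.ne
    rw [this, ENNReal.one_rpow]
  obtain ⟨u, hu, hF, hb⟩ := exists_isFourierInv_normalized (hm'.const_mul _) hs1' hs2' hst' hnorm
  rw [← hpow t u ht0'] at hb
  have hb' := ENNReal.rpow_le_rpow hb (inv_nonneg.2 t.coe_nonneg)
  rw [← ENNReal.rpow_mul, mul_inv_cancel₀ (by exact_mod_cast ht0'), ENNReal.rpow_one] at hb'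
  have hcu : eLpNorm (fun x => (c : ℂ) * u x) t = eLpNorm h s * eLpNorm u t := by
    have e := eLpNorm_const_smul (c : ℂ) u t (volume : Measure V)
    rw [hcn] at e
    exact e
  have hfin : eLpNorm u t < ⊤ := hb'.trans_lt
    (ENNReal.rpow_ne_top_of_nonneg (by positivity) ENNReal.ofReal_ne_top).lt_top
  refine ⟨fun x => c * u x, ⟨hu.const_mul _, ?_⟩, ?_, ?_⟩
  · rw [hcu]
    exact ENNReal.mul_lt_top hh.2 hfin
  · refine (hF.const_mul (c : ℂ)).congr ?_
    filter_upwards [hae] with x hx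
    rw [hx, mul_inv_cancel_left₀ hc0']
  · rw [hcu, mul_comm]
    exact mul_le_mul_left hb' _

end HausdorffYoung

end TimeFreq
end

/-! ### Fourier analysis on phase space, transported from the Euclidean product since the product
type carries the sup norm. -/

noncomputable section
namespace TimeFreq

variable {d : ℕ}

/-- The identification of `ℝ²ᵈ` with the Euclidean space of the same dimension. -/
def euclideanEquiv : WithLp 2 (Rd d × Rd d) ≃L[ℝ] Rd d × Rd d :=
  WithLp.prodContinuousLinearEquiv 2 ℝ (Rd d) (Rd d)

theorem measurePreserving_euclideanEquiv :
    MeasurePreserving (euclideanEquiv (d := d)) volume volume :=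
  WithLp.volume_preserving_ofLp (Rd d) (Rd d)

theorem measurableEmbedding_euclideanEquiv : MeasurableEmbedding (euclideanEquiv (d := d)) :=
  (euclideanEquiv (d := d)).toHomeomorph.measurableEmbedding

/-- The inverse Fourier transform of Schwartz functions on `ℝ²ᵈ`. -/
def fourierInv2 (χ : 𝓢(Rd d × Rd d, ℂ)) : 𝓢(Rd d × Rd d, ℂ) :=
  compCLMOfContinuousLinearEquiv ℂ euclideanEquiv.symm
    (𝓕⁻ (compCLMOfContinuousLinearEquiv ℂ euclideanEquiv χ))

theorem fourierInv2_euclideanEquiv (χ : 𝓢(Rd d × Rd d, ℂ)) (v : WithLp 2 (Rd d × Rd d)) :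
    fourierInv2 χ (euclideanEquiv v) =
      (𝓕⁻ (compCLMOfContinuousLinearEquiv ℂ euclideanEquiv χ)) v := by
  simp [fourierInv2]

theorem integral_fourierInv2_mul_character (χ : 𝓢(Rd d × Rd d, ℂ)) (w : Rd d × Rd d) :
    ∫ ζ, fourierInv2 χ ζ * character ζ w = χ w := by
  set X := compCLMOfContinuousLinearEquiv ℂ (euclideanEquiv (d := d)) χ with hX
  have h1 : (𝓕 (𝓕⁻ X)) (euclideanEquiv.symm w) = χ w := by
    rw [FourierTransform.fourier_fourierInv_eq]
    simp [X]
  rw [← h1, SchwartzMap.fourier_coe, Real.fourier_eq',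
    ← measurePreserving_euclideanEquiv.integral_comp measurableEmbedding_euclideanEquiv]
  congr 1
  ext v
  rw [fourierInv2_euclideanEquiv, smul_eq_mul, mul_comm, ← hX, character, ← Complex.exp_add,
    ← add_mul, ← Complex.ofReal_add, ← mul_add]
  congr 5
  rw [WithLp.prod_inner_apply, real_inner_comm, real_inner_comm _ w.2]
  rfl

theorem hausdorff_young_prod {s t : ℝ≥0∞} (hs1 : 1 ≤ s) (hs2 : s ≤ 2) (hst : s⁻¹ + t⁻¹ = 1) :
    ∃ C : ℝ≥0∞, C ≠ ⊤ ∧ ∀ h : Rd d × Rd d → ℂ, MemLp h s → ∃ u : Rd d × Rd d → ℂ, MemLp u t ∧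
      (∀ χ : 𝓢(Rd d × Rd d, ℂ), ∫ w, χ w * u w = ∫ ζ, fourierInv2 χ ζ * h ζ) ∧
      eLpNorm u t ≤ C * eLpNorm h s := by
  obtain ⟨C, hC, H⟩ := hausdorff_young (V := WithLp 2 (Rd d × Rd d)) hs1 hs2 hst
  have hmp := measurePreserving_euclideanEquiv (d := d)
  have hme := measurableEmbedding_euclideanEquiv (d := d)
  have hmp' : MeasurePreserving (euclideanEquiv (d := d)).symm volume volume :=
    WithLp.volume_preserving_toLp (Rd d) (Rd d)
  refine ⟨C, hC, fun h hh => ?_⟩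
  obtain ⟨u, hu, hF, hb⟩ := H (h ∘ euclideanEquiv) (hh.comp_measurePreserving hmp)
  refine ⟨u ∘ euclideanEquiv.symm, hu.comp_measurePreserving hmp', fun χ => ?_, ?_⟩
  · rw [← hmp.integral_comp hme, ← hmp.integral_comp hme]
    simp only [fourierInv2_euclideanEquiv, Function.comp_apply,
      ContinuousLinearEquiv.symm_apply_apply]
    have := hF (compCLMOfContinuousLinearEquiv ℂ euclideanEquiv χ)
    simpa using this
  · rw [eLpNorm_comp_measurePreserving hu.1 hmp']
    rwa [eLpNorm_comp_measurePreserving hh.1 hmp] at hb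

/-- The product of a Schwartz function with the Gaussian centred at `z`. -/
def gaussMul (z : Rd d × Rd d) : 𝓢(Rd d × Rd d, ℂ) →L[ℂ] 𝓢(Rd d × Rd d, ℂ) :=
  SchwartzMap.smulLeftCLM ℂ (compSubConstCLM ℂ z gauss2)

theorem gaussMul_apply (z : Rd d × Rd d) (χ : 𝓢(Rd d × Rd d, ℂ)) (w : Rd d × Rd d) :
    gaussMul z χ w = gauss2 (w - z) * χ w := by
  rw [gaussMul, SchwartzMap.smulLeftCLM_apply_apply (SchwartzMap.hasTemperateGrowth _),
    compSubConstCLM_apply, smul_eq_mul]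

/-- By Fourier inversion for `χ`, the function `gaussMul z χ` is a superposition of the atoms
`gaussAtom z ζ` with coefficients `fourierInv2 χ ζ`. Applying the ambiguity distribution identifies
its Gaussian localization at `z` as the inverse Fourier transform of the function of `ζ` under the
integral. -/
theorem integral_fourierInv2_mul_ambiguity (f₁ f₂ : 𝓢'(Rd d, ℂ)) (z : Rd d × Rd d)
    (χ : 𝓢(Rd d × Rd d, ℂ)) :
    ambiguity f₁ f₂ (gaussMul z χ) =
      ∫ ζ, fourierInv2 χ ζ * ambiguity f₁ f₂ (gaussAtom z ζ) := by
  let Φ : 𝓢((Rd d × Rd d) × (Rd d × Rd d), ℂ) :=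
    SchwartzMap.smulLeftCLM ℂ (fun u : (Rd d × Rd d) × (Rd d × Rd d) => character u.1 u.2)
      (tensor (fourierInv2 χ) (compSubConstCLM ℂ z gauss2))
  have hΦ : ∀ ζ w, Φ (ζ, w) = fourierInv2 χ ζ * (character ζ w * gauss2 (w - z)) := fun ζ w => by
    simp only [Φ]
    rw [SchwartzMap.smulLeftCLM_apply_apply hasTemperateGrowth_character_uncurry, tensor_apply,
      compSubConstCLM_apply, smul_eq_mul]
    ring
  have h := distribution_integral volume (toCLM (ambiguity f₁ f₂)) Φ
  have h1 : integralFst volume Φ = gaussMul z χ := by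
    ext w
    rw [integralFst_apply, gaussMul_apply, ← integral_fourierInv2_mul_character χ w,
      ← integral_const_mul]
    congr 1
    ext ζ
    rw [hΦ]
    ring
  have h2 : ∀ ζ, slice ζ Φ = fourierInv2 χ ζ • gaussAtom z ζ := fun ζ => by
    ext w
    rw [slice_apply, hΦ, smul_apply, gaussAtom_apply, smul_eq_mul]
  rw [h1] at h
  simpa only [h2, map_smul, smul_eq_mul, toCLM_apply] using h

end TimeFreq
end

/-! ### Exponents, and the mixed norm bound for the transform of the ambiguity function. -/

noncomputable section
namespace TimeFreq

section Mixed
variable {α β : Type*} [MeasurableSpace α] [MeasurableSpace β] {μ : Measure α} {ν : Measure β}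

theorem essSup_le_iff_ae_le {f : α → ℝ≥0∞} {c : ℝ≥0∞} : essSup f μ ≤ c ↔ ∀ᵐ x ∂μ, f x ≤ c :=
  ⟨fun h => (ENNReal.ae_le_essSup f).mono fun _ hx => hx.trans h, fun h => essSup_le_of_ae_le c h⟩

/-- The `L^p` norm on a product is an iterated `L^p` norm. -/
theorem eLpNorm_prod [SFinite ν] {K : α × β → ℝ≥0∞} (hK : Measurable K) {p : ℝ≥0∞} (hp : p ≠ 0) :
    eLpNorm K p (μ.prod ν) = eLpNorm (fun x => eLpNorm (fun y => K (x, y)) p ν) p μ := by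
  rcases eq_or_ne p ⊤ with rfl | ht
  · simp only [eLpNorm_top_ennreal]
    refine eq_of_forall_ge_iff fun c => ?_
    simp only [essSup_le_iff_ae_le]
    exact Measure.ae_prod_iff_ae_ae (hK measurableSet_Iic)
  · have h0 := ENNReal.toReal_pos hp ht
    simp only [eLpNorm_ennreal hp ht]
    rw [lintegral_prod _ (hK.pow_const _).aemeasurable]
    simp only [← ENNReal.rpow_mul, one_div_mul_cancel h0.ne', ENNReal.rpow_one]

theorem eLpNorm_prod_symm [SFinite μ] [SFinite ν] {K : α × β → ℝ≥0∞} (hK : Measurable K)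
    {p : ℝ≥0∞} (hp : p ≠ 0) :
    eLpNorm K p (μ.prod ν) = eLpNorm (fun y => eLpNorm (fun x => K (x, y)) p μ) p ν := by
  have h := eLpNorm_prod (μ := ν) (ν := μ) (hK.comp measurable_swap) hp
  simp only [Function.comp_apply, Prod.swap_prod_mk] at h
  rw [← h]
  exact (eLpNorm_comp_measurePreserving hK.aestronglyMeasurable
    (Measure.measurePreserving_swap (μ := ν) (ν := μ))).symm

theorem eLpNorm_rpow_ennreal (f : α → ℝ≥0∞) (p : ℝ≥0∞) {r : ℝ} (hr : 0 < r) :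
    eLpNorm (fun x => f x ^ r) p μ = eLpNorm f (p * ENNReal.ofReal r) μ ^ r := by
  simpa using eLpNorm_enorm_rpow (p := p) (μ := μ) f hr

theorem mixedNorm_rpow (F : α × α → ℝ≥0∞) (p q : ℝ≥0∞) {r : ℝ} (hr : 0 < r) :
    mixedNorm μ p q (fun z => F z ^ r) =
      mixedNorm μ (p * ENNReal.ofReal r) (q * ENNReal.ofReal r) F ^ r := by
  simp only [mixedNorm, eLpNorm_rpow_ennreal _ _ hr]

theorem mixedNorm_comp_neg {G : Type*} [AddCommGroup G] [MeasurableSpace G] [MeasurableNeg G]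
    {μ : Measure G} [SFinite μ] [μ.IsNegInvariant] {F : G × G → ℝ≥0∞} (hF : Measurable F)
    (p q : ℝ≥0∞) : mixedNorm μ p q (fun z => F (-z)) = mixedNorm μ p q F := by
  have h1 : ∀ ξ, eLpNorm (fun x => F (-x, -ξ)) p μ = eLpNorm (fun x => F (x, -ξ)) p μ := fun ξ =>
    eLpNorm_comp_measurePreserving (g := fun x => F (x, -ξ))
      (hF.comp (by fun_prop : Measurable fun x : G => (x, -ξ))).aestronglyMeasurable
      (Measure.measurePreserving_neg μ)
  have h2 : Measurable fun ξ => eLpNorm (fun x => F (x, ξ)) p μ :=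
    measurable_eLpNorm_section (f := fun ξ x => F (x, ξ)) (hF.comp measurable_swap) p
  simp only [mixedNorm, Prod.neg_mk, h1]
  exact eLpNorm_comp_measurePreserving h2.aestronglyMeasurable (Measure.measurePreserving_neg μ)

end Mixed

/-- Take `P₁ = max p₁ s` and let `P₂` be its conjugate. Then `s ≤ P₂` holds because `P₁ ≤ q`. If `P₁
= s`, then `P₂ = q ≥ p₂`; otherwise `P₁ = p₁`, and `p₂ ≤ P₂` is the condition on the reciprocals. -/
theorem exists_conj_exponents {p₁ p₂ q s : ℝ≥0∞} (hs : 1 ≤ s) (hsq : s ≤ q) (h : s⁻¹ + q⁻¹ = 1)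
    (h₁ : p₁ ≤ q) (h₂ : p₂ ≤ q) (hp : 1 ≤ p₁⁻¹ + p₂⁻¹) :
    ∃ P₁ P₂ : ℝ≥0∞, p₁ ≤ P₁ ∧ p₂ ≤ P₂ ∧ s ≤ P₁ ∧ s ≤ P₂ ∧ P₁⁻¹ + P₂⁻¹ = 1 := by
  have hs1 : s⁻¹ ≤ 1 := ENNReal.inv_le_one.2 hs
  have hsub : 1 - s⁻¹ = q⁻¹ := by
    rw [← h]
    exact ENNReal.add_sub_cancel_left (hs1.trans_lt ENNReal.one_lt_top).ne
  have hq1 : q⁻¹ ≤ 1 := ENNReal.inv_le_one.2 (hs.trans hsq)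
  have hsub' : 1 - q⁻¹ = s⁻¹ := by
    rw [← h]
    exact ENNReal.add_sub_cancel_right (hq1.trans_lt ENNReal.one_lt_top).ne
  refine ⟨max p₁ s, (1 - (max p₁ s)⁻¹)⁻¹, le_max_left _ _, ?_, le_max_right _ _, ?_, ?_⟩
  · rw [ENNReal.le_inv_iff_le_inv]
    rcases le_total p₁ s with h' | h'
    · rw [max_eq_right h', hsub]
      exact ENNReal.inv_le_inv.2 h₂
    · rw [max_eq_left h']
      exact tsub_le_iff_left.2 hp
  · rw [ENNReal.le_inv_iff_le_inv, ← hsub']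
    exact tsub_le_tsub_left (ENNReal.inv_le_inv.2 (max_le h₁ hsq)) _
  · rw [inv_inv]
    exact add_tsub_cancel_of_le (ENNReal.inv_le_one.2 (hs.trans (le_max_right _ _)))

/-- Both sides equal `s`: this is the Young relation for the `s`-th powers of the two transforms. -/
theorem young_exponents {P₁ P₂ q s : ℝ≥0∞} (hs0 : s ≠ 0) (hsT : s ≠ ⊤) (h : s⁻¹ + q⁻¹ = 1)
    (hP : P₁⁻¹ + P₂⁻¹ = 1) : (P₁ / s)⁻¹ + (P₂ / s)⁻¹ = 1 + (q / s)⁻¹ := by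
  rw [ENNReal.inv_div (Or.inl hsT) (Or.inl hs0), ENNReal.inv_div (Or.inl hsT) (Or.inl hs0),
    ENNReal.inv_div (Or.inl hsT) (Or.inl hs0), div_eq_mul_inv, div_eq_mul_inv, div_eq_mul_inv,
    ← mul_add, hP, mul_one]
  calc s = s * (s⁻¹ + q⁻¹) := by rw [h, mul_one]
    _ = _ := by rw [mul_add, ENNReal.mul_inv_cancel hs0 hsT]

/-- A convolution estimate in mixed norm spaces with powers. -/
theorem eLpNorm_rpow_conv_le {G : Type*} [AddCommGroup G] [MeasurableSpace G] [MeasurableAdd₂ G]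
    [MeasurableNeg G] {μ : Measure G} [SigmaFinite μ] [μ.IsAddLeftInvariant] [μ.IsNegInvariant]
    {F₁ F₂ : G × G → ℝ≥0∞} (hF₁ : Measurable F₁) (hF₂ : Measurable F₂) {q s P₁ P₂ Q₁ Q₂ : ℝ≥0∞}
    (hs : 1 ≤ s) (hsT : s ≠ ⊤) (hsq : s ≤ q) (hq : s⁻¹ + q⁻¹ = 1)
    (hP₁ : s ≤ P₁) (hP₂ : s ≤ P₂) (hQ₁ : s ≤ Q₁) (hQ₂ : s ≤ Q₂)
    (hP : P₁⁻¹ + P₂⁻¹ = 1) (hQ : Q₁⁻¹ + Q₂⁻¹ = 1) :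
    eLpNorm (fun z => (∫⁻ w, F₁ w ^ s.toReal * F₂ (w - z) ^ s.toReal ∂(μ.prod μ)) ^ s.toReal⁻¹)
      q (μ.prod μ) ≤ mixedNorm μ P₁ Q₁ F₁ * mixedNorm μ P₂ Q₂ F₂ := by
  have hs0 : s ≠ 0 := (zero_lt_one.trans_le hs).ne'
  have hr : 0 < s.toReal := ENNReal.toReal_pos hs0 hsT
  have hmul : ∀ P : ℝ≥0∞, P / s * ENNReal.ofReal s.toReal = P := fun P => by
    rw [ENNReal.ofReal_toReal hsT, ENNReal.div_mul_cancel hs0 hsT]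
  have hone : ∀ {P : ℝ≥0∞}, s ≤ P → 1 ≤ P / s := fun h => by
    rwa [ENNReal.le_div_iff_mul_le (Or.inl hs0) (Or.inl hsT), one_mul]
  have hneg : Measurable fun z : G × G => -z := measurable_fst.neg.prodMk measurable_snd.neg
  have hsub : Measurable fun p : (G × G) × (G × G) => p.1 - p.2 :=
    ((measurable_fst.comp measurable_fst).sub (measurable_fst.comp measurable_snd)).prodMk
      ((measurable_snd.comp measurable_fst).sub (measurable_snd.comp measurable_snd))
  -- The correlation is a convolution with the reflection of `F₂`, and reflection preserves mixed
  -- norms.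
  have hm₂ : Measurable fun z : G × G => F₂ (-z) ^ s.toReal :=
    (hF₂.comp hneg).pow_const _
  have key := mixedNorm_conv_le (μ := μ) (hF₁.pow_const s.toReal) hm₂ (hone hP₁) (hone hP₂)
    (young_exponents hs0 hsT hq hP) (hone hQ₁) (hone hQ₂) (young_exponents hs0 hsT hq hQ) (hone hsq)
  rw [mixedNorm_comp_neg (F := fun z => F₂ z ^ s.toReal) (by fun_prop), mixedNorm_rpow _ _ _ hr,
    mixedNorm_rpow _ _ _ hr, hmul, hmul, hmul, hmul] at key
  set I : G × G → ℝ≥0∞ := fun z => ∫⁻ w, F₁ w ^ s.toReal * F₂ (-(z - w)) ^ s.toReal ∂(μ.prod μ)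
    with hI
  have hIm : Measurable I := by
    refine Measurable.lintegral_prod_right' (f := fun p : (G × G) × (G × G) =>
      F₁ p.2 ^ s.toReal * F₂ (-(p.1 - p.2)) ^ s.toReal) ?_
    exact ((hF₁.comp measurable_snd).pow_const _).mul
      ((hF₂.comp (hneg.comp hsub)).pow_const _)
  have h1 : (fun z => (∫⁻ w, F₁ w ^ s.toReal * F₂ (w - z) ^ s.toReal ∂(μ.prod μ)) ^ s.toReal⁻¹) =
      fun z => I z ^ s.toReal⁻¹ := by
    simp only [hI, neg_sub]
  have hqs : q * ENNReal.ofReal s.toReal⁻¹ = q / s := by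
    rw [ENNReal.ofReal_inv_of_pos hr, ENNReal.ofReal_toReal hsT, div_eq_mul_inv]
  -- Both outer exponents in `key` are `q / s`, so its left side is an ordinary `L^(q/s)` norm on
  -- the product.
  rw [h1, eLpNorm_rpow_ennreal _ _ (inv_pos.2 hr), hqs,
    eLpNorm_prod_symm hIm (by exact (zero_lt_one.trans_le (hone hsq)).ne')]
  calc _ ≤ (mixedNorm μ P₁ Q₁ F₁ ^ s.toReal * mixedNorm μ P₂ Q₂ F₂ ^ s.toReal) ^ s.toReal⁻¹ :=
        ENNReal.rpow_le_rpow key (inv_nonneg.2 hr.le)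
    _ = _ := by
        rw [← ENNReal.mul_rpow_of_nonneg _ _ hr.le, ← ENNReal.rpow_mul, mul_inv_cancel₀ hr.ne',
          ENNReal.rpow_one]

variable {d : ℕ}

/-- For fixed `z`, the argument of the first transform is a swap followed by a reflection and
translations of `ζ`. Used as the new variable, it turns the argument of the second transform into
its translate by `-z`. -/
theorem lintegral_comp_shear (z : Rd d × Rd d) (G : Rd d × Rd d → ℝ≥0∞) (hG : Measurable G) :
    ∫⁻ ζ : Rd d × Rd d, G ((1 / 2 : ℝ) • z.1 - ζ.2, ζ.1 + (1 / 2 : ℝ) • z.2) = ∫⁻ w, G w := by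
  have h1 : MeasurePreserving (Prod.swap : Rd d × Rd d → Rd d × Rd d) volume volume :=
    Measure.measurePreserving_swap
  have h2 : MeasurePreserving (fun w : Rd d × Rd d => ((1 / 2 : ℝ) • z.1 - w.1,
      w.2 + (1 / 2 : ℝ) • z.2)) volume volume :=
    (Measure.measurePreserving_sub_left volume ((1 / 2 : ℝ) • z.1)).prod
      (measurePreserving_add_right volume ((1 / 2 : ℝ) • z.2))
  exact (h2.comp h1).lintegral_comp hG

/-- The `L^s` norm of the Gaussian-windowed short-time Fourier transform of the ambiguity
function is a convolution of short-time Fourier transforms. -/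
theorem eLpNorm_ambiguity_gaussAtom (f₁ f₂ : 𝓢'(Rd d, ℂ)) {s : ℝ≥0∞} (hs0 : s ≠ 0) (hsT : s ≠ ⊤)
    (z : Rd d × Rd d) :
    eLpNorm (fun ζ => ambiguity f₁ f₂ (gaussAtom z ζ)) s volume =
      ‖(2 : ℂ) ^ ((d : ℂ) / 2)‖ₑ * (∫⁻ w : Rd d × Rd d, ‖stft gauss1 f₁ w.1 w.2‖ₑ ^ s.toReal *
        ‖stft gauss1 f₂ (w - z).1 (w - z).2‖ₑ ^ s.toReal) ^ s.toReal⁻¹ := by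
  have hr : 0 < s.toReal := ENNReal.toReal_pos hs0 hsT
  have c1 := continuous_stft gauss1 f₁
  have c2 := continuous_stft gauss1 f₂
  let G : Rd d × Rd d → ℝ≥0∞ := fun w =>
    ‖stft gauss1 f₁ w.1 w.2‖ₑ * ‖stft gauss1 f₂ (w - z).1 (w - z).2‖ₑ
  have hG : Measurable G :=
    c1.enorm.measurable.mul ((c2.comp (continuous_sub_right z)).enorm.measurable)
  have h1 : ∀ ζ, ‖ambiguity f₁ f₂ (gaussAtom z ζ)‖ₑ = ‖(2 : ℂ) ^ ((d : ℂ) / 2)‖ₑ *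
      G ((1 / 2 : ℝ) • z.1 - ζ.2, ζ.1 + (1 / 2 : ℝ) • z.2) := fun ζ => by
    rw [show gaussAtom z ζ = gaussAtom (z.1, z.2) (ζ.1, ζ.2) from rfl, ambiguity_gaussAtom,
      enorm_mul, enorm_mul, enorm_mul]
    have e1 : ‖Complex.exp (↑(-2 * Real.pi * inner ℝ z.2 ζ.2) * Complex.I)‖ₑ = 1 := by
      rw [← ofReal_norm, Complex.norm_exp_ofReal_mul_I, ENNReal.ofReal_one]
    have e2 : (1 / 2 : ℝ) • z.1 - ζ.2 - z.1 = -((1 / 2 : ℝ) • z.1) - ζ.2 := by module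
    have e3 : ζ.1 + (1 / 2 : ℝ) • z.2 - z.2 = ζ.1 - (1 / 2 : ℝ) • z.2 := by module
    simp only [G, e1, mul_one, Prod.fst_sub, Prod.snd_sub, e2, e3]
    rw [← ofReal_norm (starRingEnd ℂ _), RCLike.norm_conj, ofReal_norm]
  have h2 : eLpNorm (fun ζ => ambiguity f₁ f₂ (gaussAtom z ζ)) s volume =
      eLpNorm (fun ζ : Rd d × Rd d => ‖(2 : ℂ) ^ ((d : ℂ) / 2)‖ₑ *
        G ((1 / 2 : ℝ) • z.1 - ζ.2, ζ.1 + (1 / 2 : ℝ) • z.2)) s volume := by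
    rw [← eLpNorm_enorm]
    simp only [h1]
  rw [h2, eLpNorm_const_mul_ennreal _ enorm_ne_top, eLpNorm_ennreal hs0 hsT,
    lintegral_comp_shear z (fun w => G w ^ s.toReal) (hG.pow_const _), one_div]
  simp only [G, ENNReal.mul_rpow_of_nonneg _ _ hr.le]

theorem memLp_ambiguity_gaussAtom (f₁ f₂ : 𝓢'(Rd d, ℂ)) {s : ℝ≥0∞} {z : Rd d × Rd d}
    (h : eLpNorm (fun ζ => ambiguity f₁ f₂ (gaussAtom z ζ)) s volume < ⊤) :
    MemLp (fun ζ => ambiguity f₁ f₂ (gaussAtom z ζ)) s volume := by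
  refine ⟨Continuous.aestronglyMeasurable ?_, h⟩
  have h1 : (fun ζ => ambiguity f₁ f₂ (gaussAtom z ζ)) = fun ζ : Rd d × Rd d =>
      (2 : ℂ) ^ ((d : ℂ) / 2) * Complex.exp (↑(-2 * Real.pi * inner ℝ z.2 ζ.2) * Complex.I) *
      (stft gauss1 f₁ ((1 / 2 : ℝ) • z.1 - ζ.2) (ζ.1 + (1 / 2 : ℝ) • z.2) *
        (starRingEnd ℂ) (stft gauss1 f₂ (-((1 / 2 : ℝ) • z.1) - ζ.2) (ζ.1 - (1 / 2 : ℝ) • z.2))) := by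
    ext ζ
    exact ambiguity_gaussAtom f₁ f₂ z.1 z.2 ζ.1 ζ.2
  have c1 := (continuous_stft gauss1 f₁).comp (by fun_prop : Continuous fun ζ : Rd d × Rd d =>
    ((1 / 2 : ℝ) • z.1 - ζ.2, ζ.1 + (1 / 2 : ℝ) • z.2))
  have c2 := (continuous_stft gauss1 f₂).comp (by fun_prop : Continuous fun ζ : Rd d × Rd d =>
    (-((1 / 2 : ℝ) • z.1) - ζ.2, ζ.1 - (1 / 2 : ℝ) • z.2))
  simp only [Function.comp_def] at c1 c2
  have := Complex.continuous_conj
  rw [h1]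
  fun_prop

/-- The `L^{s,q}` bound for the Gaussian-windowed short-time Fourier transform of the ambiguity
function. -/
theorem eLpNorm_eLpNorm_ambiguity_le (g₁ g₂ : 𝓢(Rd d, ℂ)) (hg₁ : g₁ ≠ 0) (hg₂ : g₂ ≠ 0)
    {p₁ p₂ q₁ q₂ q s : ℝ≥0∞} (hs : 1 ≤ s) (hsT : s ≠ ⊤) (hsq : s ≤ q) (hq : s⁻¹ + q⁻¹ = 1)
    (hp₁ : 1 ≤ p₁) (hp₂ : 1 ≤ p₂) (hq₁ : 1 ≤ q₁) (hq₂ : 1 ≤ q₂)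
    (hp₁q : p₁ ≤ q) (hp₂q : p₂ ≤ q) (hq₁q : q₁ ≤ q) (hq₂q : q₂ ≤ q)
    (hp : 1 ≤ p₁⁻¹ + p₂⁻¹) (hqq : 1 ≤ q₁⁻¹ + q₂⁻¹) :
    ∃ C : ℝ≥0∞, C ≠ ⊤ ∧ ∀ f₁ f₂ : 𝓢'(Rd d, ℂ),
      eLpNorm (fun z => eLpNorm (fun ζ => ambiguity f₁ f₂ (gaussAtom z ζ)) s volume) q volume ≤
        C * modulationNorm g₁ p₁ q₁ f₁ * modulationNorm g₂ p₂ q₂ f₂ := by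
  have hs0 : s ≠ 0 := (zero_lt_one.trans_le hs).ne'
  obtain ⟨P₁, P₂, hpP₁, hpP₂, hsP₁, hsP₂, hP⟩ := exists_conj_exponents hs hsq hq hp₁q hp₂q hp
  obtain ⟨Q₁, Q₂, hqQ₁, hqQ₂, hsQ₁, hsQ₂, hQ⟩ := exists_conj_exponents hs hsq hq hq₁q hq₂q hqq
  obtain ⟨C₁, hC₁, h₁⟩ := modulationNorm_le_of_le g₁ gauss1 hg₁ hp₁ hq₁ hpP₁ hqQ₁
  obtain ⟨C₂, hC₂, h₂⟩ := modulationNorm_le_of_le g₂ gauss1 hg₂ hp₂ hq₂ hpP₂ hqQ₂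
  refine ⟨‖(2 : ℂ) ^ ((d : ℂ) / 2)‖ₑ * (C₁ * C₂),
    ENNReal.mul_ne_top enorm_ne_top (ENNReal.mul_ne_top hC₁ hC₂), fun f₁ f₂ => ?_⟩
  simp only [eLpNorm_ambiguity_gaussAtom f₁ f₂ hs0 hsT]
  rw [eLpNorm_const_mul_ennreal _ enorm_ne_top]
  calc _ ≤ ‖(2 : ℂ) ^ ((d : ℂ) / 2)‖ₑ *
        (modulationNorm gauss1 P₁ Q₁ f₁ * modulationNorm gauss1 P₂ Q₂ f₂) := by
        gcongr
        rw [modulationNorm_eq_mixedNorm, modulationNorm_eq_mixedNorm]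
        exact eLpNorm_rpow_conv_le
          (F₂ := fun w : Rd d × Rd d => ‖stft gauss1 f₂ w.1 w.2‖ₑ)
          (continuous_stft gauss1 f₁).enorm.measurable
          (continuous_stft gauss1 f₂).enorm.measurable hs hsT hsq hq hsP₁ hsP₂ hsQ₁ hsQ₂ hP hQ
    _ ≤ ‖(2 : ℂ) ^ ((d : ℂ) / 2)‖ₑ *
        ((C₁ * modulationNorm g₁ p₁ q₁ f₁) * (C₂ * modulationNorm g₂ p₂ q₂ f₂)) := by
        gcongr
        · exact h₁ f₁
        · exact h₂ f₂
    _ = _ := by ring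

end TimeFreq
end

/-! ### From Gaussian localizations back to an `L^q` function. -/

noncomputable section
namespace TimeFreq

variable {d : ℕ}

instance : (volume : Measure (Rd d × Rd d)).IsNegInvariant :=
  Measure.IsAddHaarMeasure.isNegInvariant_of_regular _

theorem gauss2_apply (w : Rd d × Rd d) : gauss2 w =
    Complex.exp ((-(Real.pi / 2) * ‖w.1‖ ^ 2 : ℝ) : ℂ) *
      Complex.exp ((-(Real.pi / 2) * ‖w.2‖ ^ 2 : ℝ) : ℂ) := by
  rw [gauss2, tensor_apply, gaussian_apply, gaussian_apply]

theorem gauss2_ne_zero (w : Rd d × Rd d) : gauss2 w ≠ 0 := by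
  rw [gauss2_apply]
  exact mul_ne_zero (Complex.exp_ne_zero _) (Complex.exp_ne_zero _)

theorem gauss2_neg (w : Rd d × Rd d) : gauss2 (-w) = gauss2 w := by
  simp [gauss2_apply]

theorem integral_gauss2_ne_zero : ∫ w : Rd d × Rd d, gauss2 w ≠ 0 := by
  have h0 : ∫ η : Rd d, Complex.exp ((-(Real.pi / 2) * ‖η‖ ^ 2 : ℝ) : ℂ) = (2 : ℂ) ^ ((d : ℂ) / 2) := by
    have h := integral_gaussian_phase (0 : Rd d)
    simp only [inner_zero_right, mul_zero, Complex.ofReal_zero, zero_mul, Complex.exp_zero, mul_one,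
      norm_zero, ne_eq, OfNat.ofNat_ne_zero, not_false_eq_true, zero_pow] at h
    exact h
  have h : ∫ w : Rd d × Rd d, gauss2 w = (2 : ℂ) ^ ((d : ℂ) / 2) * (2 : ℂ) ^ ((d : ℂ) / 2) := by
    simp only [gauss2_apply]
    rw [Measure.volume_eq_prod, integral_prod_mul
      (fun η : Rd d => Complex.exp ((-(Real.pi / 2) * ‖η‖ ^ 2 : ℝ) : ℂ))
      (fun η : Rd d => Complex.exp ((-(Real.pi / 2) * ‖η‖ ^ 2 : ℝ) : ℂ)), h0]
  rw [h]
  have : (2 : ℂ) ^ ((d : ℂ) / 2) ≠ 0 := by simp [Complex.cpow_eq_zero_iff]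
  exact mul_ne_zero this this

theorem gaussMul_comm (z z' : Rd d × Rd d) (χ : 𝓢(Rd d × Rd d, ℂ)) :
    gaussMul z (gaussMul z' χ) = gaussMul z' (gaussMul z χ) := by
  ext w
  simp only [gaussMul_apply]
  ring

/-- The linear change of variables `(z, w) ↦ (w - z, w)`. -/
def gaborShear : ((Rd d × Rd d) × (Rd d × Rd d)) ≃L[ℝ] (Rd d × Rd d) × (Rd d × Rd d) :=
  LinearEquiv.toContinuousLinearEquiv
    { toFun := fun u => (u.2 - u.1, u.2)
      invFun := fun u => (u.2 - u.1, u.2)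
      map_add' := fun u u' => by simp only [Prod.mk_add_mk, Prod.fst_add, Prod.snd_add]; congr 1; abel
      map_smul' := fun a u => by simp [smul_sub]
      left_inv := fun u => by simp
      right_inv := fun u => by simp }

/-- Averaging the localizations of a distribution by translated Gaussians recovers the
distribution. -/
theorem integral_gaussMul (T : 𝓢(Rd d × Rd d, ℂ) →L[ℂ] ℂ) (Φ : 𝓢(Rd d × Rd d, ℂ)) :
    (∫ w : Rd d × Rd d, gauss2 w) * T Φ = ∫ z, T (gaussMul z Φ) := by
  let K : 𝓢((Rd d × Rd d) × (Rd d × Rd d), ℂ) :=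
    compCLMOfContinuousLinearEquiv ℂ gaborShear (tensor gauss2 Φ)
  have hK : ∀ z w, K (z, w) = gauss2 (w - z) * Φ w := fun z w => rfl
  have h := distribution_integral volume T K
  have h1 : integralFst volume K = (∫ w : Rd d × Rd d, gauss2 w) • Φ := by
    ext w
    rw [integralFst_apply, smul_apply, smul_eq_mul]
    simp only [hK]
    rw [integral_mul_const, integral_sub_left_eq_self (fun z => gauss2 z) volume w]
  have h2 : ∀ z, slice z K = gaussMul z Φ := fun z => by
    ext w
    rw [slice_apply, hK, gaussMul_apply]
  rw [h1, map_smul, smul_eq_mul] at h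
  simpa only [h2] using h

theorem integrable_gauss2_mul_prod {Φ A : Rd d × Rd d → ℂ} (h : Integrable (fun w => Φ w * A w)) :
    Integrable (fun u : (Rd d × Rd d) × (Rd d × Rd d) => Φ u.2 * A u.2 * gauss2 (u.2 - u.1))
      ((volume : Measure (Rd d × Rd d)).prod volume) := by
  have := Integrable.convolution_integrand (ContinuousLinearMap.mul ℂ ℂ) (μ := volume) h
    (gauss2.integrable (μ := (volume : Measure (Rd d × Rd d))))
  refine this.congr (Filter.Eventually.of_forall fun u => ?_)
  simp only [ContinuousLinearMap.mul_apply']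
  rw [← gauss2_neg, neg_sub]

theorem eLpNorm_gauss2_ne_zero {q : ℝ≥0∞} (hq : q ≠ 0) :
    eLpNorm (gauss2 (d := d)) q volume ≠ 0 := by
  intro h
  have h1 := (eLpNorm_eq_zero_iff gauss2.continuous.aestronglyMeasurable hq).1 h
  have h2 := (Continuous.ae_eq_iff_eq volume (gauss2 (d := d)).continuous continuous_zero).1 h1
  exact gauss2_ne_zero 0 (congrFun h2 0)

/-- A distribution whose localizations by Gaussians are functions with `L^q` norms in `L^q` is an
`L^q` function. -/
theorem exists_memLp_of_localization (T : 𝓢(Rd d × Rd d, ℂ) →L[ℂ] ℂ) {q : ℝ≥0∞} (hq : 1 ≤ q)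
    (N : Rd d × Rd d → ℝ≥0∞) (hN : eLpNorm N q volume < ⊤)
    (hT : ∀ᵐ z, ∃ u : Rd d × Rd d → ℂ, MemLp u q ∧ (∀ χ, T (gaussMul z χ) = ∫ w, χ w * u w) ∧
      eLpNorm u q ≤ N z) :
    ∃ A : Rd d × Rd d → ℂ, MemLp A q ∧ (∀ Φ, T Φ = ∫ w, Φ w * A w) ∧
      eLpNorm A q volume * eLpNorm (gauss2 (d := d)) q volume ≤ eLpNorm N q volume := by
  have hq0 : q ≠ 0 := (zero_lt_one.trans_le hq).ne'
  -- One good centre `z₀` determines the candidate: its localization divided by the Gaussian, which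
  -- never vanishes. Global integrability of the quotient is only proved later, from all the other
  -- centres.
  obtain ⟨z₀, u₀, hu₀, hT₀, -⟩ := hT.exists
  obtain ⟨v₀, hv₀, hae₀⟩ := hu₀.1
  let A : Rd d × Rd d → ℂ := fun w => v₀ w / gauss2 (w - z₀)
  have hcont : ∀ z : Rd d × Rd d, Continuous fun w => gauss2 (w - z) := fun z =>
    gauss2.continuous.comp (continuous_sub_right z)
  have hA : StronglyMeasurable A := hv₀.div (hcont z₀).stronglyMeasurable
  have hloc : ∀ (z : Rd d × Rd d) {u : Rd d × Rd d → ℂ}, MemLp u q →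
      LocallyIntegrable (fun w => gauss2 (w - z) * u w) := fun z u hu =>
    (integrable_schwartz_mul hq hu (compSubConstCLM ℂ z gauss2)).locallyIntegrable
  have hkey : ∀ᵐ z, ∃ u : Rd d × Rd d → ℂ, MemLp u q ∧
      (∀ χ, T (gaussMul z χ) = ∫ w, χ w * u w) ∧ eLpNorm u q ≤ N z ∧
      u =ᵐ[volume] fun w => A w * gauss2 (w - z) := by
    filter_upwards [hT] with z ⟨u, hu, hTu, hb⟩
    refine ⟨u, hu, hTu, hb, ?_⟩
    -- Both sides represent `T` multiplied by the two Gaussians, in either order.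
    have h1 : (fun w => gauss2 (w - z₀) * u w) =ᵐ[volume] fun w => gauss2 (w - z) * u₀ w := by
      refine ae_eq_of_integral_schwartz_mul_eq (hloc z₀ hu) (hloc z hu₀) fun χ => ?_
      have e1 := hTu (gaussMul z₀ χ)
      have e2 := hT₀ (gaussMul z χ)
      rw [gaussMul_comm, e2] at e1
      simp only [gaussMul_apply] at e1
      calc _ = ∫ w, gauss2 (w - z₀) * χ w * u w := by
            congr 1; ext w; ring
        _ = _ := by
            rw [← e1]
            congr 1; ext w; ring
    filter_upwards [h1, hae₀] with w hw hw₀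
    have := gauss2_ne_zero (w - z₀)
    simp only [A]
    rw [← hw₀]
    field_simp
    linear_combination hw
  let K : (Rd d × Rd d) × (Rd d × Rd d) → ℝ≥0∞ := fun u => ‖A u.2‖ₑ * ‖gauss2 (u.2 - u.1)‖ₑ
  have hK : Measurable K :=
    (hA.measurable.comp measurable_snd).enorm.mul
      ((gauss2.continuous.comp (continuous_snd.sub continuous_fst)).enorm.measurable)
  have hG : ∀ w : Rd d × Rd d, eLpNorm (fun z => ‖gauss2 (w - z)‖ₑ) q volume =
      eLpNorm (gauss2 (d := d)) q volume := fun w => by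
    rw [eLpNorm_enorm]
    exact eLpNorm_comp_measurePreserving (f := fun z => w - z) gauss2.continuous.aestronglyMeasurable
      (Measure.measurePreserving_sub_left volume w)
  have hGT : eLpNorm (gauss2 (d := d)) q volume ≠ ⊤ := (gauss2.memLp q volume).2.ne
  have hnorm : eLpNorm A q volume * eLpNorm (gauss2 (d := d)) q volume ≤ eLpNorm N q volume := by
    -- The `L^q` norm of `A(w) gauss2(w - z)` on the product is computed in two orders. Integrating
    -- first in `z` gives the product of the two norms; integrating first in `w` gives the norms of
    -- the localizations, bounded by `N z`.
    have e1 := (eLpNorm_prod (μ := (volume : Measure (Rd d × Rd d)))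
      (ν := (volume : Measure (Rd d × Rd d))) hK hq0).symm.trans (eLpNorm_prod_symm hK hq0)
    have e2 : ∀ w, eLpNorm (fun z => K (z, w)) q volume =
        eLpNorm (gauss2 (d := d)) q volume * ‖A w‖ₑ := fun w => by
      simp only [K]
      rw [eLpNorm_const_mul_ennreal _ enorm_ne_top, hG, mul_comm]
    simp only [e2] at e1
    rw [eLpNorm_const_mul_ennreal _ hGT, eLpNorm_enorm] at e1
    rw [mul_comm, ← e1]
    refine eLpNorm_mono_enorm_ae ?_
    filter_upwards [hkey] with z ⟨u, _, _, hb, hu⟩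
    simp only [enorm_eq_self]
    refine le_trans (le_of_eq ?_) hb
    rw [eLpNorm_congr_ae hu]
    rw [← eLpNorm_enorm (f := fun w => A w * gauss2 (w - z))]
    simp only [K, enorm_mul]
  have hAq : MemLp A q := by
    refine ⟨hA.aestronglyMeasurable, ?_⟩
    by_contra hc
    rw [not_lt, top_le_iff] at hc
    rw [hc, ENNReal.top_mul (eLpNorm_gauss2_ne_zero hq0)] at hnorm
    exact absurd hN (not_lt.2 hnorm)
  refine ⟨A, hAq, fun Φ => ?_, hnorm⟩
  -- The representation is recovered by averaging over `z`: a single localization only determines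
  -- `T` on Gaussian multiples of Schwartz functions, and `Φ` divided by a Gaussian need not be a
  -- Schwartz function.
  refine mul_left_cancel₀ (integral_gauss2_ne_zero (d := d)) ?_
  have hi := integrable_gauss2_mul_prod (integrable_schwartz_mul hq hAq Φ)
  calc _ = ∫ z, T (gaussMul z Φ) := integral_gaussMul T Φ
    _ = ∫ z, ∫ w, Φ w * A w * gauss2 (w - z) := by
      refine integral_congr_ae ?_
      filter_upwards [hkey] with z ⟨u, _, hTu, _, hu⟩
      rw [hTu]
      refine integral_congr_ae ?_
      filter_upwards [hu] with w hw
      rw [hw, mul_assoc]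
    _ = ∫ w, ∫ z, Φ w * A w * gauss2 (w - z) := integral_integral_swap hi
    _ = _ := by
      simp only [integral_const_mul]
      simp only [integral_sub_left_eq_self (fun z => gauss2 z) (volume : Measure (Rd d × Rd d))]
      rw [integral_mul_const, mul_comm]

theorem ae_lt_top_of_eLpNorm_lt_top {α : Type*} [MeasurableSpace α] {μ : Measure α}
    {N : α → ℝ≥0∞} (hN : AEStronglyMeasurable N μ) {q : ℝ≥0∞} (hq : q ≠ 0)
    (h : eLpNorm N q μ < ⊤) : ∀ᵐ x ∂μ, N x < ⊤ := by
  rcases eq_or_ne q ⊤ with rfl | ht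
  · rw [eLpNorm_top_ennreal] at h
    exact (ENNReal.ae_le_essSup N).mono fun x hx => hx.trans_lt h
  · have h0 := ENNReal.toReal_pos hq ht
    rw [eLpNorm_ennreal hq ht] at h
    have h1 : ∫⁻ x, N x ^ q.toReal ∂μ ≠ ⊤ := fun hc => by
      rw [hc, ENNReal.top_rpow_of_pos (by positivity)] at h
      exact h.ne rfl
    filter_upwards [ae_lt_top' (hN.aemeasurable.pow_const _) h1] with x hx
    exact (ENNReal.rpow_lt_top_iff_of_pos h0).1 hx

theorem measurable_eLpNorm_ambiguity (f₁ f₂ : 𝓢'(Rd d, ℂ)) {s : ℝ≥0∞} (hs0 : s ≠ 0) (hsT : s ≠ ⊤) :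
    Measurable fun z => eLpNorm (fun ζ => ambiguity f₁ f₂ (gaussAtom z ζ)) s volume := by
  simp only [eLpNorm_ambiguity_gaussAtom f₁ f₂ hs0 hsT]
  refine (Measurable.pow_const ?_ _).const_mul _
  refine Measurable.lintegral_prod_right' (f := fun p : (Rd d × Rd d) × (Rd d × Rd d) =>
    ‖stft gauss1 f₁ p.2.1 p.2.2‖ₑ ^ s.toReal *
      ‖stft gauss1 f₂ (p.2 - p.1).1 (p.2 - p.1).2‖ₑ ^ s.toReal) ?_
  exact (((continuous_stft gauss1 f₁).comp continuous_snd).enorm.measurable.pow_const _).mul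
    (((continuous_stft gauss1 f₂).comp (continuous_snd.sub continuous_fst)).enorm.measurable.pow_const _)

/-- Boundedness of the ambiguity function from modulation spaces into `L^q`. -/
theorem exists_memLp_ambiguity (g₁ g₂ : 𝓢(Rd d, ℂ)) (hg₁ : g₁ ≠ 0) (hg₂ : g₂ ≠ 0)
    {p₁ p₂ q₁ q₂ q : ℝ≥0∞} (hq : 2 ≤ q)
    (hp₁ : 1 ≤ p₁) (hp₂ : 1 ≤ p₂) (hq₁ : 1 ≤ q₁) (hq₂ : 1 ≤ q₂)
    (hp₁q : p₁ ≤ q) (hp₂q : p₂ ≤ q) (hq₁q : q₁ ≤ q) (hq₂q : q₂ ≤ q)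
    (hp : 1 ≤ p₁⁻¹ + p₂⁻¹) (hqq : 1 ≤ q₁⁻¹ + q₂⁻¹) :
    ∃ C : ℝ≥0, ∀ f₁ ∈ modulationSpace g₁ p₁ q₁, ∀ f₂ ∈ modulationSpace g₂ p₂ q₂,
      ∃ A : Rd d × Rd d → ℂ, MemLp A q volume ∧
        (∀ Φ : 𝓢(Rd d × Rd d, ℂ), ambiguity f₁ f₂ Φ = ∫ z, Φ z * A z) ∧
        eLpNorm A q volume ≤ C * modulationNorm g₁ p₁ q₁ f₁ * modulationNorm g₂ p₂ q₂ f₂ := by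
  have h1q : 1 ≤ q := one_le_two.trans hq
  have hq0 : q ≠ 0 := (zero_lt_one.trans_le h1q).ne'
  have hqi : q⁻¹ ≤ 2⁻¹ := ENNReal.inv_le_inv.2 hq
  have hqi1 : q⁻¹ ≤ 1 := ENNReal.inv_le_one.2 h1q
  -- This is the conjugate exponent of `q`. The assumption `2 ≤ q` gives `s ≤ 2`, so Hausdorff–Young
  -- maps `L^s` to `L^q`.
  obtain ⟨s, hsdef⟩ : ∃ s : ℝ≥0∞, s = (1 - q⁻¹)⁻¹ := ⟨_, rfl⟩
  have hsq1 : s⁻¹ + q⁻¹ = 1 := by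
    rw [hsdef, inv_inv]
    exact tsub_add_cancel_of_le hqi1
  have hs1 : 1 ≤ s := by
    rw [hsdef, ENNReal.one_le_inv]
    exact tsub_le_self
  have hs2 : s ≤ 2 := by
    rw [hsdef, ENNReal.inv_le_iff_inv_le, ← ENNReal.one_sub_inv_two]
    exact tsub_le_tsub_left hqi _
  have hsT : s ≠ ⊤ := (hs2.trans_lt ENNReal.ofNat_lt_top).ne
  have hs0 : s ≠ 0 := (zero_lt_one.trans_le hs1).ne'
  obtain ⟨C₁, hC₁, h₁⟩ := eLpNorm_eLpNorm_ambiguity_le g₁ g₂ hg₁ hg₂ hs1 hsT (hs2.trans hq) hsq1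
    hp₁ hp₂ hq₁ hq₂ hp₁q hp₂q hq₁q hq₂q hp hqq
  obtain ⟨C₂, hC₂, h₂⟩ := hausdorff_young_prod (d := d) hs1 hs2 hsq1
  have hG0 := eLpNorm_gauss2_ne_zero (d := d) hq0
  have hGT : eLpNorm (gauss2 (d := d)) q volume ≠ ⊤ := (gauss2.memLp q volume).2.ne
  have hCT : (eLpNorm (gauss2 (d := d)) q volume)⁻¹ * (C₂ * C₁) ≠ ⊤ :=
    ENNReal.mul_ne_top (ENNReal.inv_ne_top.2 hG0) (ENNReal.mul_ne_top hC₂ hC₁)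
  refine ⟨((eLpNorm (gauss2 (d := d)) q volume)⁻¹ * (C₂ * C₁)).toNNReal, fun f₁ hf₁ f₂ hf₂ => ?_⟩
  set N : Rd d × Rd d → ℝ≥0∞ := fun z =>
    eLpNorm (fun ζ => ambiguity f₁ f₂ (gaussAtom z ζ)) s volume with hNdef
  have hN : eLpNorm N q volume < ⊤ := (h₁ f₁ f₂).trans_lt
    (ENNReal.mul_lt_top (ENNReal.mul_lt_top hC₁.lt_top hf₁) hf₂)
  have hCN : eLpNorm (fun z => C₂ * N z) q volume = C₂ * eLpNorm N q volume :=
    eLpNorm_const_mul_ennreal _ hC₂ _ _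
  -- A finite `L^q` norm of `N` gives finiteness of `N z` for almost every `z` only, so
  -- Hausdorff–Young is applied at those `z`.
  have hNae := ae_lt_top_of_eLpNorm_lt_top
    (measurable_eLpNorm_ambiguity f₁ f₂ hs0 hsT).aestronglyMeasurable hq0 hN
  obtain ⟨A, hA, hTA, hAn⟩ := exists_memLp_of_localization (toCLM (ambiguity f₁ f₂)) h1q
    (fun z => C₂ * N z) (hCN ▸ ENNReal.mul_lt_top hC₂.lt_top hN) (by
      filter_upwards [hNae] with z hz
      obtain ⟨u, hu, hF, hb⟩ := h₂ _ (memLp_ambiguity_gaussAtom f₁ f₂ hz)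
      refine ⟨u, hu, fun χ => ?_, hb⟩
      rw [hF, toCLM_apply]
      exact integral_fourierInv2_mul_ambiguity f₁ f₂ z χ)
  refine ⟨A, hA, fun Φ => hTA Φ, ?_⟩
  rw [ENNReal.coe_toNNReal hCT]
  calc eLpNorm A q volume
      = (eLpNorm (gauss2 (d := d)) q volume)⁻¹ *
        (eLpNorm A q volume * eLpNorm (gauss2 (d := d)) q volume) := by
        rw [mul_comm, mul_assoc, ENNReal.mul_inv_cancel hG0 hGT, mul_one]
    _ ≤ (eLpNorm (gauss2 (d := d)) q volume)⁻¹ * (C₂ *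
        (C₁ * modulationNorm g₁ p₁ q₁ f₁ * modulationNorm g₂ p₂ q₂ f₂)) := by
        exact mul_le_mul_right
          (hAn.trans (hCN.le.trans (mul_le_mul_right (h₁ f₁ f₂) _))) _
    _ = _ := by ring

end TimeFreq
end

theorem corollary4p4 (d : ℕ) (p₁ p₂ q₁ q₂ q : ℝ≥0∞)
    (hp₁ : 1 ≤ p₁) (hp₂ : 1 ≤ p₂) (hq₁ : 1 ≤ q₁) (hq₂ : 1 ≤ q₂) (hq : 2 ≤ q)
    (hp₁q : p₁ ≤ q) (hp₂q : p₂ ≤ q) (hq₁q : q₁ ≤ q) (hq₂q : q₂ ≤ q)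
    (hp : 1 ≤ 1 / p₁ + 1 / p₂) (hqq : 1 ≤ 1 / q₁ + 1 / q₂)
    (g₁ g₂ : 𝓢(Rd d, ℂ)) (hg₁ : g₁ ≠ 0) (hg₂ : g₂ ≠ 0) :
    ∃ C : ℝ≥0, ∀ f₁ ∈ modulationSpace g₁ p₁ q₁, ∀ f₂ ∈ modulationSpace g₂ p₂ q₂,
      ∃ A : Rd d × Rd d → ℂ, MemLp A q volume ∧
        (∀ Φ : 𝓢(Rd d × Rd d, ℂ), ambiguity f₁ f₂ Φ = ∫ z, Φ z * A z) ∧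
        eLpNorm A q volume ≤ C * modulationNorm g₁ p₁ q₁ f₁ * modulationNorm g₂ p₂ q₂ f₂ := by
  simp only [one_div] at hp hqq
  exact exists_memLp_ambiguity g₁ g₂ hg₁ hg₂ hq hp₁ hp₂ hq₁ hq₂ hp₁q hp₂q hq₁q hq₂q hp hqq
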